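/- **Data.** For $n,k\ge 0$ let $a_n(k)>0$ be weights such that $s(n)=\sum_{k\ge0}1/a_n(k)<\infty$ for all $n$ and $s(n)\to0$ as $n\to\infty$. Let $0<c_{1,n}(k),c_{2,n}(k)\le 1$ be such that for every $n$ the products $\prod_k c_{1,n}(k)$, $\prod_k c_{2,n}(k)$ converge to nonzero limits, and such that for some constant $\kappa$ one has $1\le 1/c_{i,n}(k)\le\kappa$ for all $i,n,k$. **Hilbert space.** On $\ell^2(\mathbb Z_{\ge0}\times\mathbb Z)$ with canonical basis $e_{k,l}$ let $Ue_{k,l}=e^{-2\pi i l\theta}e_{k+1,l}$, $Ve_{k,l}=e_{k,l+1}$ and $\mathbb K e_{k,l}=ke_{k,l}$; the $C^*$-algebra generated by $U,V$ is the quantum solid torus. Let $\mathcal H_0$ be the Hilbert space of formal series $$f=\sum_{n\ge0,\,m\in\mathbb Z}V^mU^nf^+_{m,n}(\mathbb K)+\sum_{n\ge1,\,m\in\mathbb Z}f^-_{m,n}(\mathbb K)V^m(U^*)^n,\qquad \|f\|^2=\sum_{k}\Big(\sum_{n\ge0,m}\frac{|f^+_{m,n}(k)|^2}{a_n(k)}+\sum_{n\ge1,m}\frac{|f^-_{m,n}(k)|^2}{a_n(k)}\Big)<\infty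 .$$ Since $V$ commutes with functions of $\mathbb K$, the terms with $n=0$ may be counted with either sum; put $f^-_{m,0}:=f^+_{m,0}$. Let $\mathcal H=\mathcal H_0\otimes\mathbb C^2$. **The operator.** Put $B_nh(k)=a_n(k)\big(h(k)-c_{2,n}(k-1)h(k-1)\big)$ with $h(-1)=0$, and $\overline B_nh(k)=a_{n+1}(k)\big(h(k)-c_{1,n}(k)h(k+1)\big)$. On formal series define $$\delta_0f=-\sum_{n\ge0,m}V^mU^{n+1}(\overline B_nf^+_{m,n})(\mathbb K)+\sum_{n\ge1,m}(B_{n-1}f^-_{m,n})(\mathbb K)V^m(U^*)^{n-1},$$ $$\delta_2f=-\sum_{n\ge1,m}V^mU^{n-1}(B_{n-1}f^+_{m,n})(\mathbb K)+\sum_{n\ge0,m}(\overline B_nf^-_{m,n})(\mathbb K)V^m(U^*)^{n+1},$$ $$\delta_1f=\sum_{n\ge0,m}mV^mU^nf^+_{m,n}(\mathbb K)+\sum_{n\ge1,m}mf^-_{m,n}(\mathbb K)V^m(U^*)^n,$$ and $$D=\begin{pmatrix}\delta_1&\delta_0\\ \delta_2&-\delta_1\end{pmatrix}.$$ **Quantum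 $K$ functions.** For $m\in\mathbb Z$ and $n,k\ge0$ let $$C_{m,n}(k)=\begin{pmatrix}\dfrac1{c_{1,n}(k)}&\dfrac{-m}{a_{n+1}(k)c_{1,n}(k)}\\[2mm] \dfrac{-m}{a_n(k+1)c_{1,n}(k)}&c_{2,n}(k)+\dfrac{m^2}{a_n(k+1)a_{n+1}(k)c_{1,n}(k)}\end{pmatrix}.$$ A quantum $K$ function is a family of vectors $K_{m,n}(k)\in\mathbb R^2$ with $K_{m,n}(k)=C_{m,n}(k-1)\cdots C_{m,n}(0)K_{m,n}(0)$ whose limits $K_{m,n}(\infty)=\lim_{k\to\infty}K_{m,n}(k)$ satisfy 1. $K^{(1)}_{m,n}(\infty)>0$ and $K^{(2)}_{m,n}(\infty)>0$ for $m>0$; 2. $K^{(1)}_{m,n}(\infty)<0$ and $K^{(2)}_{m,n}(\infty)>0$ for $m<0$; 3. $K^{(1)}_{0,n}(\infty)=0$ and $K^{(2)}_{0,n}(\infty)\ne0$; 4. $K^{(1)}_{m,n}(\infty)/K^{(2)}_{m,n}(\infty)\to0$ as $|m|\to\infty$ in the supremum norm over $n$: for every $m\neq0$ the number $\sup_{n\ge0}\big|K^{(1)}_{m,n}(\infty)/K^{(2)}_{m,n}(\infty)\big|$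 is finite, and it tends to $0$ as $|m|\to\infty$. **Boundary condition.** Let $K$ and $K'$ be quantum $K$ functions (possibly equal). Let $\operatorname{dom}(D)$ be the space of all $F=(f,g)^t\in\mathcal H$ with $DF\in\mathcal H$ such that for all $m\in\mathbb Z$ and $n\ge0$ there are $\beta_{m,n},\beta'_{m,n}\in\mathbb C$ with $$\lim_{k\to\infty}g^+_{m,n}(k)=\beta_{m,n}K^{(1)}_{m,n}(\infty),\qquad \lim_{k\to\infty}f^+_{m,n+1}(k)=\beta_{m,n}K^{(2)}_{m,n}(\infty),$$ $$\lim_{k\to\infty}f^-_{m,n}(k)=\beta'_{m,n}K'^{(1)}_{m,n}(\infty),\qquad \lim_{k\to\infty}g^-_{m,n+1}(k)=\beta'_{m,n}K'^{(2)}_{m,n}(\infty).$$ **Theorem.** The operator $D:\operatorname{dom}(D)\to\mathcal H$ is invertible, and its inverse is a compact operator: there is a compact bounded operator $Q$ on $\mathcal H$ such that $QG\in\operatorname{dom}(D)$ and $DQG=G$ for all $G\in\mathcal H$, and $QDF=F$ for all $F\in\operatorname{dom}(D)$. -/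

import Mathlib

open Filter Topology

noncomputable section

namespace QuantumSolidTorus

/-- The standing data: weights `a n k = a_n(k)` and coefficients `c₁ n k = c_{1,n}(k)`,
`c₂ n k = c_{2,n}(k)`, with `s(n) = ∑ₖ 1 / a_n(k)` finite and tending to zero, `0 < c_{i,n}(k) ≤ 1`,
convergent products `∏ₖ c_{i,n}(k) ≠ 0`, and `1 / c_{i,n}(k) ≤ κ` for one constant `κ`. -/
structure DiracData where
  a : ℕ → ℕ → ℝ
  c₁ : ℕ → ℕ → ℝ
  c₂ : ℕ → ℕ → ℝ
  a_pos : ∀ n k, 0 < a n k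
  a_summable : ∀ n, Summable fun k => 1 / a n k
  a_tendsto : Tendsto (fun n => ∑' k, 1 / a n k) atTop (𝓝 0)
  c₁_pos : ∀ n k, 0 < c₁ n k
  c₂_pos : ∀ n k, 0 < c₂ n k
  c₁_le_one : ∀ n k, c₁ n k ≤ 1
  c₂_le_one : ∀ n k, c₂ n k ≤ 1
  c₁_prod : ∀ n, ∃ J : ℝ, J ≠ 0 ∧
    Tendsto (fun N => ∏ k ∈ Finset.range N, c₁ n k) atTop (𝓝 J)
  c₂_prod : ∀ n, ∃ J : ℝ, J ≠ 0 ∧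
    Tendsto (fun N => ∏ k ∈ Finset.range N, c₂ n k) atTop (𝓝 J)
  c_bound : ∃ κ : ℝ, ∀ n k, 1 / c₁ n k ≤ κ ∧ 1 / c₂ n k ≤ κ

/-- Index `(m, ν, k)` of a coefficient of a formal series
`∑_{n ≥ 0, m} V^m U^n f⁺_{m,n}(𝕂) + ∑_{n ≥ 1, m} f⁻_{m,n}(𝕂) V^m (U^*)^n`:
`f (m, ν, k)` is `f⁺_{m,ν}(k)` if `ν ≥ 0` and `f⁻_{m,-ν}(k)` if `ν ≤ 0`. The two readings at `ν = 0`
agree, because `V` commutes with functions of `𝕂`. -/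
abbrev Idx : Type := ℤ × ℤ × ℕ

/-- A formal series is the family of its coefficients. -/
abbrev FormalSeries : Type := Idx → ℂ

variable (d : DiracData)

/-- The weight `a_n(k)` belonging to the coefficient with index `(m, ±n, k)`. -/
def wt (i : Idx) : ℝ := d.a i.2.1.natAbs i.2.2

theorem wt_pos (i : Idx) : 0 < wt d i := d.a_pos _ _

/-- The norm is finite: `∑ |f_{m,n}^±(k)|² / a_n(k) < ∞`. -/
def FiniteNorm (f : FormalSeries) : Prop := Summable fun i => ‖f i‖ ^ 2 / wt d i

theorem norm_scaled_sq (f : FormalSeries) (i : Idx) :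
    ‖f i / (√(wt d i) : ℂ)‖ ^ 2 = ‖f i‖ ^ 2 / wt d i := by
  rw [norm_div, div_pow, Complex.norm_real, Real.norm_of_nonneg (Real.sqrt_nonneg _),
    Real.sq_sqrt (wt_pos d i).le]

theorem finiteNorm_iff (f : FormalSeries) :
    FiniteNorm d f ↔ Memℓp (fun i => f i / (√(wt d i) : ℂ)) 2 := by
  rw [memℓp_gen_iff (by norm_num)]
  simp only [FiniteNorm, ENNReal.toReal_ofNat, Real.rpow_ofNat, norm_scaled_sq]

/-- The formal series of finite norm, as a linear subspace of all formal series. -/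
def finiteNormSubmodule : Submodule ℂ FormalSeries where
  carrier := {f | FiniteNorm d f}
  zero_mem' := by simp [FiniteNorm, summable_zero]
  add_mem' {f g} hf hg := by
    change FiniteNorm d _ at *
    rw [finiteNorm_iff] at *
    convert hf.add hg using 1
    funext i
    simp [add_div]
  smul_mem' c f hf := by
    change FiniteNorm d _ at *
    rw [finiteNorm_iff] at *
    convert hf.const_smul c using 1
    funext i
    simp [mul_div_assoc]

/-- The Hilbert space `𝓗₀` of formal series of finite norm. -/
def H0 : Type := finiteNormSubmodule d

instance : AddCommGroup (H0 d) := inferInstanceAs (AddCommGroup (finiteNormSubmodule d))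

instance : Module ℂ (H0 d) := inferInstanceAs (Module ℂ (finiteNormSubmodule d))

variable {d}

/-- The coefficients of an element of `𝓗₀`. -/
def H0.coeff : H0 d →ₗ[ℂ] FormalSeries := (finiteNormSubmodule d).subtype

theorem H0.coeff_finiteNorm (f : H0 d) : FiniteNorm d f.coeff := f.2

/-- The element of `𝓗₀` with given coefficients. -/
def H0.mk (f : FormalSeries) (hf : FiniteNorm d f) : H0 d := ⟨f, hf⟩

@[simp] theorem H0.coeff_mk (f : FormalSeries) (hf : FiniteNorm d f) :
    (H0.mk f hf).coeff = f := rfl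

theorem H0.ext {f g : H0 d} (h : f.coeff = g.coeff) : f = g := Subtype.ext h

/-- Division by the square roots of the weights identifies `𝓗₀` with an unweighted `ℓ²` space;
the Hilbert space structure of `𝓗₀` is the one transported along this identification
(see `H0.norm_sq_eq`). -/
def H0.scale : H0 d ≃ₗ[ℂ] lp (fun _ : Idx => ℂ) 2 where
  toFun f := ⟨fun i => f.coeff i / (√(wt d i) : ℂ), (finiteNorm_iff d _).1 f.2⟩
  map_add' f g := by
    ext i
    simp [add_div]
    rfl
  map_smul' c f := by
    ext i
    simp [mul_div_assoc]
  invFun φ := H0.mk (fun i => (√(wt d i) : ℂ) * φ i) (by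
    rw [finiteNorm_iff]
    have hφ := lp.memℓp φ
    convert hφ using 2 with i
    have : (√(wt d i) : ℂ) ≠ 0 := by
      exact_mod_cast (Real.sqrt_pos.2 (wt_pos d i)).ne'
    field_simp)
  left_inv f := by
    apply H0.ext
    funext i
    have : (√(wt d i) : ℂ) ≠ 0 := by
      exact_mod_cast (Real.sqrt_pos.2 (wt_pos d i)).ne'
    simp only [H0.coeff_mk]
    field_simp
  right_inv φ := by
    ext i
    have : (√(wt d i) : ℂ) ≠ 0 := by
      exact_mod_cast (Real.sqrt_pos.2 (wt_pos d i)).ne'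
    simp only [H0.coeff_mk]
    field_simp

instance : NormedAddCommGroup (H0 d) :=
  NormedAddCommGroup.induced (H0 d) (lp (fun _ : Idx => ℂ) 2) H0.scale H0.scale.injective

theorem H0.norm_def (f : H0 d) : ‖f‖ = ‖H0.scale f‖ := rfl

instance : InnerProductSpace ℂ (H0 d) where
  norm_smul_le c f := by
    rw [H0.norm_def, H0.norm_def, map_smul, norm_smul]
  inner f g := inner ℂ (H0.scale f) (H0.scale g)
  norm_sq_eq_re_inner f := by
    rw [H0.norm_def]
    exact norm_sq_eq_re_inner (𝕜 := ℂ) (H0.scale f)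
  conj_inner_symm f g := inner_conj_symm _ _
  add_left f g h := by simp only [map_add, inner_add_left]
  smul_left f g c := by simp only [map_smul, inner_smul_left]

/-- `‖f‖² = ∑ |f_{m,n}^±(k)|² / a_n(k)`. -/
theorem H0.norm_sq_eq (f : H0 d) : ‖f‖ ^ 2 = ∑' i, ‖f.coeff i‖ ^ 2 / wt d i := by
  have h := lp.norm_rpow_eq_tsum (p := 2) (by norm_num) (H0.scale f)
  simp only [ENNReal.toReal_ofNat, Real.rpow_ofNat] at h
  rw [H0.norm_def, h]
  exact tsum_congr fun i => norm_scaled_sq d _ i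

instance : CompleteSpace (H0 d) := by
  let e : H0 d ≃ₗᵢ[ℂ] lp (fun _ : Idx => ℂ) 2 := ⟨H0.scale, fun f => (H0.norm_def f).symm⟩
  exact (completeSpace_congr (e := e.toEquiv) e.isometry.isUniformEmbedding).2 inferInstance

variable (d)

/-- The Hilbert space `𝓗 = 𝓗₀ ⊗ ℂ²`, that is, the Hilbert space sum of two copies of `𝓗₀`. -/
abbrev H : Type := WithLp 2 (H0 d × H0 d)

/-- `B_n h(k) = a_n(k) (h(k) - c_{2,n}(k-1) h(k-1))`, with `h(-1) = 0`. -/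
def B (n : ℕ) (h : ℕ → ℂ) : ℕ → ℂ
  | 0 => d.a n 0 * h 0
  | k + 1 => d.a n (k + 1) * (h (k + 1) - d.c₂ n k * h k)

/-- `B̄_n h(k) = a_{n+1}(k) (h(k) - c_{1,n}(k) h(k+1))`. -/
def Bbar (n : ℕ) (h : ℕ → ℂ) (k : ℕ) : ℂ :=
  d.a (n + 1) k * (h k - d.c₁ n k * h (k + 1))

theorem B_add (n : ℕ) (h h' : ℕ → ℂ) (k : ℕ) :
    B d n (fun j => h j + h' j) k = B d n h k + B d n h' k := by
  cases k <;> simp only [B] <;> ring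

theorem B_smul (n : ℕ) (c : ℂ) (h : ℕ → ℂ) (k : ℕ) :
    B d n (fun j => c * h j) k = c * B d n h k := by
  cases k <;> simp only [B] <;> ring

/-- `δ₀ f = -∑_{n ≥ 0} V^m U^{n+1} B̄_n f⁺_{m,n}(𝕂) + ∑_{n ≥ 1} B_{n-1} f⁻_{m,n}(𝕂) V^m (U^*)^{n-1}`
on formal series. -/
def delta0 : FormalSeries →ₗ[ℂ] FormalSeries where
  toFun f := fun (m, ν, k) =>
    if 1 ≤ ν then -Bbar d (ν - 1).toNat (fun j => f (m, ν - 1, j)) k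
    else B d (-ν).toNat (fun j => f (m, ν - 1, j)) k
  map_add' f g := by
    funext ⟨m, ν, k⟩
    simp only [Pi.add_apply, B_add, Bbar]
    split_ifs <;> ring
  map_smul' c f := by
    funext ⟨m, ν, k⟩
    simp only [Pi.smul_apply, smul_eq_mul, B_smul, Bbar, RingHom.id_apply]
    split_ifs <;> ring

/-- `δ₂ f = -∑_{n ≥ 1} V^m U^{n-1} B_{n-1} f⁺_{m,n}(𝕂) + ∑_{n ≥ 0} B̄_n f⁻_{m,n}(𝕂) V^m (U^*)^{n+1}`
on formal series. -/
def delta2 : FormalSeries →ₗ[ℂ] FormalSeries where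
  toFun f := fun (m, ν, k) =>
    if 0 ≤ ν then -B d ν.toNat (fun j => f (m, ν + 1, j)) k
    else Bbar d (-ν - 1).toNat (fun j => f (m, ν + 1, j)) k
  map_add' f g := by
    funext ⟨m, ν, k⟩
    simp only [Pi.add_apply, B_add, Bbar]
    split_ifs <;> ring
  map_smul' c f := by
    funext ⟨m, ν, k⟩
    simp only [Pi.smul_apply, smul_eq_mul, B_smul, Bbar, RingHom.id_apply]
    split_ifs <;> ring

/-- `δ₁ f = ∑ m V^m U^n f⁺_{m,n}(𝕂) + ∑ m f⁻_{m,n}(𝕂) V^m (U^*)^n` on formal series. -/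
def delta1 : FormalSeries →ₗ[ℂ] FormalSeries where
  toFun f := fun (m, ν, k) => (m : ℂ) * f (m, ν, k)
  map_add' f g := by
    funext ⟨m, ν, k⟩
    simp only [Pi.add_apply]
    ring
  map_smul' c f := by
    funext ⟨m, ν, k⟩
    simp only [Pi.smul_apply, smul_eq_mul, RingHom.id_apply]
    ring

/-- First component `δ₁ f + δ₀ g` of `D (f, g)`, as a formal series. -/
def diracFst : H d →ₗ[ℂ] FormalSeries where
  toFun F := delta1 F.fst.coeff + delta0 d F.snd.coeff
  map_add' F G := by
    simp only [WithLp.add_fst, WithLp.add_snd, map_add]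
    abel
  map_smul' c F := by
    simp only [WithLp.smul_fst, WithLp.smul_snd, map_smul, RingHom.id_apply, smul_add]

/-- Second component `δ₂ f - δ₁ g` of `D (f, g)`, as a formal series. -/
def diracSnd : H d →ₗ[ℂ] FormalSeries where
  toFun F := delta2 d F.fst.coeff - delta1 F.snd.coeff
  map_add' F G := by
    simp only [WithLp.add_fst, WithLp.add_snd, map_add]
    abel
  map_smul' c F := by
    simp only [WithLp.smul_fst, WithLp.smul_snd, map_smul, RingHom.id_apply, smul_sub]

/-- The matrix `C_{m,n}(k)`. -/
def C (m : ℤ) (n k : ℕ) : Matrix (Fin 2) (Fin 2) ℝ :=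
  !![1 / d.c₁ n k, -m / (d.a (n + 1) k * d.c₁ n k);
     -m / (d.a n (k + 1) * d.c₁ n k),
       d.c₂ n k + (m : ℝ) ^ 2 / (d.a n (k + 1) * d.a (n + 1) k * d.c₁ n k)]

/-- The ordered product `C_{m,n}(k-1) ⋯ C_{m,n}(0)`. -/
def prodC (m : ℤ) (n : ℕ) : ℕ → Matrix (Fin 2) (Fin 2) ℝ
  | 0 => 1
  | k + 1 => C d m n k * prodC m n k

/-- A quantum `K` function: a family of vectors `K_{m,n}(k) = C_{m,n}(k-1) ⋯ C_{m,n}(0) K_{m,n}(0)`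
whose limits `K_{m,n}(∞)` satisfy the sign conditions and for which
`K⁽¹⁾_{m,n}(∞) / K⁽²⁾_{m,n}(∞)` tends to `0` as `|m| → ∞`, uniformly in `n` (it has a bound
depending only on `m` which tends to `0`). The entries `0` and `1` of `Fin 2` are the first and
second component. -/
structure QuantumK where
  val : ℤ → ℕ → ℕ → Fin 2 → ℝ
  lim : ℤ → ℕ → Fin 2 → ℝ
  val_eq : ∀ m n k, val m n k = (prodC d m n k).mulVec (val m n 0)
  tendsto_lim : ∀ m n, Tendsto (fun k => val m n k) atTop (𝓝 (lim m n))
  sign_pos : ∀ m n, 0 < m → 0 < lim m n 0 ∧ 0 < lim m n 1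
  sign_neg : ∀ m n, m < 0 → lim m n 0 < 0 ∧ 0 < lim m n 1
  sign_zero : ∀ n, lim 0 n 0 = 0 ∧ lim 0 n 1 ≠ 0
  ratio : ∃ ρ : ℤ → ℝ, Tendsto ρ cofinite (𝓝 0) ∧
    ∀ m, m ≠ 0 → ∀ n, |lim m n 0 / lim m n 1| ≤ ρ m

variable {d}

/-- `x(∞) = β K⁽¹⁾_{m,n}(∞)` and `y(∞) = β K⁽²⁾_{m,n}(∞)` for some `β ∈ ℂ`. -/
def BoundaryCondition (K : QuantumK d) (m : ℤ) (n : ℕ) (x y : ℕ → ℂ) : Prop :=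
  ∃ β : ℂ, Tendsto x atTop (𝓝 (β * K.lim m n 0)) ∧ Tendsto y atTop (𝓝 (β * K.lim m n 1))

theorem BoundaryCondition.zero (K : QuantumK d) (m : ℤ) (n : ℕ) :
    BoundaryCondition K m n (fun _ => 0) (fun _ => 0) :=
  ⟨0, by simp, by simp⟩

theorem BoundaryCondition.add {K : QuantumK d} {m : ℤ} {n : ℕ} {x y x' y' : ℕ → ℂ}
    (h : BoundaryCondition K m n x y) (h' : BoundaryCondition K m n x' y') :
    BoundaryCondition K m n (fun k => x k + x' k) (fun k => y k + y' k) := by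
  obtain ⟨β, hx, hy⟩ := h
  obtain ⟨β', hx', hy'⟩ := h'
  refine ⟨β + β', ?_, ?_⟩
  · rw [add_mul]; exact hx.add hx'
  · rw [add_mul]; exact hy.add hy'

theorem BoundaryCondition.smul {K : QuantumK d} {m : ℤ} {n : ℕ} {x y : ℕ → ℂ} (c : ℂ)
    (h : BoundaryCondition K m n x y) :
    BoundaryCondition K m n (fun k => c * x k) (fun k => c * y k) := by
  obtain ⟨β, hx, hy⟩ := h
  refine ⟨c * β, ?_, ?_⟩
  · rw [mul_assoc]; exact hx.const_mul c
  · rw [mul_assoc]; exact hy.const_mul c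

/-- The domain of `D`: all `F = (f, g) ∈ 𝓗` with `D F ∈ 𝓗` such that `(g⁺_{m,n}, f⁺_{m,n+1})`
satisfies the boundary condition given by `Kp` and `(f⁻_{m,n}, g⁻_{m,n+1})` the one given by `Kn`,
for all `m ∈ ℤ` and `n ≥ 0`. -/
def diracDomain (Kp Kn : QuantumK d) : Submodule ℂ (H d) where
  carrier := {F | (FiniteNorm d (diracFst d F) ∧ FiniteNorm d (diracSnd d F)) ∧
    (∀ (m : ℤ) (n : ℕ), BoundaryCondition Kp m n
      (fun k => F.snd.coeff (m, n, k)) (fun k => F.fst.coeff (m, n + 1, k))) ∧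
    (∀ (m : ℤ) (n : ℕ), BoundaryCondition Kn m n
      (fun k => F.fst.coeff (m, -n, k)) (fun k => F.snd.coeff (m, -(n + 1), k)))}
  zero_mem' := by
    refine ⟨⟨?_, ?_⟩, fun m n => ?_, fun m n => ?_⟩
    · rw [map_zero]; exact (finiteNormSubmodule d).zero_mem
    · rw [map_zero]; exact (finiteNormSubmodule d).zero_mem
    · simpa using BoundaryCondition.zero Kp m n
    · simpa using BoundaryCondition.zero Kn m n
  add_mem' {F G} hF hG := by
    refine ⟨⟨?_, ?_⟩, fun m n => ?_, fun m n => ?_⟩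
    · rw [map_add]; exact (finiteNormSubmodule d).add_mem hF.1.1 hG.1.1
    · rw [map_add]; exact (finiteNormSubmodule d).add_mem hF.1.2 hG.1.2
    · simpa using (hF.2.1 m n).add (hG.2.1 m n)
    · simpa using (hF.2.2 m n).add (hG.2.2 m n)
  smul_mem' c F hF := by
    refine ⟨⟨?_, ?_⟩, fun m n => ?_, fun m n => ?_⟩
    · rw [map_smul]; exact (finiteNormSubmodule d).smul_mem c hF.1.1
    · rw [map_smul]; exact (finiteNormSubmodule d).smul_mem c hF.1.2
    · simpa using (hF.2.1 m n).smul c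
    · simpa using (hF.2.2 m n).smul c

/-- The quantum Dirac type operator `D = (δ₁, δ₀; δ₂, -δ₁)`, an unbounded operator in `𝓗` with the
domain `diracDomain Kp Kn`. -/
def dirac (Kp Kn : QuantumK d) : H d →ₗ.[ℂ] H d where
  domain := diracDomain Kp Kn
  toFun :=
    { toFun := fun F => WithLp.toLp 2
        (H0.mk (diracFst d F) F.2.1.1, H0.mk (diracSnd d F) F.2.1.2)
      map_add' := fun F G => by
        apply (WithLp.equiv 2 (H0 d × H0 d)).injective
        refine Prod.ext (H0.ext ?_) (H0.ext ?_)
        · exact map_add (diracFst d) (F : H d) (G : H d)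
        · exact map_add (diracSnd d) (F : H d) (G : H d)
      map_smul' := fun c F => by
        apply (WithLp.equiv 2 (H0 d × H0 d)).injective
        refine Prod.ext (H0.ext ?_) (H0.ext ?_)
        · exact map_smul (diracFst d) c (F : H d)
        · exact map_smul (diracSnd d) c (F : H d) }

end QuantumSolidTorus

end

/-!
The operator `D` couples the row `f_{m,ν}` only with the row `g_{m,ν-1}`. With `n = ν - 1` for
`ν ≥ 1` and `n = -ν` for `ν ≤ 0` the equation `D F = G` becomes, for each such pair, one and the
same system `B̄_n x - m y = r`, `B_n y + m x = s` with a boundary condition at infinity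
(`ModeSystem`, `pairSystem_succ`, `pairSystem_neg`). Changing signs one may take `m ≥ 0` and both
components of the `K` function nonnegative; this is a `Mode`.

For one mode there are two homogeneous solutions: `(I₁, -I₂)`, regular at `k = 0`, and `(K₁, K₂)`,
which satisfies the boundary condition. All of `I₁, I₂, K₁, K₂` are nonnegative, because the forward
recursion for `(I₁, I₂)` and the backward recursion for `(K₁, K₂)` have nonnegative coefficients.
Multiplying by the `gauge` factor `∏ c₁ / c₂` gives solutions of the adjoint system, in which `c₁`
and `c₂` are interchanged, and the pairing of a solution with an adjoint one is constant. Variation of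
constants then solves the system (`Mode.exists_isSol`), and expresses every solution satisfying the
boundary condition through triangular kernels `K_a(k) I_b(j)` (`Mode.fst_eq`, `Mode.snd_eq`).

These kernels are estimated by Schur tests based on telescoping sums such as
`∑ m p K₁ ≤ K₂` and `∑ m q I₂ ≤ I₁` (`GreenPair`). The outcome, `Mode.IsSol.apriori`, bounds the
squared norm of the solution operator by a multiple of `s(n) (ρ + s(n + 1))`, where `ρ` bounds
`K₁ / K₂` at infinity for `m ≠ 0`. It is uniform in `m` and tends to zero as `n → ∞`. For fixed `n`
an energy identity, whose boundary term has a favourable sign, gives the bound `O(1 / |m|)`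
(`Mode.IsSol.energy`). Hence the norms of the solution operators of the modes tend to zero
(`exists_mode_bound`). Each of them is compact, since solutions are bounded pointwise by the data
while the weights are summable (`Mode.exists_tail_bound`). So the inverse of `D` exists, and the
coefficients of its values have uniformly small tails, which means that it is compact
(`isCompactOperator_of_tails`).
-/

noncomputable section

namespace QuantumSolidTorus

/-! ### Schur tests for triangular kernels -/

/-- **Schur test** for a nonnegative kernel between two weighted `ℓ²` spaces. -/
theorem schur_test {ι κ : Type*} (S : Finset ι) (T : Finset κ) (N : ι → κ → ℝ)
    (ν e : ι → ℝ) (μ h : κ → ℝ) {α β : ℝ} (hN : ∀ i j, 0 ≤ N i j) (hν : ∀ i, 0 ≤ ν i)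
    (hμ : ∀ j, 0 ≤ μ j) (hh : ∀ j, 0 ≤ h j) (hα : 0 ≤ α) (hβ : 0 ≤ β)
    (hzero : ∀ i j, h j = 0 → N i j = 0)
    (hrow : ∀ i ∈ S, ∑ j ∈ T, N i j * (μ j * h j) ≤ α * e i)
    (hcol : ∀ j ∈ T, ∑ i ∈ S, N i j * (ν i * e i) ≤ β * h j) (f : κ → ℝ) :
    ∑ i ∈ S, ν i * (∑ j ∈ T, N i j * (μ j * f j)) ^ 2 ≤ α * β * ∑ j ∈ T, μ j * f j ^ 2 := by
  have hcs : ∀ i ∈ S, (∑ j ∈ T, N i j * (μ j * f j)) ^ 2 ≤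
      α * e i * ∑ j ∈ T, N i j * (μ j * (f j ^ 2 / h j)) := by
    intro i hi
    refine (Finset.sum_sq_le_sum_mul_sum_of_sq_le_mul T
      (f := fun j => N i j * (μ j * h j)) (g := fun j => N i j * (μ j * (f j ^ 2 / h j)))
      ?_ ?_ ?_).trans (mul_le_mul_of_nonneg_right (hrow i hi) ?_)
    · exact fun j _ => mul_nonneg (hN i j) (mul_nonneg (hμ j) (hh j))
    · exact fun j _ => mul_nonneg (hN i j) (mul_nonneg (hμ j) (div_nonneg (sq_nonneg _) (hh j)))
    · intro j _
      by_cases h0 : h j = 0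
      · simp [hzero i j h0]
      · exact le_of_eq (by field_simp)
    · exact Finset.sum_nonneg fun j _ =>
        mul_nonneg (hN i j) (mul_nonneg (hμ j) (div_nonneg (sq_nonneg _) (hh j)))
  calc ∑ i ∈ S, ν i * (∑ j ∈ T, N i j * (μ j * f j)) ^ 2
      ≤ ∑ i ∈ S, ν i * (α * e i * ∑ j ∈ T, N i j * (μ j * (f j ^ 2 / h j))) :=
        Finset.sum_le_sum fun i hi => mul_le_mul_of_nonneg_left (hcs i hi) (hν i)
    _ = ∑ j ∈ T, α * (μ j * (f j ^ 2 / h j)) * ∑ i ∈ S, N i j * (ν i * e i) := by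
        simp only [Finset.mul_sum]
        rw [Finset.sum_comm]
        refine Finset.sum_congr rfl fun j _ => Finset.sum_congr rfl fun i _ => by ring
    _ ≤ ∑ j ∈ T, α * β * (μ j * f j ^ 2) := by
        refine Finset.sum_le_sum fun j hj => ?_
        by_cases h0 : h j = 0
        · have : ∑ i ∈ S, N i j * (ν i * e i) = 0 :=
            Finset.sum_eq_zero fun i _ => by rw [hzero i j h0, zero_mul]
          rw [this, mul_zero]
          exact mul_nonneg (mul_nonneg hα hβ) (mul_nonneg (hμ j) (sq_nonneg _))
        · calc _ ≤ α * (μ j * (f j ^ 2 / h j)) * (β * h j) :=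
              mul_le_mul_of_nonneg_left (hcol j hj)
                (mul_nonneg hα (mul_nonneg (hμ j) (div_nonneg (sq_nonneg _) (hh j))))
            _ = _ := by field_simp
    _ = _ := by rw [Finset.mul_sum]

theorem sum_range_ite_le {k L : ℕ} (hk : k < L) (f : ℕ → ℝ) :
    ∑ j ∈ Finset.range L, (if j ≤ k then f j else 0) = ∑ j ∈ Finset.range (k + 1), f j := by
  rw [← Finset.sum_filter]
  congr 1
  ext j
  simp only [Finset.mem_filter, Finset.mem_range]
  omega

theorem sum_range_ite_lt {k L : ℕ} (hk : k < L) (f : ℕ → ℝ) :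
    ∑ j ∈ Finset.range L, (if j < k then f j else 0) = ∑ j ∈ Finset.range k, f j := by
  rw [← Finset.sum_filter]
  congr 1
  ext j
  simp only [Finset.mem_filter, Finset.mem_range]
  omega

theorem sum_range_ite_ge {j L : ℕ} (f : ℕ → ℝ) :
    ∑ k ∈ Finset.range L, (if j ≤ k then f k else 0) = ∑ k ∈ Finset.Ico j L, f k := by
  rw [← Finset.sum_filter]
  congr 1
  ext k
  simp only [Finset.mem_filter, Finset.mem_range, Finset.mem_Ico]
  omega

theorem sum_range_ite_gt {j L : ℕ} (f : ℕ → ℝ) :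
    ∑ k ∈ Finset.range L, (if j < k then f k else 0) = ∑ k ∈ Finset.Ico (j + 1) L, f k := by
  rw [← Finset.sum_filter]
  congr 1
  ext k
  simp only [Finset.mem_filter, Finset.mem_range, Finset.mem_Ico]
  omega

/-- Schur test for the kernel `A k * B j` on the triangle `j ≤ k`, and for its transpose. -/
theorem schur_triangle_le {L : ℕ} {A B ν μ e h : ℕ → ℝ} {α β : ℝ}
    (hA : ∀ k, 0 ≤ A k) (hB : ∀ k, 0 ≤ B k) (hν : ∀ k, 0 ≤ ν k) (hμ : ∀ k, 0 ≤ μ k)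
    (he : ∀ k, 0 ≤ e k) (hh : ∀ k, 0 ≤ h k) (hα : 0 ≤ α) (hβ : 0 ≤ β)
    (he0 : ∀ k, e k = 0 → A k = 0) (hh0 : ∀ j, h j = 0 → B j = 0)
    (hrow : ∀ k, A k * ∑ j ∈ Finset.range (k + 1), B j * (μ j * h j) ≤ α * e k)
    (hcol : ∀ j, B j * ∑ k ∈ Finset.Ico j L, A k * (ν k * e k) ≤ β * h j) (f : ℕ → ℝ) :
    ∑ k ∈ Finset.range L, ν k * (A k * ∑ j ∈ Finset.range (k + 1), B j * (μ j * f j)) ^ 2 ≤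
        α * β * ∑ j ∈ Finset.range L, μ j * f j ^ 2 ∧
    ∑ j ∈ Finset.range L, μ j * (B j * ∑ k ∈ Finset.Ico j L, A k * (ν k * f k)) ^ 2 ≤
        α * β * ∑ k ∈ Finset.range L, ν k * f k ^ 2 := by
  have hN : ∀ k j : ℕ, (0 : ℝ) ≤ if j ≤ k then A k * B j else 0 := fun k j => by
    split_ifs
    exacts [mul_nonneg (hA k) (hB j), le_rfl]
  have hlow : ∀ u : ℕ → ℝ, ∀ k ∈ Finset.range L,
      ∑ j ∈ Finset.range L, (if j ≤ k then A k * B j else 0) * u j =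
        A k * ∑ j ∈ Finset.range (k + 1), B j * u j := fun u k hk => by
    rw [← sum_range_ite_le (Finset.mem_range.1 hk), Finset.mul_sum]
    refine Finset.sum_congr rfl fun j _ => ?_
    split_ifs <;> ring
  have hup : ∀ u : ℕ → ℝ, ∀ j ∈ Finset.range L,
      ∑ k ∈ Finset.range L, (if j ≤ k then A k * B j else 0) * u k =
        B j * ∑ k ∈ Finset.Ico j L, A k * u k := fun u j _ => by
    rw [← sum_range_ite_ge, Finset.mul_sum]
    refine Finset.sum_congr rfl fun k _ => ?_
    split_ifs <;> ring
  have hrow' : ∀ k ∈ Finset.range L,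
      ∑ j ∈ Finset.range L, (if j ≤ k then A k * B j else 0) * (μ j * h j) ≤ α * e k :=
    fun k hk => (hlow (fun j => μ j * h j) k hk).trans_le (hrow k)
  have hcol' : ∀ j ∈ Finset.range L,
      ∑ k ∈ Finset.range L, (if j ≤ k then A k * B j else 0) * (ν k * e k) ≤ β * h j :=
    fun j hj => (hup (fun k => ν k * e k) j hj).trans_le (hcol j)
  constructor
  · refine le_of_eq_of_le (Finset.sum_congr rfl fun k hk => ?_)
      (schur_test (Finset.range L) (Finset.range L) _ ν e μ h hN hν hμ hh hα hβ
        (fun k j h0 => by simp [hh0 j h0]) hrow' hcol' f)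
    rw [hlow (fun j => μ j * f j) k hk]
  · rw [mul_comm α β]
    refine le_of_eq_of_le (Finset.sum_congr rfl fun j hj => ?_)
      (schur_test (Finset.range L) (Finset.range L) _ μ h ν e (fun j k => hN k j) hμ hν he hβ hα
        (fun j k h0 => by simp [he0 k h0]) hcol' hrow' f)
    rw [hup (fun k => ν k * f k) j hj]

/-- Schur test for the kernel `A k * B j` on the strict triangle `j < k`, and for its transpose. -/
theorem schur_triangle_lt {L : ℕ} {A B ν μ e h : ℕ → ℝ} {α β : ℝ}
    (hA : ∀ k, 0 ≤ A k) (hB : ∀ k, 0 ≤ B k) (hν : ∀ k, 0 ≤ ν k) (hμ : ∀ k, 0 ≤ μ k)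
    (he : ∀ k, 0 ≤ e k) (hh : ∀ k, 0 ≤ h k) (hα : 0 ≤ α) (hβ : 0 ≤ β)
    (he0 : ∀ k, e k = 0 → A k = 0) (hh0 : ∀ j, h j = 0 → B j = 0)
    (hrow : ∀ k, A k * ∑ j ∈ Finset.range k, B j * (μ j * h j) ≤ α * e k)
    (hcol : ∀ j, B j * ∑ k ∈ Finset.Ico (j + 1) L, A k * (ν k * e k) ≤ β * h j) (f : ℕ → ℝ) :
    ∑ k ∈ Finset.range L, ν k * (A k * ∑ j ∈ Finset.range k, B j * (μ j * f j)) ^ 2 ≤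
        α * β * ∑ j ∈ Finset.range L, μ j * f j ^ 2 ∧
    ∑ j ∈ Finset.range L, μ j * (B j * ∑ k ∈ Finset.Ico (j + 1) L, A k * (ν k * f k)) ^ 2 ≤
        α * β * ∑ k ∈ Finset.range L, ν k * f k ^ 2 := by
  have hN : ∀ k j : ℕ, (0 : ℝ) ≤ if j < k then A k * B j else 0 := fun k j => by
    split_ifs
    exacts [mul_nonneg (hA k) (hB j), le_rfl]
  have hlow : ∀ u : ℕ → ℝ, ∀ k ∈ Finset.range L,
      ∑ j ∈ Finset.range L, (if j < k then A k * B j else 0) * u j =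
        A k * ∑ j ∈ Finset.range k, B j * u j := fun u k hk => by
    rw [← sum_range_ite_lt (Finset.mem_range.1 hk), Finset.mul_sum]
    refine Finset.sum_congr rfl fun j _ => ?_
    split_ifs <;> ring
  have hup : ∀ u : ℕ → ℝ, ∀ j ∈ Finset.range L,
      ∑ k ∈ Finset.range L, (if j < k then A k * B j else 0) * u k =
        B j * ∑ k ∈ Finset.Ico (j + 1) L, A k * u k := fun u j _ => by
    rw [← sum_range_ite_gt, Finset.mul_sum]
    refine Finset.sum_congr rfl fun k _ => ?_
    split_ifs <;> ring
  have hrow' : ∀ k ∈ Finset.range L,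
      ∑ j ∈ Finset.range L, (if j < k then A k * B j else 0) * (μ j * h j) ≤ α * e k :=
    fun k hk => (hlow (fun j => μ j * h j) k hk).trans_le (hrow k)
  have hcol' : ∀ j ∈ Finset.range L,
      ∑ k ∈ Finset.range L, (if j < k then A k * B j else 0) * (ν k * e k) ≤ β * h j :=
    fun j hj => (hup (fun k => ν k * e k) j hj).trans_le (hcol j)
  constructor
  · refine le_of_eq_of_le (Finset.sum_congr rfl fun k hk => ?_)
      (schur_test (Finset.range L) (Finset.range L) _ ν e μ h hN hν hμ hh hα hβ
        (fun k j h0 => by simp [hh0 j h0]) hrow' hcol' f)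
    rw [hlow (fun j => μ j * f j) k hk]
  · rw [mul_comm α β]
    refine le_of_eq_of_le (Finset.sum_congr rfl fun j hj => ?_)
      (schur_test (Finset.range L) (Finset.range L) _ μ h ν e (fun j k => hN k j) hμ hν he hβ hα
        (fun j k h0 => by simp [he0 k h0]) hcol' hrow' f)
    rw [hup (fun k => ν k * f k) j hj]

/-! ### Kernels built from a regular and a decaying solution -/

/-- The inequalities between a solution `(I₁, -I₂)` regular at `0` and a solution `(K₁, K₂)`
positive at infinity of the homogeneous one-mode systems. Here `σ` and `τ` bound the sums of the
weights `p` and `q`, and `m * ρ` bounds `K₁ / K₂` at infinity. -/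
structure GreenPair (m σ τ ρ : ℝ) (p q I₁ I₂ K₁ K₂ : ℕ → ℝ) : Prop where
  m_nonneg : 0 ≤ m
  ρ_nonneg : 0 ≤ ρ
  p_nonneg : ∀ k, 0 ≤ p k
  q_nonneg : ∀ k, 0 ≤ q k
  sum_p_le : ∀ s : Finset ℕ, ∑ k ∈ s, p k ≤ σ
  sum_q_le : ∀ s : Finset ℕ, ∑ k ∈ s, q k ≤ τ
  I₁_pos : ∀ k, 0 < I₁ k
  I₂_nonneg : ∀ k, 0 ≤ I₂ k
  K₁_nonneg : ∀ k, 0 ≤ K₁ k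
  K₂_nonneg : ∀ k, 0 ≤ K₂ k
  I₁_step : ∀ k, I₁ k + m * q k * I₂ k ≤ I₁ (k + 1)
  K₂_step : ∀ k, K₂ (k + 1) + m * p (k + 1) * K₁ (k + 1) ≤ K₂ k
  pairing : ∀ k, I₁ k * K₂ k + I₂ k * K₁ k ≤ 1
  I₂_le : ∀ k, I₂ k ≤ m * σ * I₁ k
  I₁_mul_K₁_le : ∀ k, I₁ k * K₁ k ≤ m * (ρ + τ)
  I₂_ge : ∀ k, m * p k * I₁ k ≤ I₂ k
  K₁_ge : ∀ k, m * q k * K₂ k ≤ K₁ k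

namespace GreenPair

variable {m σ τ ρ : ℝ} {p q I₁ I₂ K₁ K₂ : ℕ → ℝ}

theorem σ_nonneg (G : GreenPair m σ τ ρ p q I₁ I₂ K₁ K₂) : 0 ≤ σ := by
  simpa using G.sum_p_le ∅

theorem τ_nonneg (G : GreenPair m σ τ ρ p q I₁ I₂ K₁ K₂) : 0 ≤ τ := by
  simpa using G.sum_q_le ∅

theorem I₁_mono (G : GreenPair m σ τ ρ p q I₁ I₂ K₁ K₂) : Monotone I₁ :=
  monotone_nat_of_le_succ fun k => by
    have := G.I₁_step k
    have := mul_nonneg (mul_nonneg G.m_nonneg (G.q_nonneg k)) (G.I₂_nonneg k)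
    linarith

theorem K₂_anti (G : GreenPair m σ τ ρ p q I₁ I₂ K₁ K₂) : Antitone K₂ :=
  antitone_nat_of_succ_le fun k => by
    have := G.K₂_step k
    have := mul_nonneg (mul_nonneg G.m_nonneg (G.p_nonneg (k + 1))) (G.K₁_nonneg (k + 1))
    linarith

theorem I₁_mul_K₂_le (G : GreenPair m σ τ ρ p q I₁ I₂ K₁ K₂) (k : ℕ) : I₁ k * K₂ k ≤ 1 := by
  have := G.pairing k
  have := mul_nonneg (G.I₂_nonneg k) (G.K₁_nonneg k)
  linarith

theorem I₂_mul_K₁_le (G : GreenPair m σ τ ρ p q I₁ I₂ K₁ K₂) (k : ℕ) : I₂ k * K₁ k ≤ 1 := by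
  have := G.pairing k
  have := mul_nonneg (G.I₁_pos k).le (G.K₂_nonneg k)
  linarith

/-- Telescoping of `m q I₂ ≤ I₁ (k + 1) - I₁ k`. -/
theorem sum_I₂_le (G : GreenPair m σ τ ρ p q I₁ I₂ K₁ K₂) (k : ℕ) :
    ∑ j ∈ Finset.range k, m * q j * I₂ j ≤ I₁ k := by
  induction k with
  | zero => simpa using (G.I₁_pos 0).le
  | succ k ih =>
    rw [Finset.sum_range_succ]
    linarith [G.I₁_step k]

/-- Telescoping of `m p K₁ ≤ K₂ (k - 1) - K₂ k`. -/
theorem sum_K₁_le (G : GreenPair m σ τ ρ p q I₁ I₂ K₁ K₂) (j L : ℕ) :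
    ∑ k ∈ Finset.Ico (j + 1) L, m * p k * K₁ k ≤ K₂ j := by
  rcases le_or_gt L (j + 1) with h | h
  · rw [Finset.Ico_eq_empty_of_le h]
    simpa using G.K₂_nonneg j
  · have key : ∀ L, j + 1 ≤ L →
        ∑ k ∈ Finset.Ico (j + 1) L, m * p k * K₁ k ≤ K₂ j - K₂ (L - 1) := by
      intro L hL
      induction L, hL using Nat.le_induction with
      | base => simp
      | succ L hL ih =>
        rw [Finset.sum_Ico_succ_top hL]
        obtain ⟨l, rfl⟩ : ∃ l, L = l + 1 := ⟨L - 1, by omega⟩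
        have := G.K₂_step l
        simp only [Nat.add_sub_cancel] at ih ⊢
        linarith
    linarith [key L h.le, G.K₂_nonneg (L - 1)]

/-- The kernel `K₁ k * I₁ j`, `j ≤ k`, and its transpose. -/
theorem schur_K₁_I₁ (G : GreenPair m σ τ ρ p q I₁ I₂ K₁ K₂) (L : ℕ) (f : ℕ → ℝ) :
    ∑ k ∈ Finset.range L, p k * (K₁ k * ∑ j ∈ Finset.range (k + 1), I₁ j * (p j * f j)) ^ 2 ≤
        2 * σ * (ρ + τ) * ∑ j ∈ Finset.range L, p j * f j ^ 2 ∧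
    ∑ j ∈ Finset.range L, p j * (I₁ j * ∑ k ∈ Finset.Ico j L, K₁ k * (p k * f k)) ^ 2 ≤
        2 * σ * (ρ + τ) * ∑ k ∈ Finset.range L, p k * f k ^ 2 := by
  have hρτ : 0 ≤ ρ + τ := add_nonneg G.ρ_nonneg G.τ_nonneg
  have hI := fun k => (G.I₁_pos k).le
  have hpos : ∀ k, 0 ≤ I₁ k * K₁ k := fun k => mul_nonneg (hI k) (G.K₁_nonneg k)
  rw [show 2 * σ * (ρ + τ) = σ * (2 * (ρ + τ)) by ring]
  refine schur_triangle_le (e := fun k => I₁ k * K₁ k) (h := fun _ => 1) G.K₁_nonneg hI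
    G.p_nonneg G.p_nonneg hpos (fun _ => zero_le_one) G.σ_nonneg (by positivity)
    (fun k h0 => (mul_eq_zero.1 h0).resolve_left (G.I₁_pos k).ne') (by simp) ?_ ?_ f
  · intro k
    calc K₁ k * ∑ j ∈ Finset.range (k + 1), I₁ j * (p j * 1)
        ≤ K₁ k * ∑ j ∈ Finset.range (k + 1), I₁ k * p j := by
          refine mul_le_mul_of_nonneg_left (Finset.sum_le_sum fun j hj => ?_) (G.K₁_nonneg k)
          rw [mul_one]
          exact mul_le_mul_of_nonneg_right
            (G.I₁_mono (Nat.lt_succ_iff.1 (Finset.mem_range.1 hj))) (G.p_nonneg j)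
      _ = (I₁ k * K₁ k) * ∑ j ∈ Finset.range (k + 1), p j := by rw [← Finset.mul_sum]; ring
      _ ≤ (I₁ k * K₁ k) * σ := mul_le_mul_of_nonneg_left (G.sum_p_le _) (hpos k)
      _ = σ * (I₁ k * K₁ k) := mul_comm _ _
  · intro j
    rcases le_or_gt L j with hL | hL
    · rw [Finset.Ico_eq_empty_of_le hL]
      simp only [Finset.sum_empty, mul_zero, mul_one]
      positivity
    have hterm : ∀ k, K₁ k * (p k * (I₁ k * K₁ k)) ≤ (ρ + τ) * (m * p k * K₁ k) := fun k => by
      calc K₁ k * (p k * (I₁ k * K₁ k)) = (p k * K₁ k) * (I₁ k * K₁ k) := by ring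
        _ ≤ (p k * K₁ k) * (m * (ρ + τ)) := mul_le_mul_of_nonneg_left (G.I₁_mul_K₁_le k)
            (mul_nonneg (G.p_nonneg k) (G.K₁_nonneg k))
        _ = _ := by ring
    calc I₁ j * ∑ k ∈ Finset.Ico j L, K₁ k * (p k * (I₁ k * K₁ k))
        ≤ I₁ j * ∑ k ∈ Finset.Ico j L, (ρ + τ) * (m * p k * K₁ k) :=
          mul_le_mul_of_nonneg_left (Finset.sum_le_sum fun k _ => hterm k) (hI j)
      _ = (ρ + τ) * (K₁ j * (m * p j * I₁ j) +
            I₁ j * ∑ k ∈ Finset.Ico (j + 1) L, m * p k * K₁ k) := by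
          rw [← Finset.mul_sum, Finset.sum_eq_sum_Ico_succ_bot hL]; ring
      _ ≤ (ρ + τ) * (K₁ j * I₂ j + I₁ j * K₂ j) := by
          refine mul_le_mul_of_nonneg_left (add_le_add ?_ ?_) hρτ
          · exact mul_le_mul_of_nonneg_left (G.I₂_ge j) (G.K₁_nonneg j)
          · exact mul_le_mul_of_nonneg_left (G.sum_K₁_le j L) (hI j)
      _ ≤ (ρ + τ) * 2 := by
          refine mul_le_mul_of_nonneg_left ?_ hρτ
          linarith [G.I₁_mul_K₂_le j, G.I₂_mul_K₁_le j, mul_comm (K₁ j) (I₂ j)]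
      _ = 2 * (ρ + τ) * 1 := by ring

theorem sum_I₂_sq_div_le (G : GreenPair m σ τ ρ p q I₁ I₂ K₁ K₂) (k : ℕ) :
    ∑ j ∈ Finset.range k, I₂ j * (q j * (I₂ j / I₁ j)) ≤ σ * I₁ k := by
  calc ∑ j ∈ Finset.range k, I₂ j * (q j * (I₂ j / I₁ j))
      ≤ ∑ j ∈ Finset.range k, σ * (m * q j * I₂ j) := by
        refine Finset.sum_le_sum fun j _ => ?_
        have h1 : I₂ j / I₁ j ≤ m * σ := (div_le_iff₀ (G.I₁_pos j)).2 (G.I₂_le j)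
        calc I₂ j * (q j * (I₂ j / I₁ j)) = (I₂ j * q j) * (I₂ j / I₁ j) := by ring
          _ ≤ (I₂ j * q j) * (m * σ) := mul_le_mul_of_nonneg_left h1
              (mul_nonneg (G.I₂_nonneg j) (G.q_nonneg j))
          _ = _ := by ring
    _ = σ * ∑ j ∈ Finset.range k, m * q j * I₂ j := by rw [Finset.mul_sum]
    _ ≤ σ * I₁ k := mul_le_mul_of_nonneg_left (G.sum_I₂_le k) G.σ_nonneg

/-- The kernel `K₁ k * I₂ j`, `j < k`, and its transpose. Neither factor is monotone, so that the
pairing on the diagonal does not bound the entries; the test functions `I₂ / I₁` and `I₁ * K₁`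
replace such a bound. -/
theorem schur_K₁_I₂ (G : GreenPair m σ τ ρ p q I₁ I₂ K₁ K₂) (L : ℕ) (f : ℕ → ℝ) :
    ∑ k ∈ Finset.range L, p k * (K₁ k * ∑ j ∈ Finset.range k, I₂ j * (q j * f j)) ^ 2 ≤
        2 * σ * (ρ + τ) * ∑ j ∈ Finset.range L, q j * f j ^ 2 ∧
    ∑ j ∈ Finset.range L, q j * (I₂ j * ∑ k ∈ Finset.Ico (j + 1) L, K₁ k * (p k * f k)) ^ 2 ≤
        2 * σ * (ρ + τ) * ∑ k ∈ Finset.range L, p k * f k ^ 2 := by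
  have hρτ : 0 ≤ ρ + τ := add_nonneg G.ρ_nonneg G.τ_nonneg
  have hI := fun k => (G.I₁_pos k).le
  have hσ := G.σ_nonneg
  have hpos : ∀ k, 0 ≤ I₁ k * K₁ k := fun k => mul_nonneg (hI k) (G.K₁_nonneg k)
  rw [show 2 * σ * (ρ + τ) = (2 * σ) * (ρ + τ) by ring]
  refine schur_triangle_lt (e := fun k => I₁ k * K₁ k) (h := fun j => I₂ j / I₁ j)
    G.K₁_nonneg G.I₂_nonneg G.p_nonneg G.q_nonneg hpos
    (fun j => div_nonneg (G.I₂_nonneg j) (hI j)) (by positivity) hρτ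
    (fun k h0 => (mul_eq_zero.1 h0).resolve_left (G.I₁_pos k).ne')
    (fun j h0 => (div_eq_zero_iff.1 h0).resolve_right (G.I₁_pos j).ne') ?_ ?_ f
  · intro k
    calc K₁ k * ∑ j ∈ Finset.range k, I₂ j * (q j * (I₂ j / I₁ j))
        ≤ K₁ k * (σ * I₁ k) := mul_le_mul_of_nonneg_left (G.sum_I₂_sq_div_le k) (G.K₁_nonneg k)
      _ = σ * (I₁ k * K₁ k) := by ring
      _ ≤ 2 * σ * (I₁ k * K₁ k) := mul_le_mul_of_nonneg_right (by linarith) (hpos k)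
  · intro j
    have hterm : ∀ k, K₁ k * (p k * (I₁ k * K₁ k)) ≤ (ρ + τ) * (m * p k * K₁ k) := fun k => by
      calc K₁ k * (p k * (I₁ k * K₁ k)) = (p k * K₁ k) * (I₁ k * K₁ k) := by ring
        _ ≤ (p k * K₁ k) * (m * (ρ + τ)) := mul_le_mul_of_nonneg_left (G.I₁_mul_K₁_le k)
            (mul_nonneg (G.p_nonneg k) (G.K₁_nonneg k))
        _ = _ := by ring
    have hK : K₂ j ≤ 1 / I₁ j := by
      rw [le_div_iff₀ (G.I₁_pos j), mul_comm]
      exact G.I₁_mul_K₂_le j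
    calc I₂ j * ∑ k ∈ Finset.Ico (j + 1) L, K₁ k * (p k * (I₁ k * K₁ k))
        ≤ I₂ j * ∑ k ∈ Finset.Ico (j + 1) L, (ρ + τ) * (m * p k * K₁ k) :=
          mul_le_mul_of_nonneg_left (Finset.sum_le_sum fun k _ => hterm k) (G.I₂_nonneg j)
      _ = (ρ + τ) * (I₂ j * ∑ k ∈ Finset.Ico (j + 1) L, m * p k * K₁ k) := by
          rw [← Finset.mul_sum]; ring
      _ ≤ (ρ + τ) * (I₂ j * (1 / I₁ j)) := by
          refine mul_le_mul_of_nonneg_left ?_ hρτ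
          exact mul_le_mul_of_nonneg_left ((G.sum_K₁_le j L).trans hK) (G.I₂_nonneg j)
      _ = (ρ + τ) * (I₂ j / I₁ j) := by ring

/-- The kernel `K₂ k * I₁ j`, `j ≤ k`, and its transpose. -/
theorem schur_K₂_I₁ (G : GreenPair m σ τ ρ p q I₁ I₂ K₁ K₂) (L : ℕ) (f : ℕ → ℝ) :
    ∑ k ∈ Finset.range L, q k * (K₂ k * ∑ j ∈ Finset.range (k + 1), I₁ j * (p j * f j)) ^ 2 ≤
        2 * σ * (ρ + τ) * ∑ j ∈ Finset.range L, p j * f j ^ 2 ∧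
    ∑ j ∈ Finset.range L, p j * (I₁ j * ∑ k ∈ Finset.Ico j L, K₂ k * (q k * f k)) ^ 2 ≤
        2 * σ * (ρ + τ) * ∑ k ∈ Finset.range L, q k * f k ^ 2 := by
  have hρτ : 0 ≤ ρ + τ := add_nonneg G.ρ_nonneg G.τ_nonneg
  have hI := fun k => (G.I₁_pos k).le
  have hσ := G.σ_nonneg
  -- the kernel itself is at most one
  have hker : ∀ {j k : ℕ}, j ≤ k → K₂ k * I₁ j ≤ 1 := fun {j k} hjk => by
    calc K₂ k * I₁ j ≤ K₂ j * I₁ j := mul_le_mul_of_nonneg_right (G.K₂_anti hjk) (hI j)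
      _ ≤ 1 := by rw [mul_comm]; exact G.I₁_mul_K₂_le j
  refine schur_triangle_le (e := fun _ => 1) (h := fun _ => 1) (α := 2 * σ)
    G.K₂_nonneg hI G.q_nonneg G.p_nonneg (fun _ => zero_le_one) (fun _ => zero_le_one)
    (by positivity) hρτ (by simp) (by simp) ?_ ?_ f
  · intro k
    calc K₂ k * ∑ j ∈ Finset.range (k + 1), I₁ j * (p j * 1)
        = ∑ j ∈ Finset.range (k + 1), (K₂ k * I₁ j) * p j := by
          rw [Finset.mul_sum]; exact Finset.sum_congr rfl fun j _ => by ring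
      _ ≤ ∑ j ∈ Finset.range (k + 1), 1 * p j := Finset.sum_le_sum fun j hj =>
          mul_le_mul_of_nonneg_right (hker (Nat.lt_succ_iff.1 (Finset.mem_range.1 hj)))
            (G.p_nonneg j)
      _ ≤ σ := by simpa using G.sum_p_le _
      _ ≤ 2 * σ * 1 := by linarith
  · intro j
    calc I₁ j * ∑ k ∈ Finset.Ico j L, K₂ k * (q k * 1)
        = ∑ k ∈ Finset.Ico j L, (K₂ k * I₁ j) * q k := by
          rw [Finset.mul_sum]; exact Finset.sum_congr rfl fun k _ => by ring
      _ ≤ ∑ k ∈ Finset.Ico j L, 1 * q k := Finset.sum_le_sum fun k hk =>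
          mul_le_mul_of_nonneg_right (hker (Finset.mem_Ico.1 hk).1) (G.q_nonneg k)
      _ ≤ τ := by simpa using G.sum_q_le _
      _ ≤ (ρ + τ) * 1 := by linarith [G.ρ_nonneg]

/-- The kernel `K₂ k * I₂ j`, `j ≤ k`, and its transpose. -/
theorem schur_K₂_I₂ (G : GreenPair m σ τ ρ p q I₁ I₂ K₁ K₂) (L : ℕ) (f : ℕ → ℝ) :
    ∑ k ∈ Finset.range L, q k * (K₂ k * ∑ j ∈ Finset.range (k + 1), I₂ j * (q j * f j)) ^ 2 ≤
        2 * σ * (ρ + τ) * ∑ j ∈ Finset.range L, q j * f j ^ 2 ∧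
    ∑ j ∈ Finset.range L, q j * (I₂ j * ∑ k ∈ Finset.Ico j L, K₂ k * (q k * f k)) ^ 2 ≤
        2 * σ * (ρ + τ) * ∑ k ∈ Finset.range L, q k * f k ^ 2 := by
  have hρτ : 0 ≤ ρ + τ := add_nonneg G.ρ_nonneg G.τ_nonneg
  have hI := fun k => (G.I₁_pos k).le
  have hσ := G.σ_nonneg
  refine schur_triangle_le (e := fun _ => 1) (h := fun j => I₂ j / I₁ j) (α := 2 * σ)
    G.K₂_nonneg G.I₂_nonneg G.q_nonneg G.q_nonneg (fun _ => zero_le_one)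
    (fun j => div_nonneg (G.I₂_nonneg j) (hI j)) (by positivity) hρτ (by simp)
    (fun j h0 => (div_eq_zero_iff.1 h0).resolve_right (G.I₁_pos j).ne') ?_ ?_ f
  · intro k
    have hdiv : I₂ k / I₁ k ≤ m * σ := (div_le_iff₀ (G.I₁_pos k)).2 (G.I₂_le k)
    -- the diagonal term is controlled by `m q K₂ ≤ K₁`
    have hdiag : K₂ k * (I₂ k * (q k * (I₂ k / I₁ k))) ≤ σ := by
      calc K₂ k * (I₂ k * (q k * (I₂ k / I₁ k)))
          = (K₂ k * I₂ k * q k) * (I₂ k / I₁ k) := by ring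
        _ ≤ (K₂ k * I₂ k * q k) * (m * σ) := mul_le_mul_of_nonneg_left hdiv
            (mul_nonneg (mul_nonneg (G.K₂_nonneg k) (G.I₂_nonneg k)) (G.q_nonneg k))
        _ = σ * (I₂ k * (m * q k * K₂ k)) := by ring
        _ ≤ σ * (I₂ k * K₁ k) := mul_le_mul_of_nonneg_left
            (mul_le_mul_of_nonneg_left (G.K₁_ge k) (G.I₂_nonneg k)) hσ
        _ ≤ σ * 1 := mul_le_mul_of_nonneg_left (G.I₂_mul_K₁_le k) hσ
        _ = σ := mul_one σ
    calc K₂ k * ∑ j ∈ Finset.range (k + 1), I₂ j * (q j * (I₂ j / I₁ j))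
        = K₂ k * ∑ j ∈ Finset.range k, I₂ j * (q j * (I₂ j / I₁ j)) +
            K₂ k * (I₂ k * (q k * (I₂ k / I₁ k))) := by rw [Finset.sum_range_succ, mul_add]
      _ ≤ K₂ k * (σ * I₁ k) + σ := add_le_add
          (mul_le_mul_of_nonneg_left (G.sum_I₂_sq_div_le k) (G.K₂_nonneg k)) hdiag
      _ = σ * (I₁ k * K₂ k) + σ := by ring
      _ ≤ σ * 1 + σ := by
          linarith [mul_le_mul_of_nonneg_left (G.I₁_mul_K₂_le k) hσ]
      _ = 2 * σ * 1 := by ring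
  · intro j
    have hK : K₂ j ≤ 1 / I₁ j := by
      rw [le_div_iff₀ (G.I₁_pos j), mul_comm]
      exact G.I₁_mul_K₂_le j
    calc I₂ j * ∑ k ∈ Finset.Ico j L, K₂ k * (q k * 1)
        ≤ I₂ j * ∑ k ∈ Finset.Ico j L, (1 / I₁ j) * q k := by
          refine mul_le_mul_of_nonneg_left (Finset.sum_le_sum fun k hk => ?_) (G.I₂_nonneg j)
          rw [mul_one]
          exact mul_le_mul_of_nonneg_right
            ((G.K₂_anti (Finset.mem_Ico.1 hk).1).trans hK) (G.q_nonneg k)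
      _ = (I₂ j / I₁ j) * ∑ k ∈ Finset.Ico j L, q k := by rw [← Finset.mul_sum]; ring
      _ ≤ (I₂ j / I₁ j) * (ρ + τ) := by
          refine mul_le_mul_of_nonneg_left ?_ (div_nonneg (G.I₂_nonneg j) (hI j))
          linarith [G.sum_q_le (Finset.Ico j L), G.ρ_nonneg]
      _ = (ρ + τ) * (I₂ j / I₁ j) := mul_comm _ _

end GreenPair

/-! ### The homogeneous system of one Fourier mode -/

/-- The data of one Fourier mode: a nonnegative `m`, summable weights `p`, `q`, coefficients
`c₁`, `c₂` whose partial products stay above `J > 0`, and a nonnegative solution `(K₁, K₂)` of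
the homogeneous system (see `Mode.IsSol`) which converges at infinity with
`lim₁ ≤ m * ρ * lim₂`. The field `normalized` fixes its scale: its pairing with the solution that
is regular at `0` is one. -/
structure Mode where
  m : ℝ
  p : ℕ → ℝ
  q : ℕ → ℝ
  c₁ : ℕ → ℝ
  c₂ : ℕ → ℝ
  K₁ : ℕ → ℝ
  K₂ : ℕ → ℝ
  lim₁ : ℝ
  lim₂ : ℝ
  ρ : ℝ
  J : ℝ
  m_nonneg : 0 ≤ m
  ρ_nonneg : 0 ≤ ρ
  J_pos : 0 < J
  p_pos : ∀ k, 0 < p k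
  q_pos : ∀ k, 0 < q k
  p_summable : Summable p
  q_summable : Summable q
  c₁_pos : ∀ k, 0 < c₁ k
  c₂_pos : ∀ k, 0 < c₂ k
  c₁_le_one : ∀ k, c₁ k ≤ 1
  c₂_le_one : ∀ k, c₂ k ≤ 1
  J_le_prod₁ : ∀ N, J ≤ ∏ k ∈ Finset.range N, c₁ k
  J_le_prod₂ : ∀ N, J ≤ ∏ k ∈ Finset.range N, c₂ k
  K₁_step : ∀ k, K₁ k = c₁ k * K₁ (k + 1) + m * q k * K₂ k
  K₂_step : ∀ k, c₂ k * K₂ k = K₂ (k + 1) + m * p (k + 1) * K₁ (k + 1)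
  K₁_nonneg : ∀ k, 0 ≤ K₁ k
  K₂_pos : ∀ k, 0 < K₂ k
  tendsto_K₁ : Tendsto K₁ atTop (𝓝 lim₁)
  tendsto_K₂ : Tendsto K₂ atTop (𝓝 lim₂)
  lim₁_nonneg : 0 ≤ lim₁
  lim₂_pos : 0 < lim₂
  lim_le : lim₁ ≤ m * ρ * lim₂
  normalized : K₂ 0 + m * p 0 * K₁ 0 = 1

namespace Mode

variable (M : Mode)

/-- The pair `(I₁, I₂)` for which `(I₁, -I₂)` is the solution of the homogeneous system with
`I₁ = 1` at `0`. -/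
def regular : ℕ → ℝ × ℝ
  | 0 => (1, M.m * M.p 0)
  | k + 1 =>
    let u := ((regular k).1 + M.m * M.q k * (regular k).2) / M.c₁ k
    (u, M.c₂ k * (regular k).2 + M.m * M.p (k + 1) * u)

/-- First component of the regular solution. -/
def I₁ (k : ℕ) : ℝ := (regular M k).1

/-- Second component of the regular solution, with the sign changed. -/
def I₂ (k : ℕ) : ℝ := (regular M k).2

theorem I₁_zero : M.I₁ 0 = 1 := rfl

theorem I₂_zero : M.I₂ 0 = M.m * M.p 0 := rfl

theorem I₁_step (k : ℕ) : M.c₁ k * M.I₁ (k + 1) = M.I₁ k + M.m * M.q k * M.I₂ k :=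
  mul_div_cancel₀ _ (M.c₁_pos k).ne'

theorem I₂_step (k : ℕ) :
    M.I₂ (k + 1) = M.c₂ k * M.I₂ k + M.m * M.p (k + 1) * M.I₁ (k + 1) := rfl

theorem I_pos (k : ℕ) : 0 < M.I₁ k ∧ 0 ≤ M.I₂ k := by
  have hm := M.m_nonneg
  induction k with
  | zero => exact ⟨one_pos, mul_nonneg hm (M.p_pos 0).le⟩
  | succ k ih =>
    have h1 : 0 < M.I₁ (k + 1) := by
      refine pos_of_mul_pos_right (a := M.c₁ k) ?_ (M.c₁_pos k).le
      rw [M.I₁_step]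
      exact add_pos_of_pos_of_nonneg ih.1 (mul_nonneg (mul_nonneg hm (M.q_pos k).le) ih.2)
    refine ⟨h1, ?_⟩
    rw [M.I₂_step]
    exact add_nonneg (mul_nonneg (M.c₂_pos k).le ih.2)
      (mul_nonneg (mul_nonneg hm (M.p_pos _).le) h1.le)

/-- The factor `∏ c₁ / c₂` turning solutions of the homogeneous system into solutions of the
system in which `c₁` and `c₂` are interchanged. -/
def gauge (k : ℕ) : ℝ := ∏ j ∈ Finset.range k, M.c₁ j / M.c₂ j

theorem gauge_zero : M.gauge 0 = 1 := by simp [gauge]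

theorem gauge_step (k : ℕ) : M.c₂ k * M.gauge (k + 1) = M.c₁ k * M.gauge k := by
  have := (M.c₂_pos k).ne'
  rw [gauge, Finset.prod_range_succ, gauge]
  field_simp

theorem gauge_pos (k : ℕ) : 0 < M.gauge k :=
  Finset.prod_pos fun j _ => div_pos (M.c₁_pos j) (M.c₂_pos j)

theorem gauge_eq (k : ℕ) : M.gauge k =
    (∏ j ∈ Finset.range k, M.c₁ j) / ∏ j ∈ Finset.range k, M.c₂ j := Finset.prod_div_distrib ..

theorem J_le_gauge (k : ℕ) : M.J ≤ M.gauge k := by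
  have h2 : ∏ j ∈ Finset.range k, M.c₂ j ≤ 1 :=
    Finset.prod_le_one (fun j _ => (M.c₂_pos j).le) fun j _ => M.c₂_le_one j
  have h0 : 0 < ∏ j ∈ Finset.range k, M.c₂ j := Finset.prod_pos fun j _ => M.c₂_pos j
  rw [gauge_eq, le_div_iff₀ h0]
  nlinarith [M.J_le_prod₁ k, M.J_pos]

theorem gauge_le (k : ℕ) : M.gauge k ≤ 1 / M.J := by
  have h1 : ∏ j ∈ Finset.range k, M.c₁ j ≤ 1 :=
    Finset.prod_le_one (fun j _ => (M.c₁_pos j).le) fun j _ => M.c₁_le_one j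
  rw [gauge_eq]
  exact div_le_div₀ zero_le_one h1 M.J_pos (M.J_le_prod₂ k)

/-- The pairing of `(I₁, -I₂)` and the gauge transform of `(K₁, K₂)` is constant. -/
theorem pairing (k : ℕ) : M.gauge k * (M.I₁ k * M.K₂ k + M.I₂ k * M.K₁ k) = 1 := by
  induction k with
  | zero => rw [M.gauge_zero, M.I₁_zero, M.I₂_zero]; linarith [M.normalized]
  | succ k ih =>
    rw [← ih]
    linear_combination (M.gauge (k + 1) * M.I₁ (k + 1)) * -(M.K₂_step k) +
      M.gauge (k + 1) * M.K₁ (k + 1) * M.I₂_step k +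
      (M.I₁ (k + 1) * M.K₂ k + M.I₂ k * M.K₁ (k + 1)) * M.gauge_step k +
      M.gauge k * M.K₂ k * M.I₁_step k - M.gauge k * M.I₂ k * M.K₁_step k

/-- The total weight of `p`. -/
def σ : ℝ := ∑' k, M.p k

/-- The total weight of `q`. -/
def τ : ℝ := ∑' k, M.q k

theorem sum_p_le (s : Finset ℕ) : ∑ k ∈ s, M.p k ≤ M.σ :=
  M.p_summable.sum_le_tsum s fun k _ => (M.p_pos k).le

theorem sum_q_le (s : Finset ℕ) : ∑ k ∈ s, M.q k ≤ M.τ :=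
  M.q_summable.sum_le_tsum s fun k _ => (M.q_pos k).le

theorem σ_nonneg : 0 ≤ M.σ := tsum_nonneg fun k => (M.p_pos k).le

theorem τ_nonneg : 0 ≤ M.τ := tsum_nonneg fun k => (M.q_pos k).le

theorem I₁_mono : Monotone M.I₁ := monotone_nat_of_le_succ fun k => by
  have h1 := M.I₁_step k
  have h2 := mul_nonneg (mul_nonneg M.m_nonneg (M.q_pos k).le) (M.I_pos k).2
  have h3 := mul_le_of_le_one_left (M.I_pos (k + 1)).1.le (M.c₁_le_one k)
  linarith

theorem I₂_le (k : ℕ) : M.I₂ k ≤ M.m * M.σ * M.I₁ k := by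
  have key : M.I₂ k ≤ M.m * (∑ j ∈ Finset.range (k + 1), M.p j) * M.I₁ k := by
    induction k with
    | zero => simp [M.I₁_zero, M.I₂_zero]
    | succ k ih =>
      rw [M.I₂_step, Finset.sum_range_succ _ (k + 1)]
      have h1 := mul_le_of_le_one_left (M.I_pos k).2 (M.c₂_le_one k)
      have h2 : M.m * (∑ j ∈ Finset.range (k + 1), M.p j) * M.I₁ k ≤
          M.m * (∑ j ∈ Finset.range (k + 1), M.p j) * M.I₁ (k + 1) :=
        mul_le_mul_of_nonneg_left (M.I₁_mono k.le_succ)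
          (mul_nonneg M.m_nonneg (Finset.sum_nonneg fun j _ => (M.p_pos j).le))
      linarith
  exact key.trans (mul_le_mul_of_nonneg_right
    (mul_le_mul_of_nonneg_left (M.sum_p_le _) M.m_nonneg) (M.I_pos k).1.le)

theorem I₂_ge (k : ℕ) : M.m * M.p k * M.I₁ k ≤ M.I₂ k := by
  cases k with
  | zero => simp [M.I₁_zero, M.I₂_zero]
  | succ k =>
    rw [M.I₂_step]
    linarith [mul_nonneg (M.c₂_pos k).le (M.I_pos k).2]

theorem K₁_ge (k : ℕ) : M.m * M.q k * M.K₂ k ≤ M.K₁ k := by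
  rw [M.K₁_step]
  linarith [mul_nonneg (M.c₁_pos k).le (M.K₁_nonneg (k + 1))]

theorem K₂_anti : Antitone M.K₂ := antitone_nat_of_succ_le fun k => by
  have h1 := M.K₂_step k
  have h2 := mul_nonneg (mul_nonneg M.m_nonneg (M.p_pos (k + 1)).le) (M.K₁_nonneg (k + 1))
  have h3 := mul_le_of_le_one_left (M.K₂_pos k).le (M.c₂_le_one k)
  linarith

/-- The quotient `K₁ / K₂` is at most `m ρ` at infinity and, since `K₂` is antitone, increases by at
most `m * q k` from `k + 1` to `k`. -/
theorem K₁_le (k : ℕ) : M.K₁ k ≤ M.m * (M.ρ + M.τ) * M.K₂ k := by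
  have hstep : ∀ k, M.K₁ k / M.K₂ k ≤ M.m * M.q k + M.K₁ (k + 1) / M.K₂ (k + 1) := fun k => by
    have h1 : M.K₁ (k + 1) / M.K₂ k ≤ M.K₁ (k + 1) / M.K₂ (k + 1) :=
      div_le_div_of_nonneg_left (M.K₁_nonneg _) (M.K₂_pos _) (M.K₂_anti k.le_succ)
    have h2 : M.K₁ k / M.K₂ k = M.c₁ k * (M.K₁ (k + 1) / M.K₂ k) + M.m * M.q k := by
      have := (M.K₂_pos k).ne'
      rw [M.K₁_step k]
      field_simp
    have h3 := mul_le_of_le_one_left (div_nonneg (M.K₁_nonneg (k + 1)) (M.K₂_pos k).le)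
      (M.c₁_le_one k)
    linarith
  have hsum : ∀ l, M.K₁ k / M.K₂ k ≤
      M.m * (∑ j ∈ Finset.Ico k (k + l), M.q j) + M.K₁ (k + l) / M.K₂ (k + l) := fun l => by
    induction l with
    | zero => simp
    | succ l ih =>
      rw [← add_assoc, Finset.sum_Ico_succ_top (by omega)]
      linarith [hstep (k + l)]
  have hlim : Tendsto (fun l => M.m * M.τ + M.K₁ (k + l) / M.K₂ (k + l)) atTop
      (𝓝 (M.m * M.τ + M.lim₁ / M.lim₂)) := by
    have h := (M.tendsto_K₁.div M.tendsto_K₂ M.lim₂_pos.ne').comp (tendsto_add_atTop_nat k)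
    refine tendsto_const_nhds.add (h.congr fun l => ?_)
    simp [add_comm]
  have h1 : M.K₁ k / M.K₂ k ≤ M.m * M.τ + M.lim₁ / M.lim₂ :=
    ge_of_tendsto' hlim fun l => (hsum l).trans
      (add_le_add_left (mul_le_mul_of_nonneg_left (M.sum_q_le _) M.m_nonneg) _)
  have h2 : M.lim₁ / M.lim₂ ≤ M.m * M.ρ := (div_le_iff₀ M.lim₂_pos).2 M.lim_le
  rw [← div_le_iff₀ (M.K₂_pos k)]
  linarith

/-- The regular solution of the system with `c₁` and `c₂` interchanged, and `(K₁, K₂)`. -/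
theorem greenPair_gauge_I : GreenPair M.m M.σ M.τ M.ρ M.p M.q (fun k => M.gauge k * M.I₁ k)
    (fun k => M.gauge k * M.I₂ k) M.K₁ M.K₂ where
  m_nonneg := M.m_nonneg
  ρ_nonneg := M.ρ_nonneg
  p_nonneg k := (M.p_pos k).le
  q_nonneg k := (M.q_pos k).le
  sum_p_le := M.sum_p_le
  sum_q_le := M.sum_q_le
  I₁_pos k := mul_pos (M.gauge_pos k) (M.I_pos k).1
  I₂_nonneg k := mul_nonneg (M.gauge_pos k).le (M.I_pos k).2
  K₁_nonneg := M.K₁_nonneg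
  K₂_nonneg k := (M.K₂_pos k).le
  I₁_step k := by
    have h1 := mul_le_of_le_one_left
      (mul_pos (M.gauge_pos (k + 1)) (M.I_pos (k + 1)).1).le (M.c₂_le_one k)
    linear_combination h1 - M.gauge k * M.I₁_step k - M.I₁ (k + 1) * M.gauge_step k
  K₂_step k := by
    have h3 := mul_le_of_le_one_left (M.K₂_pos k).le (M.c₂_le_one k)
    linarith [M.K₂_step k]
  pairing k := le_of_eq (by linear_combination M.pairing k)
  I₂_le k := by
    linear_combination mul_le_mul_of_nonneg_left (M.I₂_le k) (M.gauge_pos k).le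
  I₁_mul_K₁_le k := by
    have h0 := M.m_nonneg
    have h4 := M.ρ_nonneg
    have h5 := M.τ_nonneg
    have h1 : M.gauge k * M.I₁ k * M.K₂ k ≤ 1 := by
      linarith [M.pairing k, mul_nonneg (M.gauge_pos k).le
        (mul_nonneg (M.I_pos k).2 (M.K₁_nonneg k))]
    have h2 := mul_le_mul_of_nonneg_left (M.K₁_le k)
      (mul_pos (M.gauge_pos k) (M.I_pos k).1).le
    have h3 := mul_le_mul_of_nonneg_left h1 (by positivity : 0 ≤ M.m * (M.ρ + M.τ))
    linarith
  I₂_ge k := by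
    linear_combination mul_le_mul_of_nonneg_left (M.I₂_ge k) (M.gauge_pos k).le
  K₁_ge := M.K₁_ge

/-- The regular solution, and `(K₁, K₂)` for the system with `c₁` and `c₂` interchanged. -/
theorem greenPair_gauge_K : GreenPair M.m M.σ M.τ M.ρ M.p M.q M.I₁ M.I₂
    (fun k => M.gauge k * M.K₁ k) (fun k => M.gauge k * M.K₂ k) where
  m_nonneg := M.m_nonneg
  ρ_nonneg := M.ρ_nonneg
  p_nonneg k := (M.p_pos k).le
  q_nonneg k := (M.q_pos k).le
  sum_p_le := M.sum_p_le
  sum_q_le := M.sum_q_le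
  I₁_pos k := (M.I_pos k).1
  I₂_nonneg k := (M.I_pos k).2
  K₁_nonneg k := mul_nonneg (M.gauge_pos k).le (M.K₁_nonneg k)
  K₂_nonneg k := mul_nonneg (M.gauge_pos k).le (M.K₂_pos k).le
  I₁_step k := by
    have h3 := mul_le_of_le_one_left (M.I_pos (k + 1)).1.le (M.c₁_le_one k)
    linarith [M.I₁_step k]
  K₂_step k := by
    have h1 := mul_le_of_le_one_left
      (mul_pos (M.gauge_pos k) (M.K₂_pos k)).le (M.c₁_le_one k)
    linear_combination h1 - M.gauge (k + 1) * M.K₂_step k + M.K₂ k * M.gauge_step k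
  pairing k := le_of_eq (by linear_combination M.pairing k)
  I₂_le := M.I₂_le
  I₁_mul_K₁_le k := by linarith [M.greenPair_gauge_I.I₁_mul_K₁_le k]
  I₂_ge := M.I₂_ge
  K₁_ge k := by
    linear_combination mul_le_mul_of_nonneg_left (M.K₁_ge k) (M.gauge_pos k).le

/-- `(x, y)` solves the one-mode system `B̄ x - m y = r`, `B y + m x = s`, divided by the
weights. -/
structure IsSol (x y r s : ℕ → ℂ) : Prop where
  fst : ∀ k, x k = M.c₁ k * x (k + 1) + M.q k * (M.m * y k + r k)
  snd_zero : y 0 = M.p 0 * (s 0 - M.m * x 0)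
  snd_succ : ∀ k, y (k + 1) = M.c₂ k * y k + M.p (k + 1) * (s (k + 1) - M.m * x (k + 1))

/-- `(x, y)` is proportional to `(K₁, K₂)` at infinity. -/
def Bdry (x y : ℕ → ℂ) : Prop :=
  ∃ β : ℂ, Tendsto x atTop (𝓝 (β * M.lim₁)) ∧ Tendsto y atTop (𝓝 (β * M.lim₂))

variable {M}
variable {x y r s : ℕ → ℂ}

theorem pairingC (k : ℕ) :
    (M.gauge k : ℂ) * (M.I₁ k * M.K₂ k + M.I₂ k * M.K₁ k) = 1 := by
  exact_mod_cast M.pairing k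

theorem gauge_stepC (k : ℕ) : (M.c₂ k : ℂ) * M.gauge (k + 1) = M.c₁ k * M.gauge k := by
  exact_mod_cast M.gauge_step k

theorem I₁_stepC (k : ℕ) : (M.c₁ k : ℂ) * M.I₁ (k + 1) = M.I₁ k + M.m * M.q k * M.I₂ k := by
  exact_mod_cast M.I₁_step k

theorem I₂_stepC (k : ℕ) :
    (M.I₂ (k + 1) : ℂ) = M.c₂ k * M.I₂ k + M.m * M.p (k + 1) * M.I₁ (k + 1) := by
  exact_mod_cast M.I₂_step k

theorem K₁_stepC (k : ℕ) : (M.K₁ k : ℂ) = M.c₁ k * M.K₁ (k + 1) + M.m * M.q k * M.K₂ k := by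
  exact_mod_cast M.K₁_step k

theorem K₂_stepC (k : ℕ) :
    (M.c₂ k : ℂ) * M.K₂ k = M.K₂ (k + 1) + M.m * M.p (k + 1) * M.K₁ (k + 1) := by
  exact_mod_cast M.K₂_step k

variable (M) in
/-- The pairing of `(x, y)` with the gauge transform of `(K₁, K₂)`. It is constant for solutions of
the homogeneous system, and tends to `0` under the boundary condition. -/
def wronskK (x y : ℕ → ℂ) (k : ℕ) : ℂ := M.gauge k * (x k * M.K₂ k - y k * M.K₁ k)

variable (M) in
/-- The pairing of `(x, y)` with the gauge transform of the regular solution, with the sign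
changed. -/
def wronskI (x y : ℕ → ℂ) (k : ℕ) : ℂ := M.gauge k * (x k * M.I₂ k + y k * M.I₁ k)

/-- The two pairings determine `(x, y)`. -/
theorem fst_eq (x y : ℕ → ℂ) (k : ℕ) :
    x k = M.I₁ k * M.wronskK x y k + M.K₁ k * M.wronskI x y k := by
  simp only [wronskK, wronskI]
  linear_combination -x k * M.pairingC k

theorem snd_eq (x y : ℕ → ℂ) (k : ℕ) :
    y k = M.K₂ k * M.wronskI x y k - M.I₂ k * M.wronskK x y k := by
  simp only [wronskK, wronskI]
  linear_combination -y k * M.pairingC k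

theorem IsSol.wronskK_step (h : M.IsSol x y r s) (k : ℕ) : M.wronskK x y k =
    M.wronskK x y (k + 1) + ((M.gauge (k + 1) * M.K₁ (k + 1) : ℝ) * (M.p (k + 1) * s (k + 1)) +
      (M.gauge k * M.K₂ k : ℝ) * (M.q k * r k)) := by
  simp only [wronskK]
  push_cast
  linear_combination M.gauge k * M.K₂ k * h.fst k - M.gauge k * y k * M.K₁_stepC k
    + M.gauge (k + 1) * M.K₁ (k + 1) * h.snd_succ k
    - M.gauge (k + 1) * x (k + 1) * -(M.K₂_stepC k)
    - (M.K₂ k * x (k + 1) - y k * M.K₁ (k + 1)) * M.gauge_stepC k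

theorem IsSol.wronskI_zero (h : M.IsSol x y r s) :
    M.wronskI x y 0 = (M.gauge 0 * M.I₁ 0 : ℝ) * (M.p 0 * s 0) := by
  simp only [wronskI, h.snd_zero, M.I₁_zero, M.I₂_zero]
  push_cast
  ring

theorem IsSol.wronskI_step (h : M.IsSol x y r s) (k : ℕ) : M.wronskI x y (k + 1) =
    M.wronskI x y k + (M.gauge (k + 1) * M.I₁ (k + 1) : ℝ) * (M.p (k + 1) * s (k + 1)) -
      (M.gauge k * M.I₂ k : ℝ) * (M.q k * r k) := by
  simp only [wronskI]
  push_cast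
  linear_combination M.gauge (k + 1) * M.I₁ (k + 1) * h.snd_succ k
    + M.gauge (k + 1) * x (k + 1) * M.I₂_stepC k
    - M.gauge k * M.I₂ k * h.fst k
    + (M.I₂ k * x (k + 1) + y k * M.I₁ (k + 1)) * M.gauge_stepC k
    + M.gauge k * y k * M.I₁_stepC k

/-! ### Estimates for solutions with the boundary condition -/

theorem IsSol.norm_wronskK_le (h : M.IsSol x y r s) {k L : ℕ} (hkL : k ≤ L) :
    ‖M.wronskK x y k‖ ≤ ‖M.wronskK x y L‖ +
      ∑ j ∈ Finset.Ico (k + 1) (L + 1), (M.gauge j * M.K₁ j) * (M.p j * ‖s j‖) +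
      ∑ j ∈ Finset.Ico k L, (M.gauge j * M.K₂ j) * (M.q j * ‖r j‖) := by
  induction L, hkL using Nat.le_induction with
  | base => simp
  | succ L hkL ih =>
    rw [Finset.sum_Ico_succ_top (by omega : k + 1 ≤ L + 1), Finset.sum_Ico_succ_top hkL]
    have h1 : ‖M.wronskK x y L‖ ≤ ‖M.wronskK x y (L + 1)‖ +
        ((M.gauge (L + 1) * M.K₁ (L + 1)) * (M.p (L + 1) * ‖s (L + 1)‖) +
          (M.gauge L * M.K₂ L) * (M.q L * ‖r L‖)) := by
      rw [h.wronskK_step L]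
      refine (norm_add_le _ _).trans (add_le_add_right ((norm_add_le _ _).trans_eq ?_) _)
      simp only [norm_mul, Complex.norm_real, Real.norm_eq_abs, abs_of_pos (M.gauge_pos _),
        abs_of_pos (M.p_pos _), abs_of_pos (M.q_pos _), abs_of_nonneg (M.K₁_nonneg _),
        abs_of_pos (M.K₂_pos _)]
    linarith

theorem IsSol.norm_wronskI_le (h : M.IsSol x y r s) (k : ℕ) :
    ‖M.wronskI x y k‖ ≤
      ∑ j ∈ Finset.range (k + 1), (M.gauge j * M.I₁ j) * (M.p j * ‖s j‖) +
      ∑ j ∈ Finset.range k, (M.gauge j * M.I₂ j) * (M.q j * ‖r j‖) := by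
  induction k with
  | zero =>
    rw [h.wronskI_zero]
    simp only [norm_mul, Complex.norm_real, Real.norm_eq_abs, abs_of_pos (M.gauge_pos _),
      abs_of_pos (M.p_pos _), abs_of_pos (M.I_pos _).1]
    simp
  | succ k ih =>
    rw [Finset.sum_range_succ _ (k + 1), Finset.sum_range_succ _ k]
    have h1 : ‖M.wronskI x y (k + 1)‖ ≤ ‖M.wronskI x y k‖ +
        (M.gauge (k + 1) * M.I₁ (k + 1)) * (M.p (k + 1) * ‖s (k + 1)‖) +
          (M.gauge k * M.I₂ k) * (M.q k * ‖r k‖) := by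
      rw [h.wronskI_step k]
      refine (norm_sub_le _ _).trans
        (le_of_le_of_eq (add_le_add_left (norm_add_le _ _) _) ?_)
      simp only [norm_mul, Complex.norm_real, Real.norm_eq_abs, abs_of_pos (M.gauge_pos _),
        abs_of_pos (M.p_pos _), abs_of_pos (M.q_pos _), abs_of_nonneg (M.I_pos _).2,
        abs_of_pos (M.I_pos _).1]
    rw [Finset.sum_range_succ _ k] at ih ⊢
    linarith

theorem tendsto_wronskK (hb : M.Bdry x y) : Tendsto (M.wronskK x y) atTop (𝓝 0) := by
  obtain ⟨β, hx, hy⟩ := hb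
  have h1 : Tendsto (fun k => x k * M.K₂ k - y k * M.K₁ k) atTop (𝓝 0) := by
    have h := (hx.mul ((Complex.continuous_ofReal.tendsto _).comp M.tendsto_K₂)).sub
      (hy.mul ((Complex.continuous_ofReal.tendsto _).comp M.tendsto_K₁))
    rwa [show β * (M.lim₁ : ℂ) * M.lim₂ - β * M.lim₂ * M.lim₁ = 0 by ring] at h
  refine squeeze_zero_norm (a := fun k => 1 / M.J * ‖x k * M.K₂ k - y k * M.K₁ k‖)
    (fun k => ?_) (by simpa using h1.norm.const_mul (1 / M.J))
  rw [wronskK, norm_mul, Complex.norm_real, Real.norm_of_nonneg (M.gauge_pos k).le]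
  exact mul_le_mul_of_nonneg_right (M.gauge_le k) (norm_nonneg _)

/-- `E` bounds the squared weighted `ℓ²` norm of the right-hand side. -/
def DataBound (M : Mode) (r s : ℕ → ℂ) (E : ℝ) : Prop :=
  ∀ L, ∑ j ∈ Finset.range L, (M.p j * ‖s j‖ ^ 2 + M.q j * ‖r j‖ ^ 2) ≤ E

theorem DataBound.nonneg {E : ℝ} (hE : M.DataBound r s E) : 0 ≤ E := by simpa using hE 0

theorem sq_add_five_le (a b c d e : ℝ) :
    (a + b + c + d + e) ^ 2 ≤ 5 * (a ^ 2 + b ^ 2 + c ^ 2 + d ^ 2 + e ^ 2) := by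
  linarith [sq_nonneg (a - b), sq_nonneg (a - c), sq_nonneg (a - d), sq_nonneg (a - e),
    sq_nonneg (b - c), sq_nonneg (b - d), sq_nonneg (b - e), sq_nonneg (c - d),
    sq_nonneg (c - e), sq_nonneg (d - e)]

theorem weighted_sum_sq_le {S T : ℕ} (hST : S ≤ T) {w u a b c d e : ℕ → ℝ} (hw : ∀ k, 0 ≤ w k)
    (hu : ∀ k, 0 ≤ u k) (hle : ∀ k < T, u k ≤ a k + b k + c k + d k + e k)
    {A C : ℝ} (ha : ∑ k ∈ Finset.range T, w k * a k ^ 2 ≤ A)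
    (hb : ∑ k ∈ Finset.range T, w k * b k ^ 2 ≤ C)
    (hc : ∑ k ∈ Finset.range T, w k * c k ^ 2 ≤ A)
    (hd : ∑ k ∈ Finset.range T, w k * d k ^ 2 ≤ C) :
    ∑ k ∈ Finset.range S, w k * u k ^ 2 ≤
      10 * (A + C) + 5 * ∑ k ∈ Finset.range S, w k * e k ^ 2 := by
  have hsub : ∀ v : ℕ → ℝ, ∑ k ∈ Finset.range S, w k * v k ^ 2 ≤
      ∑ k ∈ Finset.range T, w k * v k ^ 2 := fun v =>
    Finset.sum_le_sum_of_subset_of_nonneg (Finset.range_subset_range.2 hST)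
      fun k _ _ => mul_nonneg (hw k) (sq_nonneg _)
  calc ∑ k ∈ Finset.range S, w k * u k ^ 2
      ≤ ∑ k ∈ Finset.range S, w k *
          (5 * (a k ^ 2 + b k ^ 2 + c k ^ 2 + d k ^ 2 + e k ^ 2)) := by
        refine Finset.sum_le_sum fun k hk => mul_le_mul_of_nonneg_left ?_ (hw k)
        exact (pow_le_pow_left₀ (hu k) (hle k ((Finset.mem_range.1 hk).trans_le hST)) 2).trans
          (sq_add_five_le _ _ _ _ _)
    _ = 5 * (∑ k ∈ Finset.range S, w k * a k ^ 2 + ∑ k ∈ Finset.range S, w k * b k ^ 2 +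
          ∑ k ∈ Finset.range S, w k * c k ^ 2 + ∑ k ∈ Finset.range S, w k * d k ^ 2 +
          ∑ k ∈ Finset.range S, w k * e k ^ 2) := by
        simp only [← Finset.sum_add_distrib, Finset.mul_sum]
        exact Finset.sum_congr rfl fun k _ => by ring
    _ ≤ _ := by linarith [hsub a, hsub b, hsub c, hsub d]

/-- Solutions satisfying the boundary condition are bounded by the data, with a constant that
does not depend on `m`: by `fst_eq` and `snd_eq` they are sums of eight integral operators, to which
the Schur tests of `GreenPair` apply. -/
theorem IsSol.apriori (h : M.IsSol x y r s) (hb : M.Bdry x y) {E : ℝ} (hE : M.DataBound r s E)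
    (S : ℕ) : ∑ k ∈ Finset.range S, (M.p k * ‖x k‖ ^ 2 + M.q k * ‖y k‖ ^ 2) ≤
      40 * M.σ * (M.ρ + M.τ) * E := by
  set Λ : ℝ := 2 * M.σ * (M.ρ + M.τ) with hΛ
  have hΛ0 : 0 ≤ Λ := mul_nonneg (mul_nonneg zero_le_two M.σ_nonneg)
    (add_nonneg M.ρ_nonneg M.τ_nonneg)
  have hp := fun k => (M.p_pos k).le
  have hq := fun k => (M.q_pos k).le
  have hg := fun k => (M.gauge_pos k).le
  have hI₁ := fun k => (M.I_pos k).1.le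
  have hI₂ := fun k => (M.I_pos k).2
  have hK₂ := fun k => (M.K₂_pos k).le
  have hmain : ∀ L, S ≤ L → ∑ k ∈ Finset.range S, (M.p k * ‖x k‖ ^ 2 + M.q k * ‖y k‖ ^ 2) ≤
      20 * Λ * E + ‖M.wronskK x y L‖ ^ 2 *
        (5 * ∑ k ∈ Finset.range S, (M.p k * M.I₁ k ^ 2 + M.q k * M.I₂ k ^ 2)) := by
    intro L hSL
    set A := ∑ j ∈ Finset.range (L + 1), M.p j * ‖s j‖ ^ 2 with hA
    set C := ∑ j ∈ Finset.range (L + 1), M.q j * ‖r j‖ ^ 2 with hC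
    have hAC : A + C ≤ E := by
      rw [hA, hC, ← Finset.sum_add_distrib]
      exact hE (L + 1)
    have G := M.greenPair_gauge_I
    have G' := M.greenPair_gauge_K
    set f := fun j => ‖s j‖ with hf
    set f' := fun j => ‖r j‖ with hf'
    have hnn : ∀ (a : ℕ → ℝ) (w : ℕ → ℝ) (v : ℕ → ℂ) (j : ℕ), 0 ≤ a j → 0 ≤ w j →
        0 ≤ a j * (w j * ‖v j‖) := fun a w v j ha hw =>
      mul_nonneg ha (mul_nonneg hw (norm_nonneg _))
    have hKbound : ∀ k < L + 1, ‖M.wronskK x y k‖ ≤ ‖M.wronskK x y L‖ +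
        ∑ j ∈ Finset.Ico (k + 1) (L + 1), (M.gauge j * M.K₁ j) * (M.p j * f j) +
        ∑ j ∈ Finset.Ico k (L + 1), (M.gauge j * M.K₂ j) * (M.q j * f' j) := fun k hk =>
      (h.norm_wronskK_le (Nat.lt_succ_iff.1 hk)).trans (add_le_add_right
        (Finset.sum_le_sum_of_subset_of_nonneg (Finset.Ico_subset_Ico_right L.le_succ)
          fun j _ _ => hnn (fun j => M.gauge j * M.K₂ j) M.q r j
            (mul_nonneg (hg j) (hK₂ j)) (hq j)) _)
    have hKsub : ∀ k, ∑ j ∈ Finset.Ico (k + 1) (L + 1), (M.gauge j * M.K₁ j) * (M.p j * f j) ≤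
        ∑ j ∈ Finset.Ico k (L + 1), (M.gauge j * M.K₁ j) * (M.p j * f j) := fun k =>
      Finset.sum_le_sum_of_subset_of_nonneg (Finset.Ico_subset_Ico_left k.le_succ)
        fun j _ _ => hnn (fun j => M.gauge j * M.K₁ j) M.p s j
          (mul_nonneg (hg j) (M.K₁_nonneg j)) (hp j)
    have hIsub : ∀ k, ∑ j ∈ Finset.range k, (M.gauge j * M.I₂ j) * (M.q j * f' j) ≤
        ∑ j ∈ Finset.range (k + 1), (M.gauge j * M.I₂ j) * (M.q j * f' j) := fun k =>
      Finset.sum_le_sum_of_subset_of_nonneg (Finset.range_subset_range.2 k.le_succ)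
        fun j _ _ => hnn (fun j => M.gauge j * M.I₂ j) M.q r j
          (mul_nonneg (hg j) (hI₂ j)) (hq j)
    have hx : ∀ k < L + 1, ‖x k‖ ≤
        M.I₁ k * ∑ j ∈ Finset.Ico k (L + 1), (M.gauge j * M.K₁ j) * (M.p j * f j) +
        M.I₁ k * ∑ j ∈ Finset.Ico k (L + 1), (M.gauge j * M.K₂ j) * (M.q j * f' j) +
        M.K₁ k * ∑ j ∈ Finset.range (k + 1), (M.gauge j * M.I₁ j) * (M.p j * f j) +
        M.K₁ k * ∑ j ∈ Finset.range k, (M.gauge j * M.I₂ j) * (M.q j * f' j) +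
        ‖M.wronskK x y L‖ * M.I₁ k := by
      intro k hk
      have h1 : ‖x k‖ ≤ M.I₁ k * ‖M.wronskK x y k‖ + M.K₁ k * ‖M.wronskI x y k‖ := by
        conv_lhs => rw [M.fst_eq x y k]
        refine (norm_add_le _ _).trans_eq ?_
        rw [norm_mul, norm_mul, Complex.norm_real, Complex.norm_real,
          Real.norm_of_nonneg (hI₁ k), Real.norm_of_nonneg (M.K₁_nonneg k)]
      have h2 := mul_le_mul_of_nonneg_left (hKbound k hk) (hI₁ k)
      have h3 := mul_le_mul_of_nonneg_left (h.norm_wronskI_le k) (M.K₁_nonneg k)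
      have h4 := mul_le_mul_of_nonneg_left (hKsub k) (hI₁ k)
      linarith
    have hy : ∀ k < L + 1, ‖y k‖ ≤
        M.K₂ k * ∑ j ∈ Finset.range (k + 1), (M.gauge j * M.I₁ j) * (M.p j * f j) +
        M.K₂ k * ∑ j ∈ Finset.range (k + 1), (M.gauge j * M.I₂ j) * (M.q j * f' j) +
        M.I₂ k * ∑ j ∈ Finset.Ico (k + 1) (L + 1), (M.gauge j * M.K₁ j) * (M.p j * f j) +
        M.I₂ k * ∑ j ∈ Finset.Ico k (L + 1), (M.gauge j * M.K₂ j) * (M.q j * f' j) +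
        ‖M.wronskK x y L‖ * M.I₂ k := by
      intro k hk
      have h1 : ‖y k‖ ≤ M.K₂ k * ‖M.wronskI x y k‖ + M.I₂ k * ‖M.wronskK x y k‖ := by
        conv_lhs => rw [M.snd_eq x y k]
        refine (norm_sub_le _ _).trans_eq ?_
        rw [norm_mul, norm_mul, Complex.norm_real, Complex.norm_real,
          Real.norm_of_nonneg (hI₂ k), Real.norm_of_nonneg (hK₂ k)]
      have h2 := mul_le_mul_of_nonneg_left (hKbound k hk) (hI₂ k)
      have h3 := mul_le_mul_of_nonneg_left (h.norm_wronskI_le k) (hK₂ k)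
      have h4 := mul_le_mul_of_nonneg_left (hIsub k) (hK₂ k)
      linarith
    have hX := weighted_sum_sq_le (hSL.trans L.le_succ) hp (fun k => norm_nonneg (x k)) hx
      (G'.schur_K₁_I₁ (L + 1) f).2 (G'.schur_K₂_I₁ (L + 1) f').2
      (G.schur_K₁_I₁ (L + 1) f).1 (G.schur_K₁_I₂ (L + 1) f').1
    have hY := weighted_sum_sq_le (hSL.trans L.le_succ) hq (fun k => norm_nonneg (y k)) hy
      (G.schur_K₂_I₁ (L + 1) f).1 (G.schur_K₂_I₂ (L + 1) f').1
      (G'.schur_K₁_I₂ (L + 1) f).2 (G'.schur_K₂_I₂ (L + 1) f').2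
    have hΛE := mul_le_mul_of_nonneg_left hAC hΛ0
    have hI : ∀ w v : ℕ → ℝ, ∑ k ∈ Finset.range S, w k * (‖M.wronskK x y L‖ * v k) ^ 2 =
        ‖M.wronskK x y L‖ ^ 2 * ∑ k ∈ Finset.range S, w k * v k ^ 2 := fun w v => by
      rw [Finset.mul_sum]
      exact Finset.sum_congr rfl fun k _ => by ring
    rw [hI] at hX hY
    rw [Finset.sum_add_distrib, Finset.sum_add_distrib]
    linarith
  have hlim : Tendsto (fun L => 20 * Λ * E + ‖M.wronskK x y L‖ ^ 2 *
      (5 * ∑ k ∈ Finset.range S, (M.p k * M.I₁ k ^ 2 + M.q k * M.I₂ k ^ 2))) atTop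
      (𝓝 (20 * Λ * E)) := by
    have h0 := ((tendsto_wronskK hb).norm.pow 2).mul_const
      (5 * ∑ k ∈ Finset.range S, (M.p k * M.I₁ k ^ 2 + M.q k * M.I₂ k ^ 2))
    simpa using h0.const_add (20 * Λ * E)
  refine (ge_of_tendsto hlim (eventually_atTop.2 ⟨S, hmain⟩)).trans_eq ?_
  rw [hΛ]
  ring

/-- Energy estimate: the solution operator has norm at most `1 / (J * m)`. The gauge factor
makes the terms of `Re (x̄ y)` telescope even though `c₁ ≠ c₂`. The constant `J` bounds this factor
and its inverse; for the Dirac operator it depends on `n`. -/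
theorem IsSol.energy (h : M.IsSol x y r s) (hb : M.Bdry x y) (hm : 0 < M.m) {E : ℝ}
    (hE : M.DataBound r s E) (S : ℕ) :
    ∑ k ∈ Finset.range S, (M.p k * ‖x k‖ ^ 2 + M.q k * ‖y k‖ ^ 2) ≤
      1 / (M.J * M.m) ^ 2 * E := by
  set R : ℕ → ℝ := fun k => (starRingEnd ℂ (x k) * y k).re with hR
  have hg := M.gauge_pos
  have hyoung : ∀ a b : ℂ, 2 * M.m * |(starRingEnd ℂ a * b).re| ≤
      M.m ^ 2 * ‖a‖ ^ 2 + ‖b‖ ^ 2 := fun a b => by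
    have h1 : |(starRingEnd ℂ a * b).re| ≤ ‖a‖ * ‖b‖ :=
      (Complex.abs_re_le_norm _).trans_eq (by rw [norm_mul, RCLike.norm_conj])
    nlinarith [sq_nonneg (M.m * ‖a‖ - ‖b‖), mul_le_mul_of_nonneg_left h1 hm.le]
  -- one step of the energy identity
  have hid : ∀ k, M.gauge (k + 1) * R (k + 1) +
      M.gauge (k + 1) * M.p (k + 1) * (M.m * ‖x (k + 1)‖ ^ 2 -
        (starRingEnd ℂ (x (k + 1)) * s (k + 1)).re) +
      M.gauge k * M.q k * (M.m * ‖y k‖ ^ 2 + (starRingEnd ℂ (y k) * r k).re) =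
      M.gauge k * R k := by
    intro k
    have e1 := h.fst k
    have e2 := h.snd_succ k
    have hgs := M.gauge_step k
    have e1r := congrArg Complex.re e1
    have e1i := congrArg Complex.im e1
    have e2r := congrArg Complex.re e2
    have e2i := congrArg Complex.im e2
    simp only [Complex.add_re, Complex.sub_re, Complex.mul_re, Complex.ofReal_re,
      Complex.ofReal_im, zero_mul, sub_zero, Complex.add_im, Complex.sub_im, Complex.mul_im,
      add_zero] at e1r e1i e2r e2i
    simp only [hR, Complex.sq_norm, Complex.normSq_apply, Complex.mul_re, Complex.conj_re,
      Complex.conj_im]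
    linear_combination M.gauge (k + 1) * (x (k + 1)).re * e2r
      + M.gauge (k + 1) * (x (k + 1)).im * e2i
      - M.gauge k * (y k).re * e1r - M.gauge k * (y k).im * e1i
      + ((x (k + 1)).re * (y k).re + (x (k + 1)).im * (y k).im) * hgs
  have hzero : M.gauge 0 * R 0 + M.gauge 0 * M.p 0 * (M.m * ‖x 0‖ ^ 2 -
      (starRingEnd ℂ (x 0) * s 0).re) = 0 := by
    have e2r := congrArg Complex.re h.snd_zero
    have e2i := congrArg Complex.im h.snd_zero
    simp only [Complex.sub_re, Complex.mul_re, Complex.ofReal_re,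
      Complex.ofReal_im, zero_mul, sub_zero, Complex.sub_im, Complex.mul_im,
      add_zero] at e2r e2i
    simp only [hR, Complex.sq_norm, Complex.normSq_apply, Complex.mul_re, Complex.conj_re,
      Complex.conj_im]
    linear_combination M.gauge 0 * (x 0).re * e2r + M.gauge 0 * (x 0).im * e2i
  have hX : ∀ k, M.gauge k * M.p k * (M.m ^ 2 * ‖x k‖ ^ 2) ≤
      2 * M.m * (M.gauge k * M.p k * (M.m * ‖x k‖ ^ 2 - (starRingEnd ℂ (x k) * s k).re)) +
        M.gauge k * M.p k * ‖s k‖ ^ 2 := fun k => by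
    have h1 : M.m ^ 2 * ‖x k‖ ^ 2 ≤
        2 * M.m * (M.m * ‖x k‖ ^ 2 - (starRingEnd ℂ (x k) * s k).re) + ‖s k‖ ^ 2 := by
      nlinarith [hyoung (x k) (s k), mul_le_mul_of_nonneg_left
        (le_abs_self (starRingEnd ℂ (x k) * s k).re) hm.le]
    have := mul_le_mul_of_nonneg_left h1 (mul_pos (hg k) (M.p_pos k)).le
    linarith
  have hY : ∀ k, M.gauge k * M.q k * (M.m ^ 2 * ‖y k‖ ^ 2) ≤
      2 * M.m * (M.gauge k * M.q k * (M.m * ‖y k‖ ^ 2 + (starRingEnd ℂ (y k) * r k).re)) +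
        M.gauge k * M.q k * ‖r k‖ ^ 2 := fun k => by
    have h1 : M.m ^ 2 * ‖y k‖ ^ 2 ≤
        2 * M.m * (M.m * ‖y k‖ ^ 2 + (starRingEnd ℂ (y k) * r k).re) + ‖r k‖ ^ 2 := by
      nlinarith [hyoung (y k) (r k), mul_le_mul_of_nonneg_left
        (neg_abs_le (starRingEnd ℂ (y k) * r k).re) hm.le]
    have := mul_le_mul_of_nonneg_left h1 (mul_pos (hg k) (M.q_pos k)).le
    linarith
  have hsum : ∀ N, 2 * M.m * (M.gauge N * R N) + M.gauge N * M.p N * (M.m ^ 2 * ‖x N‖ ^ 2) +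
      M.m ^ 2 * ∑ k ∈ Finset.range N, M.gauge k * (M.p k * ‖x k‖ ^ 2 + M.q k * ‖y k‖ ^ 2) ≤
      M.gauge N * M.p N * ‖s N‖ ^ 2 +
      ∑ k ∈ Finset.range N, M.gauge k * (M.p k * ‖s k‖ ^ 2 + M.q k * ‖r k‖ ^ 2) := by
    intro N
    induction N with
    | zero =>
      simp only [Finset.range_zero, Finset.sum_empty]
      linarith [hX 0, congrArg (2 * M.m * ·) hzero]
    | succ N ih =>
      rw [Finset.sum_range_succ, Finset.sum_range_succ]
      linarith [hX (N + 1), hY N, congrArg (2 * M.m * ·) (hid N)]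
  have hmain : ∀ N, S ≤ N → M.J * (M.m ^ 2 *
      ∑ k ∈ Finset.range S, (M.p k * ‖x k‖ ^ 2 + M.q k * ‖y k‖ ^ 2)) ≤
      1 / M.J * E - 2 * M.m * (M.gauge N * R N) := by
    intro N hN
    have h1 : M.J * ∑ k ∈ Finset.range S, (M.p k * ‖x k‖ ^ 2 + M.q k * ‖y k‖ ^ 2) ≤
        ∑ k ∈ Finset.range N, M.gauge k * (M.p k * ‖x k‖ ^ 2 + M.q k * ‖y k‖ ^ 2) := by
      rw [Finset.mul_sum]
      have hnn : ∀ k, 0 ≤ M.p k * ‖x k‖ ^ 2 + M.q k * ‖y k‖ ^ 2 := fun k =>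
        add_nonneg (mul_nonneg (M.p_pos k).le (sq_nonneg _))
          (mul_nonneg (M.q_pos k).le (sq_nonneg _))
      exact (Finset.sum_le_sum fun k _ => mul_le_mul_of_nonneg_right (M.J_le_gauge k) (hnn k)).trans
        (Finset.sum_le_sum_of_subset_of_nonneg (Finset.range_subset_range.2 hN)
          fun k _ _ => mul_nonneg (hg k).le (hnn k))
    have h2 : M.gauge N * M.p N * ‖s N‖ ^ 2 +
        ∑ k ∈ Finset.range N, M.gauge k * (M.p k * ‖s k‖ ^ 2 + M.q k * ‖r k‖ ^ 2) ≤
        1 / M.J * E := by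
      have h3 : ∑ k ∈ Finset.range (N + 1), M.gauge k * (M.p k * ‖s k‖ ^ 2 + M.q k * ‖r k‖ ^ 2) ≤
          1 / M.J * E := by
        refine le_trans ?_ (mul_le_mul_of_nonneg_left (hE (N + 1)) (by positivity [M.J_pos]))
        rw [Finset.mul_sum]
        exact Finset.sum_le_sum fun k _ => mul_le_mul_of_nonneg_right (M.gauge_le k)
          (add_nonneg (mul_nonneg (M.p_pos k).le (sq_nonneg _))
            (mul_nonneg (M.q_pos k).le (sq_nonneg _)))
      rw [Finset.sum_range_succ] at h3
      have := mul_nonneg (mul_pos (hg N) (M.q_pos N)).le (sq_nonneg ‖r N‖)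
      linarith
    have h4 := mul_nonneg (mul_pos (hg N) (M.p_pos N)).le
      (mul_nonneg (sq_nonneg M.m) (sq_nonneg ‖x N‖))
    have h5 := mul_le_mul_of_nonneg_left h1 (sq_nonneg M.m)
    linarith [hsum N]
  obtain ⟨β, hx, hy⟩ := hb
  set t : ℝ := (starRingEnd ℂ (β * M.lim₁) * (β * M.lim₂)).re with ht
  -- the boundary condition enters through the sign of the energy at infinity
  have ht0 : 0 ≤ t := by
    have : t = ‖β‖ ^ 2 * M.lim₁ * M.lim₂ := by
      simp only [ht, Complex.sq_norm, Complex.normSq_apply, map_mul, Complex.conj_ofReal,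
        Complex.mul_re, Complex.mul_im, Complex.conj_re, Complex.conj_im, Complex.ofReal_re,
        Complex.ofReal_im]
      ring
    rw [this]
    exact mul_nonneg (mul_nonneg (sq_nonneg _) M.lim₁_nonneg) M.lim₂_pos.le
  have hRlim : Tendsto R atTop (𝓝 t) :=
    (Complex.continuous_re.tendsto _).comp
      (((Complex.continuous_conj.tendsto _).comp hx).mul hy)
  have hlow : ∀ N, -(1 / M.J * |R N - t|) ≤ M.gauge N * R N := fun N => by
    have h1 : -|R N - t| ≤ R N := by linarith [neg_abs_le (R N - t)]
    have h2 := mul_le_mul_of_nonneg_left h1 (hg N).le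
    have h3 := mul_le_mul_of_nonneg_right (M.gauge_le N) (abs_nonneg (R N - t))
    linarith
  have hlim : Tendsto (fun N => 1 / M.J * E + 2 * M.m * (1 / M.J * |R N - t|)) atTop
      (𝓝 (1 / M.J * E)) := by
    have h0 : Tendsto (fun N => |R N - t|) atTop (𝓝 0) := by
      simpa using (hRlim.sub_const t).abs
    simpa using ((h0.const_mul (1 / M.J)).const_mul (2 * M.m)).const_add (1 / M.J * E)
  have hfin := ge_of_tendsto hlim (eventually_atTop.2 ⟨S, fun N hN => (hmain N hN).trans (by
    linarith [mul_le_mul_of_nonneg_left (hlow N) (mul_pos two_pos hm).le])⟩)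
  have hJ := M.J_pos
  have hpos : 0 < M.J * M.m ^ 2 := by positivity
  have : ∑ k ∈ Finset.range S, (M.p k * ‖x k‖ ^ 2 + M.q k * ‖y k‖ ^ 2) ≤
      (1 / M.J * E) / (M.J * M.m ^ 2) := by
    rw [le_div_iff₀ hpos]
    linarith
  refine this.trans_eq ?_
  field_simp

/-! ### Decay of tails and existence of solutions -/

theorem sq_sum_weight_le {w u : ℕ → ℝ} (hw : ∀ k, 0 ≤ w k) (t : Finset ℕ) :
    (∑ k ∈ t, w k * u k) ^ 2 ≤ (∑ k ∈ t, w k) * ∑ k ∈ t, w k * u k ^ 2 :=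
  Finset.sum_sq_le_sum_mul_sum_of_sq_le_mul t (fun k _ => hw k)
    (fun k _ => mul_nonneg (hw k) (sq_nonneg _)) fun k _ => le_of_eq (by ring)

/-- Solutions satisfying the boundary condition are bounded pointwise by the data. -/
theorem exists_sup_bound (M : Mode) : ∃ C : ℝ, 0 ≤ C ∧ ∀ (x y r s : ℕ → ℂ) (E : ℝ),
    M.IsSol x y r s → M.Bdry x y → M.DataBound r s E →
      ∀ k, ‖x k‖ ^ 2 ≤ C * E ∧ ‖y k‖ ^ 2 ≤ C * E := by
  set Λ : ℝ := 40 * M.σ * (M.ρ + M.τ) with hΛ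
  have hΛ0 : 0 ≤ Λ := mul_nonneg (mul_nonneg (by norm_num) M.σ_nonneg)
    (add_nonneg M.ρ_nonneg M.τ_nonneg)
  set A : ℝ := 2 * (M.σ + M.τ) * (1 + M.m ^ 2 * Λ) with hA
  have hστ : 0 ≤ M.σ + M.τ := add_nonneg M.σ_nonneg M.τ_nonneg
  have hA0 : 0 ≤ A := by positivity
  have hκ : 0 ≤ M.lim₁ / M.lim₂ := div_nonneg M.lim₁_nonneg M.lim₂_pos.le
  refine ⟨(M.lim₁ / M.lim₂ + 1) ^ 2 * A, by positivity, fun x y r s E h hb hE => ?_⟩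
  have hE0 := hE.nonneg
  have hap := h.apriori hb hE
  have hp := fun k => (M.p_pos k).le
  have hq := fun k => (M.q_pos k).le
  -- the sums of `p |s - m x|` and of `q |m y + r|` are at most `√(A E)`
  have hS : ∀ N, (∑ j ∈ Finset.range N, M.p j * (‖s j‖ + M.m * ‖x j‖)) ^ 2 ≤ A * E := fun N => by
    have h1 : ∑ j ∈ Finset.range N, M.p j * (‖s j‖ + M.m * ‖x j‖) ^ 2 ≤
        2 * (1 + M.m ^ 2 * Λ) * E := by
      calc _ ≤ ∑ j ∈ Finset.range N, (2 * (M.p j * ‖s j‖ ^ 2 + M.q j * ‖r j‖ ^ 2) +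
            2 * M.m ^ 2 * (M.p j * ‖x j‖ ^ 2 + M.q j * ‖y j‖ ^ 2)) := by
            refine Finset.sum_le_sum fun j _ => ?_
            have e1 := mul_nonneg (hp j) (sq_nonneg (‖s j‖ - M.m * ‖x j‖))
            have e2 := mul_nonneg (hq j) (sq_nonneg ‖r j‖)
            have e3 := mul_nonneg (sq_nonneg M.m) (mul_nonneg (hq j) (sq_nonneg ‖y j‖))
            linarith
        _ = 2 * ∑ j ∈ Finset.range N, (M.p j * ‖s j‖ ^ 2 + M.q j * ‖r j‖ ^ 2) +
            2 * M.m ^ 2 * ∑ j ∈ Finset.range N, (M.p j * ‖x j‖ ^ 2 + M.q j * ‖y j‖ ^ 2) := by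
            rw [Finset.sum_add_distrib, Finset.mul_sum, Finset.mul_sum]
        _ ≤ 2 * E + 2 * M.m ^ 2 * (Λ * E) := by
            have := hE N
            have := mul_le_mul_of_nonneg_left (hap N) (by positivity : 0 ≤ 2 * M.m ^ 2)
            linarith
        _ = _ := by ring
    refine (sq_sum_weight_le hp _).trans ?_
    calc _ ≤ (M.σ + M.τ) * (2 * (1 + M.m ^ 2 * Λ) * E) := by
          refine mul_le_mul ?_ h1 (Finset.sum_nonneg fun j _ =>
            mul_nonneg (hp j) (sq_nonneg _)) hστ
          linarith [M.sum_p_le (Finset.range N), M.τ_nonneg]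
      _ = A * E := by rw [hA]; ring
  have hR : ∀ k l, (∑ j ∈ Finset.Ico k l, M.q j * (M.m * ‖y j‖ + ‖r j‖)) ^ 2 ≤ A * E :=
      fun k l => by
    have h1 : ∑ j ∈ Finset.Ico k l, M.q j * (M.m * ‖y j‖ + ‖r j‖) ^ 2 ≤
        2 * (1 + M.m ^ 2 * Λ) * E := by
      calc _ ≤ ∑ j ∈ Finset.range l, M.q j * (M.m * ‖y j‖ + ‖r j‖) ^ 2 :=
            Finset.sum_le_sum_of_subset_of_nonneg
              (by rw [Finset.range_eq_Ico]; exact Finset.Ico_subset_Ico_left k.zero_le)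
              fun j _ _ => mul_nonneg (hq j) (sq_nonneg _)
        _ ≤ ∑ j ∈ Finset.range l, (2 * (M.p j * ‖s j‖ ^ 2 + M.q j * ‖r j‖ ^ 2) +
            2 * M.m ^ 2 * (M.p j * ‖x j‖ ^ 2 + M.q j * ‖y j‖ ^ 2)) := by
            refine Finset.sum_le_sum fun j _ => ?_
            have e1 := mul_nonneg (hq j) (sq_nonneg (‖r j‖ - M.m * ‖y j‖))
            have e2 := mul_nonneg (hp j) (sq_nonneg ‖s j‖)
            have e3 := mul_nonneg (sq_nonneg M.m) (mul_nonneg (hp j) (sq_nonneg ‖x j‖))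
            linarith
        _ = 2 * ∑ j ∈ Finset.range l, (M.p j * ‖s j‖ ^ 2 + M.q j * ‖r j‖ ^ 2) +
            2 * M.m ^ 2 * ∑ j ∈ Finset.range l, (M.p j * ‖x j‖ ^ 2 + M.q j * ‖y j‖ ^ 2) := by
            rw [Finset.sum_add_distrib, Finset.mul_sum, Finset.mul_sum]
        _ ≤ 2 * E + 2 * M.m ^ 2 * (Λ * E) := by
            have := hE l
            have := mul_le_mul_of_nonneg_left (hap l) (by positivity : 0 ≤ 2 * M.m ^ 2)
            linarith
        _ = _ := by ring
    refine (sq_sum_weight_le hq _).trans ?_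
    calc _ ≤ (M.σ + M.τ) * (2 * (1 + M.m ^ 2 * Λ) * E) := by
          refine mul_le_mul ?_ h1 (Finset.sum_nonneg fun j _ =>
            mul_nonneg (hq j) (sq_nonneg _)) hστ
          linarith [M.sum_q_le (Finset.Ico k l), M.σ_nonneg]
      _ = A * E := by rw [hA]; ring
  have hAE : 0 ≤ A * E := mul_nonneg hA0 hE0
  have hy : ∀ k, ‖y k‖ ≤ √(A * E) := fun k => by
    have h1 : ∀ k, ‖y k‖ ≤ ∑ j ∈ Finset.range (k + 1), M.p j * (‖s j‖ + M.m * ‖x j‖) := by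
      have h2 : ∀ j, ‖(M.p j : ℂ) * (s j - M.m * x j)‖ ≤ M.p j * (‖s j‖ + M.m * ‖x j‖) :=
          fun j => by
        rw [norm_mul, Complex.norm_real, Real.norm_of_nonneg (hp j)]
        refine mul_le_mul_of_nonneg_left ((norm_sub_le _ _).trans_eq ?_) (hp j)
        rw [norm_mul, Complex.norm_real, Real.norm_of_nonneg M.m_nonneg]
      intro k
      induction k with
      | zero => simpa [h.snd_zero] using h2 0
      | succ k ih =>
        rw [Finset.sum_range_succ, h.snd_succ k]
        refine (norm_add_le _ _).trans (add_le_add (le_trans ?_ ih) (h2 (k + 1)))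
        rw [norm_mul, Complex.norm_real, Real.norm_of_nonneg (M.c₂_pos k).le]
        exact mul_le_of_le_one_left (norm_nonneg _) (M.c₂_le_one k)
    exact (h1 k).trans (Real.le_sqrt_of_sq_le (hS (k + 1)))
  obtain ⟨β, hxlim, hylim⟩ := hb
  have hβ : ‖β‖ * M.lim₂ ≤ √(A * E) := by
    have h1 := le_of_tendsto' hylim.norm hy
    rwa [norm_mul, Complex.norm_real, Real.norm_of_nonneg M.lim₂_pos.le] at h1
  have hx : ∀ k, ‖x k‖ ≤ (M.lim₁ / M.lim₂ + 1) * √(A * E) := fun k => by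
    have h1 : ∀ l, k ≤ l → ‖x k‖ ≤ ‖x l‖ +
        ∑ j ∈ Finset.Ico k l, M.q j * (M.m * ‖y j‖ + ‖r j‖) := by
      intro l hl
      induction l, hl using Nat.le_induction with
      | base => simp
      | succ l hl ih =>
        rw [Finset.sum_Ico_succ_top hl]
        have h2 : ‖x l‖ ≤ ‖x (l + 1)‖ + M.q l * (M.m * ‖y l‖ + ‖r l‖) := by
          rw [h.fst l]
          refine (norm_add_le _ _).trans (add_le_add ?_ ?_)
          · rw [norm_mul, Complex.norm_real, Real.norm_of_nonneg (M.c₁_pos l).le]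
            exact mul_le_of_le_one_left (norm_nonneg _) (M.c₁_le_one l)
          · rw [norm_mul, Complex.norm_real, Real.norm_of_nonneg (hq l)]
            refine mul_le_mul_of_nonneg_left ((norm_add_le _ _).trans_eq ?_) (hq l)
            rw [norm_mul, Complex.norm_real, Real.norm_of_nonneg M.m_nonneg]
        linarith
    have h2 : ‖x k‖ ≤ ‖β * M.lim₁‖ + √(A * E) :=
      ge_of_tendsto (hxlim.norm.add_const _) (eventually_atTop.2 ⟨k, fun l hl =>
        (h1 l hl).trans (add_le_add_right (Real.le_sqrt_of_sq_le (hR k l)) _)⟩)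
    rw [norm_mul, Complex.norm_real, Real.norm_of_nonneg M.lim₁_nonneg] at h2
    have h3 : ‖β‖ * M.lim₁ = M.lim₁ / M.lim₂ * (‖β‖ * M.lim₂) := by
      have := M.lim₂_pos.ne'
      field_simp
    have h4 := mul_le_mul_of_nonneg_left hβ hκ
    linarith
  have hsq : ∀ u : ℝ, 0 ≤ u → u ≤ (M.lim₁ / M.lim₂ + 1) * √(A * E) →
      u ^ 2 ≤ (M.lim₁ / M.lim₂ + 1) ^ 2 * A * E := fun u h0 hu => by
    refine (pow_le_pow_left₀ h0 hu 2).trans_eq ?_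
    rw [mul_pow, Real.sq_sqrt hAE]
    ring
  refine fun k => ⟨hsq _ (norm_nonneg _) (hx k), hsq _ (norm_nonneg _) ((hy k).trans ?_)⟩
  linarith [mul_nonneg hκ (Real.sqrt_nonneg (A * E))]

/-- The solution operator of one mode is compact: tails of solutions are uniformly small. -/
theorem exists_tail_bound (M : Mode) {ε : ℝ} (hε : 0 < ε) : ∃ N : ℕ,
    ∀ (x y r s : ℕ → ℂ) (E : ℝ), M.IsSol x y r s → M.Bdry x y → M.DataBound r s E →
      ∀ L, ∑ k ∈ Finset.Ico N L, (M.p k * ‖x k‖ ^ 2 + M.q k * ‖y k‖ ^ 2) ≤ ε * E := by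
  obtain ⟨C, hC, hbound⟩ := M.exists_sup_bound
  have htail : Tendsto (fun N => C * ∑' k, (M.p (k + N) + M.q (k + N))) atTop (𝓝 0) := by
    simpa using (tendsto_sum_nat_add fun k => M.p k + M.q k).const_mul C
  obtain ⟨N, hN⟩ := (htail.eventually_le_const hε).exists
  refine ⟨N, fun x y r s E h hb hE L => ?_⟩
  have hsum : ∑ k ∈ Finset.Ico N L, (M.p k + M.q k) ≤ ∑' k, (M.p (k + N) + M.q (k + N)) := by
    rw [Finset.sum_Ico_eq_sum_range]
    simp only [add_comm N]
    exact (((summable_nat_add_iff N).2 (M.p_summable.add M.q_summable))).sum_le_tsum _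
      fun k _ => add_nonneg (M.p_pos _).le (M.q_pos _).le
  have h0 := hE.nonneg
  calc ∑ k ∈ Finset.Ico N L, (M.p k * ‖x k‖ ^ 2 + M.q k * ‖y k‖ ^ 2)
      ≤ ∑ k ∈ Finset.Ico N L, (M.p k + M.q k) * (C * E) := by
        refine Finset.sum_le_sum fun k _ => ?_
        obtain ⟨h1, h2⟩ := hbound x y r s E h hb hE k
        rw [add_mul]
        exact add_le_add (mul_le_mul_of_nonneg_left h1 (M.p_pos k).le)
          (mul_le_mul_of_nonneg_left h2 (M.q_pos k).le)
    _ = (C * ∑ k ∈ Finset.Ico N L, (M.p k + M.q k)) * E := by rw [← Finset.sum_mul]; ring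
    _ ≤ ε * E := mul_le_mul_of_nonneg_right
        ((mul_le_mul_of_nonneg_left hsum hC).trans hN) h0

theorem summable_weighted {w b : ℕ → ℝ} (hw : ∀ k, 0 ≤ w k) (hsum : Summable w) {C : ℝ}
    (hb : ∀ k, |b k| ≤ C) {u : ℕ → ℂ} {E : ℝ}
    (hE : ∀ L, ∑ k ∈ Finset.range L, w k * ‖u k‖ ^ 2 ≤ E) :
    Summable fun k => (b k : ℂ) * (w k * u k) := by
  have h2 : Summable fun k => w k * ‖u k‖ ^ 2 :=
    summable_of_sum_range_le (fun k => mul_nonneg (hw k) (sq_nonneg _)) hE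
  refine Summable.of_norm_bounded ((hsum.add h2).mul_left C) fun k => ?_
  have hC : 0 ≤ C := (abs_nonneg _).trans (hb k)
  rw [norm_mul, norm_mul, Complex.norm_real, Complex.norm_real, Real.norm_eq_abs,
    Real.norm_of_nonneg (hw k)]
  refine mul_le_mul (hb k) ?_ (mul_nonneg (hw k) (norm_nonneg _)) hC
  nlinarith [hw k, mul_nonneg (hw k) (sq_nonneg (‖u k‖ - 1)),
    mul_nonneg (hw k) (sq_nonneg ‖u k‖)]

theorem I₁_le (M : Mode) (k : ℕ) : M.I₁ k ≤ 1 / (M.J * M.lim₂) := by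
  have h1 := M.greenPair_gauge_K.I₁_mul_K₂_le k
  have h2 : M.J * M.lim₂ ≤ M.gauge k * M.K₂ k :=
    mul_le_mul (M.J_le_gauge k) (M.K₂_anti.le_of_tendsto M.tendsto_K₂ k) M.lim₂_pos.le
      (M.gauge_pos k).le
  rw [le_div_iff₀ (mul_pos M.J_pos M.lim₂_pos)]
  exact (mul_le_mul_of_nonneg_left h2 (M.I_pos k).1.le).trans h1

/-- Existence of solutions satisfying the boundary condition, by variation of constants. -/
theorem exists_isSol (M : Mode) {r s : ℕ → ℂ} {E : ℝ} (hE : M.DataBound r s E) :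
    ∃ x y : ℕ → ℂ, M.IsSol x y r s ∧ M.Bdry x y := by
  have hp := fun k => (M.p_pos k).le
  have hq := fun k => (M.q_pos k).le
  have hEs : ∀ L, ∑ k ∈ Finset.range L, M.p k * ‖s k‖ ^ 2 ≤ E := fun L =>
    (Finset.sum_le_sum fun k _ => le_add_of_nonneg_right
      (mul_nonneg (hq k) (sq_nonneg _))).trans (hE L)
  have hEr : ∀ L, ∑ k ∈ Finset.range L, M.q k * ‖r k‖ ^ 2 ≤ E := fun L =>
    (Finset.sum_le_sum fun k _ => le_add_of_nonneg_left
      (mul_nonneg (hp k) (sq_nonneg _))).trans (hE L)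
  -- all coefficient sequences are bounded
  have hmul : ∀ {b : ℕ → ℝ} {C : ℝ}, (∀ k, 0 ≤ b k) → (∀ k, b k ≤ C) →
      ∀ k, |M.gauge k * b k| ≤ 1 / M.J * C := fun hb hC k => by
    rw [abs_of_nonneg (mul_nonneg (M.gauge_pos k).le (hb k))]
    exact mul_le_mul (M.gauge_le k) (hC k) (hb k) (one_div_nonneg.2 M.J_pos.le)
  have hmσ : 0 ≤ M.m * M.σ := mul_nonneg M.m_nonneg M.σ_nonneg
  have hmτ : 0 ≤ M.m * (M.ρ + M.τ) :=
    mul_nonneg M.m_nonneg (add_nonneg M.ρ_nonneg M.τ_nonneg)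
  have bI₁ := hmul (fun k => (M.I_pos k).1.le) M.I₁_le
  have bI₂ := hmul (fun k => (M.I_pos k).2) fun k =>
    (M.I₂_le k).trans (mul_le_mul_of_nonneg_left (M.I₁_le k) hmσ)
  have bK₂ := hmul (fun k => (M.K₂_pos k).le) fun k => M.K₂_anti k.zero_le
  have bK₁ := hmul M.K₁_nonneg fun k =>
    (M.K₁_le k).trans (mul_le_mul_of_nonneg_left (M.K₂_anti k.zero_le) hmτ)
  set u₁ : ℕ → ℂ := fun k => (M.gauge k * M.I₁ k : ℝ) * (M.p k * s k) with hu₁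
  set u₂ : ℕ → ℂ := fun k => (M.gauge k * M.I₂ k : ℝ) * (M.q k * r k) with hu₂
  set v₁ : ℕ → ℂ := fun k => (M.gauge k * M.K₁ k : ℝ) * (M.p k * s k) with hv₁
  set v₂ : ℕ → ℂ := fun k => (M.gauge k * M.K₂ k : ℝ) * (M.q k * r k) with hv₂
  have su₁ : Summable u₁ := summable_weighted hp M.p_summable bI₁ hEs
  have su₂ : Summable u₂ := summable_weighted hq M.q_summable bI₂ hEr
  have sv₁ : Summable v₁ := summable_weighted hp M.p_summable bK₁ hEs
  have sv₂ : Summable v₂ := summable_weighted hq M.q_summable bK₂ hEr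
  set W : ℕ → ℂ := fun k => ∑' j, v₁ (j + (k + 1)) + ∑' j, v₂ (j + k) with hW
  set P : ℕ → ℂ := fun k => ∑ j ∈ Finset.range (k + 1), u₁ j - ∑ j ∈ Finset.range k, u₂ j with hP
  have hWstep : ∀ k, W k = W (k + 1) + (v₁ (k + 1) + v₂ k) := fun k => by
    have e1 : ∑' j, v₁ (j + (k + 1)) = v₁ (k + 1) + ∑' j, v₁ (j + (k + 1 + 1)) := by
      rw [((summable_nat_add_iff (k + 1)).2 sv₁).tsum_eq_zero_add, zero_add]
      simp only [add_assoc, add_comm 1]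
    have e2 : ∑' j, v₂ (j + k) = v₂ k + ∑' j, v₂ (j + (k + 1)) := by
      rw [((summable_nat_add_iff k).2 sv₂).tsum_eq_zero_add, zero_add]
      simp only [add_assoc, add_comm 1]
    simp only [hW]
    rw [e1, e2]
    ring
  have hPstep : ∀ k, P (k + 1) = P k + u₁ (k + 1) - u₂ k := fun k => by
    simp only [hP]
    rw [Finset.sum_range_succ _ (k + 1), Finset.sum_range_succ u₂ k]
    ring
  have hP0 : P 0 = u₁ 0 := by simp [hP]
  have hWlim : Tendsto W atTop (𝓝 0) := by
    simpa using ((tendsto_sum_nat_add v₁).comp (tendsto_add_atTop_nat 1)).add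
      (tendsto_sum_nat_add v₂)
  have hPlim : Tendsto P atTop (𝓝 (∑' j, u₁ j - ∑' j, u₂ j)) :=
    (su₁.hasSum.tendsto_sum_nat.comp (tendsto_add_atTop_nat 1)).sub su₂.hasSum.tendsto_sum_nat
  have hIW : ∀ {b : ℕ → ℝ} {C : ℝ}, (∀ k, 0 ≤ b k) → (∀ k, b k ≤ C) →
      Tendsto (fun k => (b k : ℂ) * W k) atTop (𝓝 0) := fun {b C} hb hC => by
    refine squeeze_zero_norm (a := fun k => C * ‖W k‖) (fun k => ?_)
      (by simpa using hWlim.norm.const_mul C)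
    rw [norm_mul, Complex.norm_real, Real.norm_of_nonneg (hb k)]
    exact mul_le_mul_of_nonneg_right (hC k) (norm_nonneg _)
  have hK₁ := (Complex.continuous_ofReal.tendsto _).comp M.tendsto_K₁
  have hK₂ := (Complex.continuous_ofReal.tendsto _).comp M.tendsto_K₂
  refine ⟨fun k => M.I₁ k * W k + M.K₁ k * P k, fun k => M.K₂ k * P k - M.I₂ k * W k,
    ⟨fun k => ?_, ?_, fun k => ?_⟩, ∑' j, u₁ j - ∑' j, u₂ j, ?_, ?_⟩
  · have e1 := hWstep k
    have e2 := hPstep k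
    simp only [hu₁, hu₂, hv₁, hv₂] at e1 e2
    push_cast at e1 e2
    linear_combination M.c₁ k * M.I₁ (k + 1) * e1 - M.c₁ k * M.K₁ (k + 1) * e2
      - W k * M.I₁_stepC k + P k * M.K₁_stepC k
      + M.gauge k * M.K₂ k * M.q k * r k * M.I₁_stepC k
      - M.gauge k * M.I₂ k * M.q k * r k * M.K₁_stepC k + M.q k * r k * M.pairingC k
  · simp only [hP0, hu₁, M.I₁_zero, M.I₂_zero]
    push_cast
    have e := M.pairingC 0
    rw [M.I₁_zero, M.I₂_zero] at e
    push_cast at e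
    linear_combination M.p 0 * s 0 * e
  · have e1 := hWstep k
    have e2 := hPstep k
    simp only [hu₁, hu₂, hv₁, hv₂] at e1 e2
    push_cast at e1 e2
    linear_combination M.c₂ k * M.I₂ k * e1 + M.c₂ k * M.K₂ k * e2
      - P (k + 1) * M.K₂_stepC k - W (k + 1) * M.I₂_stepC k
      + M.gauge (k + 1) * M.I₁ (k + 1) * M.p (k + 1) * s (k + 1) * M.K₂_stepC k
      - M.gauge (k + 1) * M.K₁ (k + 1) * M.p (k + 1) * s (k + 1) * M.I₂_stepC k
      + M.p (k + 1) * s (k + 1) * M.pairingC (k + 1)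
  · have h := (hIW (fun k => (M.I_pos k).1.le) M.I₁_le).add (hK₁.mul hPlim)
    rw [zero_add, mul_comm] at h
    exact h
  · have h := (hK₂.mul hPlim).sub (hIW (fun k => (M.I_pos k).2) fun k =>
      (M.I₂_le k).trans (mul_le_mul_of_nonneg_left (M.I₁_le k) hmσ))
    rw [sub_zero, mul_comm] at h
    exact h

end Mode

/-! ### Modes of the quantum Dirac operator -/

variable {d : DiracData}

/-- The partial products of a sequence in `(0, 1]` with a nonzero infinite product stay above a
positive constant. -/
theorem exists_le_prod {c : ℕ → ℝ} (h0 : ∀ k, 0 < c k) (h1 : ∀ k, c k ≤ 1)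
    (h : ∃ J : ℝ, J ≠ 0 ∧ Tendsto (fun N => ∏ k ∈ Finset.range N, c k) atTop (𝓝 J)) :
    ∃ J : ℝ, 0 < J ∧ ∀ N, J ≤ ∏ k ∈ Finset.range N, c k := by
  obtain ⟨J, hJ, hlim⟩ := h
  have hpos : ∀ N, 0 < ∏ k ∈ Finset.range N, c k := fun N => Finset.prod_pos fun k _ => h0 k
  have hanti : Antitone fun N => ∏ k ∈ Finset.range N, c k := antitone_nat_of_succ_le fun N => by
    rw [Finset.prod_range_succ]
    exact mul_le_of_le_one_right (hpos N).le (h1 N)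
  exact ⟨J, lt_of_le_of_ne (ge_of_tendsto' hlim fun N => (hpos N).le) hJ.symm,
    fun N => hanti.le_of_tendsto hlim N⟩

theorem DiracData.exists_le_prods (d : DiracData) : ∃ J : ℕ → ℝ, ∀ n, 0 < J n ∧
    (∀ N, J n ≤ ∏ k ∈ Finset.range N, d.c₁ n k) ∧ ∀ N, J n ≤ ∏ k ∈ Finset.range N, d.c₂ n k := by
  have h : ∀ n, ∃ J : ℝ, 0 < J ∧ (∀ N, J ≤ ∏ k ∈ Finset.range N, d.c₁ n k) ∧
      ∀ N, J ≤ ∏ k ∈ Finset.range N, d.c₂ n k := fun n => by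
    obtain ⟨J₁, h₁, h₁'⟩ := exists_le_prod (d.c₁_pos n) (d.c₁_le_one n) (d.c₁_prod n)
    obtain ⟨J₂, h₂, h₂'⟩ := exists_le_prod (d.c₂_pos n) (d.c₂_le_one n) (d.c₂_prod n)
    exact ⟨min J₁ J₂, lt_min h₁ h₂, fun N => (min_le_left _ _).trans (h₁' N),
      fun N => (min_le_right _ _).trans (h₂' N)⟩
  exact ⟨fun n => (h n).choose, fun n => (h n).choose_spec⟩

namespace QuantumK

variable (K : QuantumK d)

theorem exists_ratio_le : ∃ R : ℝ, 0 ≤ R ∧ ∀ m : ℤ, m ≠ 0 → ∀ n,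
    |K.lim m n 0 / K.lim m n 1| ≤ R := by
  obtain ⟨ρ, hρ, h⟩ := K.ratio
  obtain ⟨R, hR⟩ := hρ.bddAbove_range_of_cofinite
  exact ⟨max R 0, le_max_right _ _, fun m hm n =>
    (h m hm n).trans ((hR ⟨m, rfl⟩).trans (le_max_left _ _))⟩

theorem val_succ (m : ℤ) (n k : ℕ) :
    K.val m n (k + 1) = (C d m n k).mulVec (K.val m n k) := by
  rw [K.val_eq m n (k + 1), K.val_eq m n k, Matrix.mulVec_mulVec, prodC]

theorem val_fst (m : ℤ) (n k : ℕ) : K.val m n k 0 =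
    d.c₁ n k * K.val m n (k + 1) 0 + m * (1 / d.a (n + 1) k) * K.val m n k 1 := by
  have h1 := (d.c₁_pos n k).ne'
  have h2 := (d.a_pos (n + 1) k).ne'
  rw [K.val_succ]
  simp only [C, Matrix.mulVec, dotProduct, Fin.sum_univ_two, Matrix.of_apply,
    Matrix.cons_val', Matrix.cons_val_zero, Matrix.cons_val_one, Matrix.cons_val_fin_one]
  field_simp
  ring

theorem val_snd (m : ℤ) (n k : ℕ) : d.c₂ n k * K.val m n k 1 =
    K.val m n (k + 1) 1 + m * (1 / d.a n (k + 1)) * K.val m n (k + 1) 0 := by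
  have h1 := (d.c₁_pos n k).ne'
  have h2 := (d.a_pos (n + 1) k).ne'
  have h3 := (d.a_pos n (k + 1)).ne'
  rw [K.val_succ]
  simp only [C, Matrix.mulVec, dotProduct, Fin.sum_univ_two, Matrix.of_apply,
    Matrix.cons_val', Matrix.cons_val_zero, Matrix.cons_val_one, Matrix.cons_val_fin_one]
  field_simp
  ring

theorem tendsto_val (m : ℤ) (n : ℕ) (i : Fin 2) :
    Tendsto (fun k => K.val m n k i) atTop (𝓝 (K.lim m n i)) :=
  (continuous_apply i).continuousAt.tendsto.comp (K.tendsto_lim m n)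

/-- Up to signs, the limit of a quantum `K` function is nonnegative and so is `m`. -/
theorem exists_signs (m : ℤ) (n : ℕ) : ∃ e₁ e₂ : ℝ, e₁ * e₁ = 1 ∧ e₂ * e₂ = 1 ∧
    e₁ * e₂ * m = |(m : ℝ)| ∧ 0 < e₂ * K.lim m n 1 ∧
    (0 < e₁ * K.lim m n 0 ∨ m = 0 ∧ e₁ * K.lim m n 0 = 0) := by
  rcases lt_trichotomy m 0 with hm | rfl | hm
  · have hm' : (m : ℝ) < 0 := by exact_mod_cast hm
    obtain ⟨h1, h2⟩ := K.sign_neg m n hm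
    refine ⟨-1, 1, by norm_num, by norm_num, ?_, by simpa using h2, Or.inl (by simpa using h1)⟩
    rw [abs_of_neg hm']; ring
  · obtain ⟨h1, h2⟩ := K.sign_zero n
    rcases lt_or_gt_of_ne h2 with h | h
    · exact ⟨-1, -1, by norm_num, by norm_num, by simp, by simpa using h,
        Or.inr ⟨rfl, by simp [h1]⟩⟩
    · exact ⟨1, 1, by norm_num, by norm_num, by simp, by simpa using h,
        Or.inr ⟨rfl, by simp [h1]⟩⟩
  · have hm' : (0 : ℝ) < m := by exact_mod_cast hm
    obtain ⟨h1, h2⟩ := K.sign_pos m n hm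
    refine ⟨1, 1, by norm_num, by norm_num, ?_, by simpa using h2, Or.inl (by simpa using h1)⟩
    rw [abs_of_pos hm']; ring

end QuantumK

/-- Positivity at infinity propagates to all `k`, since the recursion has nonnegative coefficients
when it is run backwards. -/
theorem nonneg_of_limits {μ : ℝ} {p q c₁ c₂ u w : ℕ → ℝ} {U W : ℝ} (hμ : 0 ≤ μ)
    (hp : ∀ k, 0 < p k) (hq : ∀ k, 0 < q k) (hc₁ : ∀ k, 0 < c₁ k) (hc₁' : ∀ k, c₁ k ≤ 1)
    (hc₂ : ∀ k, 0 < c₂ k) (hu : ∀ k, u k = c₁ k * u (k + 1) + μ * q k * w k)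
    (hw : ∀ k, c₂ k * w k = w (k + 1) + μ * p (k + 1) * u (k + 1))
    (hU : Tendsto u atTop (𝓝 U)) (hW : Tendsto w atTop (𝓝 W)) (hW0 : 0 < W)
    (hU0 : 0 < U ∨ μ = 0 ∧ U = 0) (k : ℕ) : 0 ≤ u k ∧ 0 < w k := by
  have hev : ∀ᶠ k in atTop, 0 ≤ u k ∧ 0 < w k := by
    refine Eventually.and ?_ (hW.eventually (lt_mem_nhds hW0))
    rcases hU0 with h | ⟨h, h0⟩
    · exact (hU.eventually (lt_mem_nhds h)).mono fun k hk => hk.le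
    · have hmono : Monotone fun k => |u k| := monotone_nat_of_le_succ fun k => by
        have : u k = c₁ k * u (k + 1) := by rw [hu k, h]; ring
        rw [this, abs_mul, abs_of_pos (hc₁ k)]
        exact mul_le_of_le_one_left (abs_nonneg _) (hc₁' k)
      refine Eventually.of_forall fun k => le_of_eq ?_
      have h1 := hmono.ge_of_tendsto hU.abs k
      rw [h0, abs_zero] at h1
      exact (abs_nonpos_iff.1 h1).symm
  have hback : ∀ k, (0 ≤ u (k + 1) ∧ 0 < w (k + 1)) → 0 ≤ u k ∧ 0 < w k := by
    rintro k ⟨h1, h2⟩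
    have hw' : 0 < w k := by
      refine pos_of_mul_pos_right (a := c₂ k) ?_ (hc₂ k).le
      rw [hw k]
      exact add_pos_of_pos_of_nonneg h2 (mul_nonneg (mul_nonneg hμ (hp _).le) h1)
    refine ⟨?_, hw'⟩
    rw [hu k]
    exact add_nonneg (mul_nonneg (hc₁ k).le h1) (mul_nonneg (mul_nonneg hμ (hq k).le) hw'.le)
  obtain ⟨N, hN⟩ := eventually_atTop.1 hev
  rcases le_total N k with h | h
  · exact hN k h
  · exact Nat.decreasingInduction (motive := fun j _ => 0 ≤ u j ∧ 0 < w j)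
      (fun j _ ih => hback j ih) (hN N le_rfl) h

/-- Each pair `(m, n)` gives rise to a mode with parameter `|m|`; `η` is the sign by which the
second component has to be multiplied. -/
theorem exists_mode (K : QuantumK d) {R : ℝ} (hR0 : 0 ≤ R)
    (hR : ∀ m : ℤ, m ≠ 0 → ∀ n, |K.lim m n 0 / K.lim m n 1| ≤ R) {J : ℝ} (m : ℤ) (n : ℕ)
    (hJ : 0 < J ∧ (∀ N, J ≤ ∏ k ∈ Finset.range N, d.c₁ n k) ∧
      ∀ N, J ≤ ∏ k ∈ Finset.range N, d.c₂ n k) :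
    ∃ (M : Mode) (η z : ℝ), M.p = (fun k => 1 / d.a n k) ∧ M.q = (fun k => 1 / d.a (n + 1) k) ∧
      M.c₁ = d.c₁ n ∧ M.c₂ = d.c₂ n ∧ M.ρ = R ∧ M.J = J ∧ M.m = |(m : ℝ)| ∧ η * η = 1 ∧
      M.m = η * m ∧ z ≠ 0 ∧ K.lim m n 0 = z * M.lim₁ ∧ K.lim m n 1 = η * z * M.lim₂ := by
  obtain ⟨e₁, e₂, he₁, he₂, hm, hlim₂, hlim₁⟩ := K.exists_signs m n
  have hp : ∀ k, 0 < 1 / d.a n k := fun k => one_div_pos.2 (d.a_pos n k)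
  have hq : ∀ k, 0 < 1 / d.a (n + 1) k := fun k => one_div_pos.2 (d.a_pos (n + 1) k)
  set u : ℕ → ℝ := fun k => e₁ * K.val m n k 0 with hu
  set w : ℕ → ℝ := fun k => e₂ * K.val m n k 1 with hw
  have hustep : ∀ k, u k = d.c₁ n k * u (k + 1) + |(m : ℝ)| * (1 / d.a (n + 1) k) * w k :=
    fun k => by
      simp only [hu, hw, ← hm]
      linear_combination e₁ * K.val_fst m n k -
        e₁ * m * (1 / d.a (n + 1) k) * K.val m n k 1 * he₂
  have hwstep : ∀ k, d.c₂ n k * w k =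
      w (k + 1) + |(m : ℝ)| * (1 / d.a n (k + 1)) * u (k + 1) := fun k => by
    simp only [hu, hw, ← hm]
    linear_combination e₂ * K.val_snd m n k -
      e₂ * m * (1 / d.a n (k + 1)) * K.val m n (k + 1) 0 * he₁
  have hulim : Tendsto u atTop (𝓝 (e₁ * K.lim m n 0)) := (K.tendsto_val m n 0).const_mul e₁
  have hwlim : Tendsto w atTop (𝓝 (e₂ * K.lim m n 1)) := (K.tendsto_val m n 1).const_mul e₂
  have hpos := nonneg_of_limits (abs_nonneg (m : ℝ)) hp hq (d.c₁_pos n) (d.c₁_le_one n)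
    (d.c₂_pos n) hustep hwstep hulim hwlim hlim₂
    (hlim₁.imp_right fun h => ⟨by simp [h.1], h.2⟩)
  have hlim₁' : 0 ≤ e₁ * K.lim m n 0 := hlim₁.elim le_of_lt fun h => h.2.ge
  set N : ℝ := w 0 + |(m : ℝ)| * (1 / d.a n 0) * u 0 with hN
  have hN0 : 0 < N := add_pos_of_pos_of_nonneg (hpos 0).2
    (mul_nonneg (mul_nonneg (abs_nonneg _) (hp 0).le) (hpos 0).1)
  have hratio : e₁ * K.lim m n 0 ≤ |(m : ℝ)| * R * (e₂ * K.lim m n 1) := by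
    rcases hlim₁ with h | ⟨_, h⟩
    · have hm0 : m ≠ 0 := by
        rintro rfl
        rw [(K.sign_zero n).1, mul_zero] at h
        exact lt_irrefl _ h
      have h1 : (1 : ℝ) ≤ |(m : ℝ)| := by exact_mod_cast Int.one_le_abs hm0
      have h2 := hR m hm0 n
      have ha : ∀ e : ℝ, e * e = 1 → |e| = 1 := fun e he => by
        rw [← abs_mul_abs_self, ← sq] at he
        exact (pow_eq_one_iff_of_nonneg (abs_nonneg e) two_ne_zero).1 he
      rw [abs_div, div_le_iff₀ (abs_pos.2 (fun h0 => by simp [h0] at hlim₂))] at h2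
      have h3 : |K.lim m n 0| = e₁ * K.lim m n 0 := by
        rw [← abs_of_pos h, abs_mul, ha e₁ he₁, one_mul]
      have h4 : |K.lim m n 1| = e₂ * K.lim m n 1 := by
        rw [← abs_of_pos hlim₂, abs_mul, ha e₂ he₂, one_mul]
      rw [h3, h4] at h2
      have h5 := mul_le_mul_of_nonneg_right h1 (mul_nonneg hR0 hlim₂.le)
      linarith
    · rw [h]
      exact mul_nonneg (mul_nonneg (abs_nonneg _) hR0) hlim₂.le
  let M : Mode :=
    { m := |(m : ℝ)|
      p := fun k => 1 / d.a n k
      q := fun k => 1 / d.a (n + 1) k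
      c₁ := d.c₁ n
      c₂ := d.c₂ n
      K₁ := fun k => u k / N
      K₂ := fun k => w k / N
      lim₁ := e₁ * K.lim m n 0 / N
      lim₂ := e₂ * K.lim m n 1 / N
      ρ := R
      J := J
      m_nonneg := abs_nonneg _
      ρ_nonneg := hR0
      J_pos := hJ.1
      p_pos := hp
      q_pos := hq
      p_summable := d.a_summable n
      q_summable := d.a_summable (n + 1)
      c₁_pos := d.c₁_pos n
      c₂_pos := d.c₂_pos n
      c₁_le_one := d.c₁_le_one n
      c₂_le_one := d.c₂_le_one n
      J_le_prod₁ := hJ.2.1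
      J_le_prod₂ := hJ.2.2
      K₁_step := fun k => by rw [hustep k]; ring
      K₂_step := fun k => by rw [← mul_div_assoc, hwstep k]; ring
      K₁_nonneg := fun k => div_nonneg (hpos k).1 hN0.le
      K₂_pos := fun k => div_pos (hpos k).2 hN0
      tendsto_K₁ := hulim.div_const N
      tendsto_K₂ := hwlim.div_const N
      lim₁_nonneg := div_nonneg hlim₁' hN0.le
      lim₂_pos := div_pos hlim₂ hN0
      lim_le := by
        rw [← mul_div_assoc]
        exact div_le_div_of_nonneg_right hratio hN0.le
      normalized := by
        rw [← mul_div_assoc, ← add_div]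
        exact div_self hN0.ne' }
  refine ⟨M, e₁ * e₂, e₁ * N, rfl, rfl, rfl, rfl, rfl, rfl, rfl, ?_, hm.symm, ?_, ?_, ?_⟩
  · linear_combination he₁ + e₁ * e₁ * he₂
  · refine mul_ne_zero (fun h => ?_) hN0.ne'
    rw [h] at he₁
    norm_num at he₁
  · change K.lim m n 0 = e₁ * N * (e₁ * K.lim m n 0 / N)
    rw [mul_div_assoc', eq_div_iff hN0.ne']
    linear_combination -N * K.lim m n 0 * he₁
  · change K.lim m n 1 = e₁ * e₂ * (e₁ * N) * (e₂ * K.lim m n 1 / N)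
    rw [mul_div_assoc', eq_div_iff hN0.ne']
    linear_combination -N * K.lim m n 1 * (he₁ + e₁ * e₁ * he₂)

/-- The coupled equations `B̄_n x - m y = r`, `B_n y + m x = s`. -/
def ModeSystem (d : DiracData) (m : ℤ) (n : ℕ) (x y r s : ℕ → ℂ) : Prop :=
  (∀ k, Bbar d n x k - m * y k = r k) ∧ ∀ k, B d n y k + m * x k = s k

/-- Partial sums of the squared norm of a pair `(x, y)` with weights `1 / a_n` and
`1 / a_{n + 1}`. -/
def modeSum (d : DiracData) (n : ℕ) (x y : ℕ → ℂ) (t : Finset ℕ) : ℝ :=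
  ∑ k ∈ t, (‖x k‖ ^ 2 / d.a n k + ‖y k‖ ^ 2 / d.a (n + 1) k)

theorem modeSystem_iff {M : Mode} {η : ℝ} {m : ℤ} {n : ℕ} (hp : M.p = fun k => 1 / d.a n k)
    (hq : M.q = fun k => 1 / d.a (n + 1) k) (hc₁ : M.c₁ = d.c₁ n) (hc₂ : M.c₂ = d.c₂ n)
    (hη : η * η = 1) (hm : M.m = η * m) (x y r s : ℕ → ℂ) :
    ModeSystem d m n x y r s ↔ M.IsSol x (fun k => η * y k) r (fun k => η * s k) := by
  have hηC : (η : ℂ) * η = 1 := by exact_mod_cast hη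
  have hη0 : (η : ℂ) ≠ 0 := fun h => by simp [h] at hηC
  have ha : ∀ n k, (d.a n k : ℂ) ≠ 0 := fun n k => by exact_mod_cast (d.a_pos n k).ne'
  have hpC : ∀ k, (M.p k : ℂ) = 1 / d.a n k := fun k => by rw [hp]; push_cast; rfl
  have hqC : ∀ k, (M.q k : ℂ) = 1 / d.a (n + 1) k := fun k => by rw [hq]; push_cast; rfl
  have hmC : (M.m : ℂ) = η * m := by rw [hm]; push_cast; rfl
  have e1 : ∀ k, (Bbar d n x k - m * y k = r k ↔
      x k = M.c₁ k * x (k + 1) + M.q k * (M.m * (η * y k) + r k)) := fun k => by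
    rw [hqC, hmC, hc₁, Bbar, show (η * m * (η * y k) + r k : ℂ) = m * y k + r k by
      linear_combination (m * y k : ℂ) * hηC]
    have h := ha (n + 1) k
    constructor
    · intro h1
      rw [← h1]
      field_simp
      ring
    · intro h1
      have h2 : x k - d.c₁ n k * x (k + 1) = 1 / d.a (n + 1) k * (m * y k + r k) := by
        linear_combination h1
      rw [h2]
      field_simp
      ring
  have e2 : B d n y 0 + m * x 0 = s 0 ↔ η * y 0 = M.p 0 * (η * s 0 - M.m * x 0) := by
    have h := ha n 0
    rw [hpC, hmC, B, show (η * s 0 - η * m * x 0 : ℂ) = η * (s 0 - m * x 0) by ring,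
      ← mul_left_comm, mul_right_inj' hη0, one_div, eq_inv_mul_iff_mul_eq₀ h]
    constructor
    · intro h1; linear_combination h1
    · intro h1; linear_combination h1
  have e3 : ∀ k, (B d n y (k + 1) + m * x (k + 1) = s (k + 1) ↔ η * y (k + 1) =
      M.c₂ k * (η * y k) + M.p (k + 1) * (η * s (k + 1) - M.m * x (k + 1))) := fun k => by
    have h := ha n (k + 1)
    rw [hpC, hmC, hc₂, B, show (d.c₂ n k * (η * y k) + 1 / d.a n (k + 1) *
      (η * s (k + 1) - η * m * x (k + 1)) : ℂ) = η * (d.c₂ n k * y k + 1 / d.a n (k + 1) *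
      (s (k + 1) - m * x (k + 1))) by ring, mul_right_inj' hη0]
    constructor
    · intro h1
      rw [← h1]
      field_simp
      ring
    · intro h1
      rw [h1]
      field_simp
      ring
  constructor
  · rintro ⟨h1, h2⟩
    exact ⟨fun k => (e1 k).1 (h1 k), e2.1 (h2 0), fun k => (e3 k).1 (h2 (k + 1))⟩
  · rintro ⟨h1, h2, h3⟩
    refine ⟨fun k => (e1 k).2 (h1 k), fun k => ?_⟩
    cases k with
    | zero => exact e2.2 h2
    | succ k => exact (e3 k).2 (h3 k)

theorem boundaryCondition_iff {K : QuantumK d} {M : Mode} {η z : ℝ} {m : ℤ} {n : ℕ}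
    (hη : η * η = 1) (hz : z ≠ 0) (h₁ : K.lim m n 0 = z * M.lim₁)
    (h₂ : K.lim m n 1 = η * z * M.lim₂) (x y : ℕ → ℂ) :
    BoundaryCondition K m n x y ↔ M.Bdry x (fun k => η * y k) := by
  have hηC : (η : ℂ) * η = 1 := by exact_mod_cast hη
  have hzC : (z : ℂ) ≠ 0 := by exact_mod_cast hz
  have h₁C : (K.lim m n 0 : ℂ) = z * M.lim₁ := by exact_mod_cast h₁
  have h₂C : (K.lim m n 1 : ℂ) = η * z * M.lim₂ := by exact_mod_cast h₂
  constructor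
  · rintro ⟨β, hx, hy⟩
    refine ⟨β * z, ?_, ?_⟩
    · rwa [mul_assoc, ← h₁C]
    · have h := hy.const_mul (η : ℂ)
      rwa [h₂C, show (η : ℂ) * (β * (η * z * M.lim₂)) = β * z * M.lim₂ by
        linear_combination (β * z * M.lim₂ : ℂ) * hηC] at h
  · rintro ⟨β, hx, hy⟩
    refine ⟨β / z, ?_, ?_⟩
    · rwa [h₁C, ← mul_assoc, div_mul_cancel₀ _ hzC]
    · have h := hy.const_mul (η : ℂ)
      rw [h₂C, show β / z * (η * z * M.lim₂) = η * (β * M.lim₂) by field_simp]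
      refine h.congr fun k => ?_
      linear_combination y k * hηC

/-- What is proved about one mode, in terms of the original data. The bounds are those of
`Mode.IsSol.apriori` and `Mode.IsSol.energy`. -/
theorem mode_solution (K : QuantumK d) {R : ℝ} (hR0 : 0 ≤ R)
    (hR : ∀ m : ℤ, m ≠ 0 → ∀ n, |K.lim m n 0 / K.lim m n 1| ≤ R) {J : ℝ} (m : ℤ) (n : ℕ)
    (hJ : 0 < J ∧ (∀ N, J ≤ ∏ k ∈ Finset.range N, d.c₁ n k) ∧
      ∀ N, J ≤ ∏ k ∈ Finset.range N, d.c₂ n k) :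
    (∀ x y r s E, ModeSystem d m n x y r s → BoundaryCondition K m n x y →
      (∀ L, modeSum d n s r (Finset.range L) ≤ E) → ∀ L, modeSum d n x y (Finset.range L) ≤
        40 * (∑' k, 1 / d.a n k) * (R + ∑' k, 1 / d.a (n + 1) k) * E ∧
      (m ≠ 0 → modeSum d n x y (Finset.range L) ≤ 1 / (J * m) ^ 2 * E)) ∧
    (∀ ε > 0, ∃ N, ∀ x y r s E, ModeSystem d m n x y r s → BoundaryCondition K m n x y →
      (∀ L, modeSum d n s r (Finset.range L) ≤ E) →
        ∀ L, modeSum d n x y (Finset.Ico N L) ≤ ε * E) ∧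
    (∀ r s E, (∀ L, modeSum d n s r (Finset.range L) ≤ E) →
      ∃ x y, ModeSystem d m n x y r s ∧ BoundaryCondition K m n x y) := by
  obtain ⟨M, η, z, hp, hq, hc₁, hc₂, hρ, hJM, hmabs, hη, hm, hz, h₁, h₂⟩ :=
    exists_mode K hR0 hR m n hJ
  have hηnorm : ‖(η : ℂ)‖ ^ 2 = 1 := by
    rw [Complex.norm_real, Real.norm_eq_abs, sq_abs, sq, hη]
  have hsys := modeSystem_iff hp hq hc₁ hc₂ hη hm
  have hbdry := boundaryCondition_iff hη hz h₁ h₂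
  have hηy : ∀ y : ℂ, ‖(η : ℂ) * y‖ ^ 2 = ‖y‖ ^ 2 := fun y => by
    rw [norm_mul, mul_pow, hηnorm, one_mul]
  have hsum : ∀ x y t, ∑ k ∈ t, (M.p k * ‖x k‖ ^ 2 + M.q k * ‖(η : ℂ) * y k‖ ^ 2) =
      modeSum d n x y t := fun x y t =>
    Finset.sum_congr rfl fun k _ => by rw [hηy, hp, hq]; ring
  have hdata : ∀ {r s : ℕ → ℂ} {E : ℝ}, (∀ L, modeSum d n s r (Finset.range L) ≤ E) →
      M.DataBound r (fun k => η * s k) E := fun {r s E} h L => by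
    refine le_of_eq_of_le (Finset.sum_congr rfl fun k _ => ?_) (h L)
    rw [hηy, hp, hq]
    ring
  refine ⟨fun x y r s E h hb hE L => ⟨?_, fun hm0 => ?_⟩, fun ε hε => ?_, fun r s E hE => ?_⟩
  · have h3 := ((hsys x y r s).1 h).apriori ((hbdry x y).1 hb) (hdata hE) L
    rwa [hsum, Mode.σ, Mode.τ, hp, hq, hρ] at h3
  · have hpos : 0 < M.m := by rw [hmabs]; exact abs_pos.2 (by exact_mod_cast hm0)
    have h3 := ((hsys x y r s).1 h).energy ((hbdry x y).1 hb) hpos (hdata hE) L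
    rwa [hsum, hJM, hmabs, mul_pow, sq_abs, ← mul_pow] at h3
  · obtain ⟨N, hN⟩ := M.exists_tail_bound hε
    refine ⟨N, fun x y r s E h hb hE L => ?_⟩
    rw [← hsum]
    exact hN x _ r _ E ((hsys x y r s).1 h) ((hbdry x y).1 hb) (hdata hE) L
  · obtain ⟨x, y, h, hb⟩ := M.exists_isSol (hdata hE)
    have hy : (fun k => (η : ℂ) * (η * y k)) = y := by
      funext k
      have hηC : (η : ℂ) * η = 1 := by exact_mod_cast hη
      linear_combination y k * hηC
    refine ⟨x, fun k => η * y k, (hsys _ _ _ _).2 ?_, (hbdry _ _).2 ?_⟩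
    · rwa [hy]
    · rwa [hy]

/-- The norms of the solution operators of the modes tend to zero. For large `n` this follows
from the bound which is uniform in `m`, for each of the remaining `n` from the energy estimate. -/
theorem exists_mode_bound (K : QuantumK d) : ∃ b : ℤ × ℕ → ℝ,
    Tendsto b cofinite (𝓝 0) ∧ ∀ m n x y r s E, ModeSystem d m n x y r s →
      BoundaryCondition K m n x y → (∀ L, modeSum d n s r (Finset.range L) ≤ E) →
        ∀ L, modeSum d n x y (Finset.range L) ≤ b (m, n) * E := by
  obtain ⟨R, hR0, hR⟩ := K.exists_ratio_le
  obtain ⟨J, hJ⟩ := d.exists_le_prods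
  set S : ℕ → ℝ := fun n => ∑' k, 1 / d.a n k with hS
  set b₁ : ℕ → ℝ := fun n => 40 * S n * (R + S (n + 1)) with hb₁
  -- at `m = 0` there is no energy estimate, and `1 / (J * m) ^ 2` would be the junk value `0`
  set b₂ : ℤ × ℕ → ℝ := fun i => if i.1 = 0 then b₁ i.2 else 1 / (J i.2 * i.1) ^ 2 with hb₂
  have hS0 : ∀ n, 0 ≤ S n := fun n => tsum_nonneg fun k => (one_div_pos.2 (d.a_pos n k)).le
  have hb₁0 : ∀ n, 0 ≤ b₁ n := fun n =>
    mul_nonneg (mul_nonneg (by norm_num) (hS0 n)) (add_nonneg hR0 (hS0 _))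
  have hb₂0 : ∀ i, 0 ≤ b₂ i := fun i => by
    simp only [hb₂]
    split_ifs
    exacts [hb₁0 _, by positivity]
  have hb₁lim : Tendsto b₁ atTop (𝓝 0) := by
    simpa [hb₁, hS] using (d.a_tendsto.const_mul 40).mul
      ((d.a_tendsto.comp (tendsto_add_atTop_nat 1)).const_add R)
  have hb₂lim : ∀ n, Tendsto (fun m : ℤ => b₂ (m, n)) cofinite (𝓝 0) := fun n => by
    have h1 : Tendsto (fun m : ℤ => J n * (m : ℝ)) cofinite (Bornology.cobounded ℝ) := by
      rw [Metric.cobounded_eq_cocompact]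
      exact (Homeomorph.mulLeft₀ (J n) (hJ n).1.ne').isClosedEmbedding.tendsto_cocompact.comp
        Int.tendsto_coe_cofinite
    have h2 : Tendsto (fun m : ℤ => 1 / (J n * (m : ℝ)) ^ 2) cofinite (𝓝 0) := by
      have h := (tendsto_inv₀_cobounded.comp h1).pow 2
      rw [zero_pow two_ne_zero] at h
      refine h.congr fun m => ?_
      simp only [Function.comp_apply, inv_pow, one_div]
    refine h2.congr' ?_
    have h3 : ∀ᶠ m : ℤ in cofinite, m ≠ 0 := by
      rw [eventually_cofinite]
      exact (Set.finite_singleton (0 : ℤ)).subset fun m hm => not_not.1 hm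
    filter_upwards [h3] with m hm
    simp [hb₂, hm]
  refine ⟨fun i => min (b₁ i.2) (b₂ i), ?_, fun m n x y r s E h hb hE L => ?_⟩
  · rw [tendsto_order]
    refine ⟨fun ε hε => Eventually.of_forall fun i => hε.trans_le (le_min (hb₁0 _) (hb₂0 _)),
      fun ε hε => ?_⟩
    obtain ⟨n₀, hn₀⟩ := eventually_atTop.1 (hb₁lim.eventually_lt_const hε)
    rw [eventually_cofinite]
    refine (Set.Finite.biUnion (Finset.range n₀).finite_toSet fun n _ =>
      (eventually_cofinite.1 ((hb₂lim n).eventually_lt_const hε)).image fun m => (m, n)).subset ?_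
    rintro ⟨m, n⟩ hi
    simp only [Set.mem_ofPred_eq, min_lt_iff, not_or] at hi
    refine Set.mem_biUnion (x := n) ?_ ⟨m, hi.2, rfl⟩
    rw [Finset.mem_coe, Finset.mem_range]
    by_contra hn
    exact hi.1 (hn₀ n (not_lt.1 hn))
  · have hE0 : 0 ≤ E := by simpa [modeSum] using hE 0
    obtain ⟨h1, h2⟩ := (mode_solution K hR0 hR m n (hJ n)).1 x y r s E h hb hE L
    rw [min_mul_of_nonneg _ _ hE0]
    refine le_min h1 ?_
    simp only [hb₂]
    split_ifs with hm
    exacts [h1, h2 hm]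

theorem exists_mode_tail_bound (K : QuantumK d) (m : ℤ) (n : ℕ) {ε : ℝ} (hε : 0 < ε) :
    ∃ N, ∀ x y r s E, ModeSystem d m n x y r s → BoundaryCondition K m n x y →
      (∀ L, modeSum d n s r (Finset.range L) ≤ E) →
        ∀ L, modeSum d n x y (Finset.Ico N L) ≤ ε * E := by
  obtain ⟨R, hR0, hR⟩ := K.exists_ratio_le
  obtain ⟨J, hJ⟩ := d.exists_le_prods
  exact (mode_solution K hR0 hR m n (hJ n)).2.1 ε hε

theorem exists_modeSystem (K : QuantumK d) (m : ℤ) (n : ℕ) {r s : ℕ → ℂ} {E : ℝ}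
    (hE : ∀ L, modeSum d n s r (Finset.range L) ≤ E) :
    ∃ x y, ModeSystem d m n x y r s ∧ BoundaryCondition K m n x y := by
  obtain ⟨R, hR0, hR⟩ := K.exists_ratio_le
  obtain ⟨J, hJ⟩ := d.exists_le_prods
  exact (mode_solution K hR0 hR m n (hJ n)).2.2 r s E hE

/-! ### Pairs of rows -/

/-- The equations coupling the rows `f = f_{m,ν}` and `g = g_{m,ν-1}` in `D (f, g) = (u, v)`, where
`u`, `v` are the rows with the same indices. -/
def PairSystem (d : DiracData) (m ν : ℤ) (f g u v : ℕ → ℂ) : Prop :=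
  (∀ k, m * f k + (if 1 ≤ ν then -Bbar d (ν - 1).toNat g k else B d (-ν).toNat g k) = u k) ∧
  ∀ k, (if 0 ≤ ν - 1 then -B d (ν - 1).toNat f k else Bbar d (-(ν - 1) - 1).toNat f k) -
    m * g k = v k

/-- The boundary condition relating `f_{m,ν}` and `g_{m,ν-1}`. -/
def PairBoundary (Kp Kn : QuantumK d) (m ν : ℤ) (f g : ℕ → ℂ) : Prop :=
  if 1 ≤ ν then BoundaryCondition Kp m (ν - 1).toNat g f
  else BoundaryCondition Kn m (-ν).toNat f g

/-- Partial sums of the squared norm of the rows `f_{m,ν}` and `g_{m,ν-1}`. -/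
def pairSum (d : DiracData) (ν : ℤ) (f g : ℕ → ℂ) (t : Finset ℕ) : ℝ :=
  ∑ k ∈ t, (‖f k‖ ^ 2 / d.a ν.natAbs k + ‖g k‖ ^ 2 / d.a (ν - 1).natAbs k)

theorem modeSum_neg (n : ℕ) (x y : ℕ → ℂ) (t : Finset ℕ) :
    modeSum d n (fun k => -x k) (fun k => -y k) t = modeSum d n x y t := by
  simp [modeSum]

theorem pairSystem_succ (m : ℤ) (n : ℕ) (f g u v : ℕ → ℂ) :
    PairSystem d m (n + 1) f g u v ↔
      ModeSystem d m n g f (fun k => -u k) (fun k => -v k) := by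
  simp only [PairSystem, ModeSystem, add_sub_cancel_right, Int.toNat_natCast, Nat.cast_nonneg,
    if_true, show (1 : ℤ) ≤ n + 1 by omega]
  refine and_congr (forall_congr' fun k => ?_) (forall_congr' fun k => ?_)
  · constructor <;> intro h <;> linear_combination -h
  · constructor <;> intro h <;> linear_combination -h

theorem pairSystem_neg (m : ℤ) (n : ℕ) (f g u v : ℕ → ℂ) :
    PairSystem d m (-n) f g u v ↔ ModeSystem d m n f g v u := by
  simp only [PairSystem, ModeSystem, neg_neg, Int.toNat_natCast,
    if_neg (show ¬ (1 : ℤ) ≤ -n by omega), if_neg (show ¬ (0 : ℤ) ≤ -n - 1 by omega),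
    show (-(-(n : ℤ) - 1) - 1) = n by ring]
  rw [and_comm]
  refine and_congr Iff.rfl (forall_congr' fun k => ?_)
  rw [add_comm]

theorem pairSum_succ (n : ℕ) (f g : ℕ → ℂ) (t : Finset ℕ) :
    pairSum d (n + 1) f g t = modeSum d n g f t := by
  refine Finset.sum_congr rfl fun k _ => ?_
  rw [add_sub_cancel_right, Int.natAbs_natCast, show ((n : ℤ) + 1).natAbs = n + 1 by omega,
    add_comm]

theorem pairSum_neg (n : ℕ) (f g : ℕ → ℂ) (t : Finset ℕ) :
    pairSum d (-n) f g t = modeSum d n f g t := by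
  refine Finset.sum_congr rfl fun k _ => ?_
  rw [show (-(n : ℤ)).natAbs = n by omega, show (-(n : ℤ) - 1).natAbs = n + 1 by omega]

theorem pairBoundary_succ (Kp Kn : QuantumK d) (m : ℤ) (n : ℕ) (f g : ℕ → ℂ) :
    PairBoundary Kp Kn m (n + 1) f g ↔ BoundaryCondition Kp m n g f := by
  simp only [PairBoundary, add_sub_cancel_right, Int.toNat_natCast,
    if_pos (show (1 : ℤ) ≤ n + 1 by omega)]

theorem pairBoundary_neg (Kp Kn : QuantumK d) (m : ℤ) (n : ℕ) (f g : ℕ → ℂ) :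
    PairBoundary Kp Kn m (-n) f g ↔ BoundaryCondition Kn m n f g := by
  simp only [PairBoundary, neg_neg, Int.toNat_natCast, if_neg (show ¬ (1 : ℤ) ≤ -n by omega)]

theorem exists_eq_succ_or_neg (ν : ℤ) : ∃ n : ℕ, ν = n + 1 ∨ ν = -n := by
  rcases le_or_gt 1 ν with h | h
  · exact ⟨(ν - 1).toNat, Or.inl (by omega)⟩
  · exact ⟨(-ν).toNat, Or.inr (by omega)⟩

theorem exists_pairSystem (Kp Kn : QuantumK d) (m ν : ℤ) {u v : ℕ → ℂ} {E : ℝ}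
    (hE : ∀ L, pairSum d ν u v (Finset.range L) ≤ E) :
    ∃ f g, PairSystem d m ν f g u v ∧ PairBoundary Kp Kn m ν f g := by
  obtain ⟨n, rfl | rfl⟩ := exists_eq_succ_or_neg ν
  · simp only [pairSum_succ] at hE
    obtain ⟨g, f, h, hb⟩ := exists_modeSystem Kp m n (r := fun k => -u k) (s := fun k => -v k)
      (E := E) (fun L => by rw [modeSum_neg]; exact hE L)
    exact ⟨f, g, (pairSystem_succ m n f g u v).2 h, (pairBoundary_succ Kp Kn m n f g).2 hb⟩
  · simp only [pairSum_neg] at hE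
    obtain ⟨f, g, h, hb⟩ := exists_modeSystem Kn m n hE
    exact ⟨f, g, (pairSystem_neg m n f g u v).2 h, (pairBoundary_neg Kp Kn m n f g).2 hb⟩

theorem exists_pair_bound (Kp Kn : QuantumK d) : ∃ b : ℤ × ℤ → ℝ,
    Tendsto b cofinite (𝓝 0) ∧ ∀ m ν f g u v E, PairSystem d m ν f g u v →
      PairBoundary Kp Kn m ν f g → (∀ L, pairSum d ν u v (Finset.range L) ≤ E) →
        ∀ L, pairSum d ν f g (Finset.range L) ≤ b (m, ν) * E := by
  obtain ⟨b, hb, h⟩ := exists_mode_bound Kp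
  obtain ⟨b', hb', h'⟩ := exists_mode_bound Kn
  refine ⟨fun i => if 1 ≤ i.2 then b (i.1, (i.2 - 1).toNat) else b' (i.1, (-i.2).toNat), ?_,
    fun m ν f g u v E hs hbd hE L => ?_⟩
  · intro U hU
    have h1 := mem_cofinite.1 (hb hU)
    have h2 := mem_cofinite.1 (hb' hU)
    refine mem_cofinite.2 (((h1.image fun i => (i.1, (i.2 : ℤ) + 1)).union
      (h2.image fun i => (i.1, -(i.2 : ℤ)))).subset ?_)
    rintro ⟨m, ν⟩ hi
    obtain ⟨n, rfl | rfl⟩ := exists_eq_succ_or_neg ν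
    · refine Or.inl ⟨(m, n), fun hn => hi ?_, rfl⟩
      simpa [show (1 : ℤ) ≤ n + 1 by omega] using hn
    · refine Or.inr ⟨(m, n), fun hn => hi ?_, rfl⟩
      simpa [show ¬ (1 : ℤ) ≤ -n by omega] using hn
  · obtain ⟨n, rfl | rfl⟩ := exists_eq_succ_or_neg ν
    · simp only [pairSum_succ] at hE ⊢
      have := h m n g f _ _ E ((pairSystem_succ m n f g u v).1 hs)
        ((pairBoundary_succ Kp Kn m n f g).1 hbd) (fun L => by rw [modeSum_neg]; exact hE L) L
      simpa [show (1 : ℤ) ≤ n + 1 by omega] using this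
    · simp only [pairSum_neg] at hE ⊢
      have := h' m n f g _ _ E ((pairSystem_neg m n f g u v).1 hs)
        ((pairBoundary_neg Kp Kn m n f g).1 hbd) hE L
      simpa [show ¬ (1 : ℤ) ≤ -n by omega] using this

theorem exists_pair_tail_bound (Kp Kn : QuantumK d) (m ν : ℤ) {ε : ℝ} (hε : 0 < ε) :
    ∃ N, ∀ f g u v E, PairSystem d m ν f g u v → PairBoundary Kp Kn m ν f g →
      (∀ L, pairSum d ν u v (Finset.range L) ≤ E) →
        ∀ L, pairSum d ν f g (Finset.Ico N L) ≤ ε * E := by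
  obtain ⟨n, rfl | rfl⟩ := exists_eq_succ_or_neg ν
  · obtain ⟨N, hN⟩ := exists_mode_tail_bound Kp m n hε
    refine ⟨N, fun f g u v E hs hb hE L => ?_⟩
    simp only [pairSum_succ] at hE ⊢
    exact hN g f _ _ E ((pairSystem_succ m n f g u v).1 hs)
      ((pairBoundary_succ Kp Kn m n f g).1 hb) (fun L => by rw [modeSum_neg]; exact hE L) L
  · obtain ⟨N, hN⟩ := exists_mode_tail_bound Kn m n hε
    refine ⟨N, fun f g u v E hs hb hE L => ?_⟩
    simp only [pairSum_neg] at hE ⊢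
    exact hN f g _ _ E ((pairSystem_neg m n f g u v).1 hs)
      ((pairBoundary_neg Kp Kn m n f g).1 hb) hE L

/-- For every `ε` the tails of the rows are small compared to the data, and only finitely many rows
have to be cut at all. -/
theorem exists_uniform_tail_bound (Kp Kn : QuantumK d) {ε : ℝ} (hε : 0 < ε) :
    ∃ N : ℤ → ℤ → ℕ, {i : ℤ × ℤ | N i.1 i.2 ≠ 0}.Finite ∧ ∀ m ν f g u v E,
      PairSystem d m ν f g u v → PairBoundary Kp Kn m ν f g →
        (∀ L, pairSum d ν u v (Finset.range L) ≤ E) →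
          ∀ L, pairSum d ν f g (Finset.Ico (N m ν) L) ≤ ε * E := by
  obtain ⟨b, hb, h⟩ := exists_pair_bound Kp Kn
  have hfin := eventually_cofinite.1 (hb.eventually_le_const hε)
  refine ⟨fun m ν => if b (m, ν) ≤ ε then 0 else (exists_pair_tail_bound Kp Kn m ν hε).choose,
    hfin.subset fun i hi hle => hi (if_pos hle), fun m ν f g u v E hs hbd hE L => ?_⟩
  beta_reduce
  split_ifs with hle
  · have hE0 : 0 ≤ E := by simpa [pairSum] using hE 0
    rw [← Finset.range_eq_Ico]
    exact (h m ν f g u v E hs hbd hE L).trans (mul_le_mul_of_nonneg_right hle hE0)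
  · exact (exists_pair_tail_bound Kp Kn m ν hε).choose_spec f g u v E hs hbd hE L

/-- Row-wise bounds for finite sums add up. -/
theorem sum_le_of_rows {A W : Idx → ℝ} (hA : ∀ i, 0 ≤ A i) (hW : ∀ i, 0 ≤ W i)
    (hsum : Summable W) {c : ℝ} (hc : 0 ≤ c)
    (h : ∀ m ν L, ∑ k ∈ Finset.range L, A (m, ν, k) ≤ c * ∑' k, W (m, ν, k)) (t : Finset Idx) :
    ∑ i ∈ t, A i ≤ c * ∑' i, W i := by
  classical
  set e : (ℤ × ℤ) × ℕ ≃ Idx := Equiv.prodAssoc ℤ ℤ ℕ with he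
  have hsum' : Summable (W ∘ e) := e.summable_iff.2 hsum
  set T : Finset (ℤ × ℤ) := t.image fun i => (i.1, i.2.1) with hT
  obtain ⟨L, hL⟩ := (t.image fun i => i.2.2).exists_nat_subset_range
  have hsub : t ⊆ (T ×ˢ Finset.range L).map e.toEmbedding := by
    rintro ⟨m, ν, k⟩ hi
    rw [Finset.mem_map]
    exact ⟨((m, ν), k), Finset.mem_product.2 ⟨Finset.mem_image.2 ⟨_, hi, rfl⟩,
      hL (Finset.mem_image.2 ⟨_, hi, rfl⟩)⟩, rfl⟩
  calc ∑ i ∈ t, A i ≤ ∑ i ∈ (T ×ˢ Finset.range L).map e.toEmbedding, A i :=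
        Finset.sum_le_sum_of_subset_of_nonneg hsub fun i _ _ => hA i
    _ = ∑ j ∈ T, ∑ k ∈ Finset.range L, A (j.1, j.2, k) := by
        rw [Finset.sum_map, Finset.sum_product]
        rfl
    _ ≤ ∑ j ∈ T, c * ∑' k, W (j.1, j.2, k) := Finset.sum_le_sum fun j _ => h j.1 j.2 L
    _ = c * ∑ j ∈ T, ∑' k, (W ∘ e) (j, k) := by rw [← Finset.mul_sum]; rfl
    _ ≤ c * ∑' j, ∑' k, (W ∘ e) (j, k) := mul_le_mul_of_nonneg_left
        (hsum'.prod.sum_le_tsum T fun j _ => tsum_nonneg fun k => hW _) hc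
    _ = c * ∑' i, W i := by rw [← hsum'.tsum_prod, ← e.tsum_eq W]; rfl

/-- A bounded operator into `ℓ²` whose values have uniformly small tails is compact, being a limit
of operators of finite rank. -/
theorem isCompactOperator_of_tails {ι V : Type*} [NormedAddCommGroup V] [NormedSpace ℂ V]
    (T : V →L[ℂ] lp (fun _ : ι => ℂ) 2)
    (h : ∀ ε > 0, ∃ S : Finset ι, ∀ v, ‖T v‖ ^ 2 - ∑ i ∈ S, ‖T v i‖ ^ 2 ≤ ε * ‖v‖ ^ 2) :
    IsCompactOperator T := by
  classical
  set P : Finset ι → V →L[ℂ] lp (fun _ : ι => ℂ) 2 := fun S => ∑ i ∈ S,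
    ((lp.singleContinuousLinearMap ℂ (fun _ : ι => ℂ) 2 i).comp
      (lp.evalCLM ℂ (fun _ : ι => ℂ) 2 i)).comp T with hP
  have hPcomp : ∀ S, P S ∈ compactOperator (RingHom.id ℂ) V (lp (fun _ : ι => ℂ) 2) := fun S =>
    Submodule.sum_mem _ fun i _ => by
      have h1 : IsCompactOperator (lp.singleContinuousLinearMap ℂ (fun _ : ι => ℂ) 2 i) :=
        isCompactOperator_of_locallyCompactSpace_rng _
      exact h1.comp_clm ((lp.evalCLM ℂ (fun _ : ι => ℂ) 2 i).comp T)
  have hmem : T ∈ (compactOperator (RingHom.id ℂ) V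
      (lp (fun _ : ι => ℂ) 2)).topologicalClosure := by
    refine Metric.mem_closure_iff.2 fun δ hδ => ?_
    obtain ⟨S, hS⟩ := h ((δ / 2) ^ 2) (by positivity)
    refine ⟨P S, hPcomp S, ?_⟩
    rw [dist_eq_norm]
    refine (ContinuousLinearMap.opNorm_le_bound _ (by positivity) fun v => ?_).trans_lt
      (half_lt_self hδ)
    have h1 := lp.norm_compl_sum_single (p := 2) (by norm_num) (T v) S
    simp only [ENNReal.toReal_ofNat, Real.rpow_ofNat] at h1
    have h2 : (T - P S) v = T v - ∑ i ∈ S, lp.single 2 i (T v i) := by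
      simp [hP]
      rfl
    rw [h2]
    refine le_of_sq_le_sq ?_ (by positivity)
    rw [h1, mul_pow]
    exact hS v
  rwa [compactOperator_topologicalClosure] at hmem

/-! ### The inverse of the Dirac operator -/

/-- The shift `ν ↦ ν - 1` of indices, pairing the rows of `f` with those of `g`. -/
def shiftIdx : Idx ≃ Idx where
  toFun i := (i.1, i.2.1 - 1, i.2.2)
  invFun i := (i.1, i.2.1 + 1, i.2.2)
  left_inv i := by simp
  right_inv i := by simp

/-- The contribution of `f_{m,ν}(k)` and `g_{m,ν-1}(k)` to the squared norm of `(f, g)`. -/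
def pairTerm (d : DiracData) (f g : FormalSeries) (i : Idx) : ℝ :=
  ‖f i‖ ^ 2 / wt d i + ‖g (shiftIdx i)‖ ^ 2 / wt d (shiftIdx i)

theorem term_nonneg (f : FormalSeries) (i : Idx) : 0 ≤ ‖f i‖ ^ 2 / wt d i :=
  div_nonneg (sq_nonneg _) (wt_pos d i).le

theorem pairTerm_nonneg (f g : FormalSeries) (i : Idx) : 0 ≤ pairTerm d f g i :=
  add_nonneg (term_nonneg f i) (term_nonneg g _)

theorem summable_pairTerm {f g : FormalSeries} (hf : FiniteNorm d f) (hg : FiniteNorm d g) :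
    Summable (pairTerm d f g) :=
  Summable.add hf (shiftIdx.summable_iff.2 hg)

theorem tsum_pairTerm (F : H d) : ∑' i, pairTerm d F.fst.coeff F.snd.coeff i = ‖F‖ ^ 2 := by
  have hf : Summable fun i => ‖F.fst.coeff i‖ ^ 2 / wt d i := F.fst.coeff_finiteNorm
  have hg : Summable fun i => ‖F.snd.coeff i‖ ^ 2 / wt d i := F.snd.coeff_finiteNorm
  rw [WithLp.prod_norm_sq_eq_of_L2, H0.norm_sq_eq, H0.norm_sq_eq,
    ← shiftIdx.tsum_eq fun i => ‖F.snd.coeff i‖ ^ 2 / wt d i]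
  exact hf.tsum_add (shiftIdx.summable_iff.2 hg)

/-- The row `k ↦ f (m, ν, k)`. -/
def row (f : FormalSeries) (m ν : ℤ) (k : ℕ) : ℂ := f (m, ν, k)

theorem sum_pairTerm (f g : FormalSeries) (m ν : ℤ) (t : Finset ℕ) :
    ∑ k ∈ t, pairTerm d f g (m, ν, k) = pairSum d ν (row f m ν) (row g m (ν - 1)) t := rfl

theorem pairSystem_dirac (f g : FormalSeries) (m ν : ℤ) :
    PairSystem d m ν (row f m ν) (row g m (ν - 1)) (row (delta1 f + delta0 d g) m ν)
      (row (delta2 d f - delta1 g) m (ν - 1)) := by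
  refine ⟨fun k => rfl, fun k => ?_⟩
  change _ = (if 0 ≤ ν - 1 then -B d (ν - 1).toNat (fun j => f (m, ν - 1 + 1, j)) k
    else Bbar d (-(ν - 1) - 1).toNat (fun j => f (m, ν - 1 + 1, j)) k) - m * g (m, ν - 1, k)
  simp only [sub_add_cancel]
  rfl

/-- The boundary condition in the definition of the domain, row by row. -/
theorem pairBoundary_iff (Kp Kn : QuantumK d) (f g : FormalSeries) :
    (∀ m ν, PairBoundary Kp Kn m ν (row f m ν) (row g m (ν - 1))) ↔
      (∀ (m : ℤ) (n : ℕ), BoundaryCondition Kp m n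
        (fun k => g (m, n, k)) (fun k => f (m, n + 1, k))) ∧
      (∀ (m : ℤ) (n : ℕ), BoundaryCondition Kn m n
        (fun k => f (m, -n, k)) (fun k => g (m, -(n + 1), k))) := by
  have e1 : ∀ (m : ℤ) (n : ℕ), PairBoundary Kp Kn m (n + 1) (row f m (n + 1))
      (row g m (n + 1 - 1)) ↔ BoundaryCondition Kp m n
        (fun k => g (m, n, k)) (fun k => f (m, n + 1, k)) := fun m n => by
    rw [pairBoundary_succ, add_sub_cancel_right]
    rfl
  have e2 : ∀ (m : ℤ) (n : ℕ), PairBoundary Kp Kn m (-n) (row f m (-n))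
      (row g m (-n - 1)) ↔ BoundaryCondition Kn m n
        (fun k => f (m, -n, k)) (fun k => g (m, -(n + 1), k)) := fun m n => by
    rw [pairBoundary_neg, show -(n : ℤ) - 1 = -(n + 1) by ring]
    rfl
  refine ⟨fun h => ⟨fun m n => (e1 m n).1 (h m _), fun m n => (e2 m n).1 (h m _)⟩,
    fun h m ν => ?_⟩
  obtain ⟨n, rfl | rfl⟩ := exists_eq_succ_or_neg ν
  exacts [(e1 m n).2 (h.1 m n), (e2 m n).2 (h.2 m n)]

theorem rowData_le (G : H d) (m ν : ℤ) (L : ℕ) :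
    pairSum d ν (row G.fst.coeff m ν) (row G.snd.coeff m (ν - 1)) (Finset.range L) ≤
      ∑' k, pairTerm d G.fst.coeff G.snd.coeff (m, ν, k) := by
  have hs := summable_pairTerm G.fst.coeff_finiteNorm G.snd.coeff_finiteNorm
  have hinj : Function.Injective fun k : ℕ => ((m, ν, k) : Idx) := fun k k' h => by
    simpa using h
  rw [← sum_pairTerm]
  exact (hs.comp_injective hinj).sum_le_tsum _ fun k _ => pairTerm_nonneg _ _ _

variable (Kp Kn : QuantumK d)

theorem pairSystem_domain (F : (dirac Kp Kn).domain) (m ν : ℤ) :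
    PairSystem d m ν (row F.1.fst.coeff m ν) (row F.1.snd.coeff m (ν - 1))
      (row (dirac Kp Kn F).fst.coeff m ν) (row (dirac Kp Kn F).snd.coeff m (ν - 1)) :=
  pairSystem_dirac _ _ m ν

theorem pairBoundary_domain (F : (dirac Kp Kn).domain) (m ν : ℤ) :
    PairBoundary Kp Kn m ν (row F.1.fst.coeff m ν) (row F.1.snd.coeff m (ν - 1)) :=
  (pairBoundary_iff Kp Kn _ _).2 F.2.2 m ν

/-- A bound for the norms of all row solution operators. -/
theorem exists_pair_bound_const : ∃ c : ℝ, 0 ≤ c ∧ ∀ m ν f g u v E, PairSystem d m ν f g u v →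
    PairBoundary Kp Kn m ν f g → (∀ L, pairSum d ν u v (Finset.range L) ≤ E) →
      ∀ L, pairSum d ν f g (Finset.range L) ≤ c * E := by
  obtain ⟨b, hb, h⟩ := exists_pair_bound Kp Kn
  obtain ⟨c, hc⟩ := hb.bddAbove_range_of_cofinite
  refine ⟨max c 0, le_max_right _ _, fun m ν f g u v E hs hbd hE L =>
    (h m ν f g u v E hs hbd hE L).trans (mul_le_mul_of_nonneg_right
      ((hc ⟨_, rfl⟩).trans (le_max_left _ _)) (by simpa [pairSum] using hE 0))⟩

theorem exists_dirac_eq (G : H d) : ∃ F : (dirac Kp Kn).domain, dirac Kp Kn F = G := by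
  obtain ⟨c, hc, hbound⟩ := exists_pair_bound_const Kp Kn
  have hsol := fun m ν => exists_pairSystem Kp Kn m ν (rowData_le G m ν)
  choose x y hsys hbdry using hsol
  set f : FormalSeries := fun i => x i.1 i.2.1 i.2.2 with hf
  set g : FormalSeries := fun i => y i.1 (i.2.1 + 1) i.2.2 with hg
  have hfrow : ∀ m ν, row f m ν = x m ν := fun m ν => rfl
  have hgrow : ∀ m ν, row g m (ν - 1) = y m ν := fun m ν => by
    funext k
    simp only [row, hg, sub_add_cancel]
  have hsum : Summable (pairTerm d f g) := by
    refine summable_of_sum_le (pairTerm_nonneg f g) (sum_le_of_rows (pairTerm_nonneg f g)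
      (pairTerm_nonneg G.fst.coeff G.snd.coeff)
      (summable_pairTerm G.fst.coeff_finiteNorm G.snd.coeff_finiteNorm) hc fun m ν L => ?_)
    rw [sum_pairTerm, hfrow, hgrow]
    exact hbound m ν _ _ _ _ _ (hsys m ν) (hbdry m ν) (rowData_le G m ν) L
  have hfn : FiniteNorm d f := Summable.of_nonneg_of_le (term_nonneg f)
    (fun i => le_add_of_nonneg_right (term_nonneg g _)) hsum
  have hgn : FiniteNorm d g := by
    have h : Summable ((fun i => ‖g i‖ ^ 2 / wt d i) ∘ shiftIdx) :=
      Summable.of_nonneg_of_le (fun i => term_nonneg g _)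
        (fun i => le_add_of_nonneg_left (term_nonneg f i)) hsum
    exact shiftIdx.summable_iff.1 h
  -- the equations of the rows say that `D (f, g) = G`
  have hrow := fun m ν => pairSystem_dirac (d := d) f g m ν
  have h1 : delta1 f + delta0 d g = G.fst.coeff := by
    funext ⟨m, ν, k⟩
    have e1 := (hrow m ν).1 k
    rw [hfrow, hgrow, (hsys m ν).1 k] at e1
    exact e1.symm
  have h2 : delta2 d f - delta1 g = G.snd.coeff := by
    funext ⟨m, ν, k⟩
    obtain ⟨ν, rfl⟩ : ∃ ν', ν = ν' - 1 := ⟨ν + 1, by ring⟩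
    have e1 := (hrow m ν).2 k
    rw [hfrow, hgrow, (hsys m ν).2 k] at e1
    exact e1.symm
  have hdom : (WithLp.toLp 2 (H0.mk f hfn, H0.mk g hgn) : H d) ∈ (dirac Kp Kn).domain := by
    refine ⟨⟨?_, ?_⟩, (pairBoundary_iff Kp Kn f g).1 fun m ν => ?_⟩
    · change FiniteNorm d (delta1 f + delta0 d g)
      rw [h1]
      exact G.fst.coeff_finiteNorm
    · change FiniteNorm d (delta2 d f - delta1 g)
      rw [h2]
      exact G.snd.coeff_finiteNorm
    · rw [hfrow, hgrow]
      exact hbdry m ν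
  refine ⟨⟨_, hdom⟩, (WithLp.equiv 2 (H0 d × H0 d)).injective (Prod.ext (H0.ext ?_) (H0.ext ?_))⟩
  · exact h1
  · exact h2

theorem exists_norm_le : ∃ c : ℝ, 0 ≤ c ∧ ∀ F : (dirac Kp Kn).domain,
    ‖(F : H d)‖ ≤ c * ‖dirac Kp Kn F‖ := by
  obtain ⟨c, hc, hbound⟩ := exists_pair_bound_const Kp Kn
  refine ⟨√c, Real.sqrt_nonneg c, fun F => ?_⟩
  refine le_of_sq_le_sq ?_ (mul_nonneg (Real.sqrt_nonneg c) (norm_nonneg _))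
  rw [mul_pow, Real.sq_sqrt hc, ← tsum_pairTerm, ← tsum_pairTerm]
  refine Real.tsum_le_of_sum_le (pairTerm_nonneg _ _) (sum_le_of_rows (pairTerm_nonneg _ _)
    (pairTerm_nonneg _ _) (summable_pairTerm (dirac Kp Kn F).fst.coeff_finiteNorm
      (dirac Kp Kn F).snd.coeff_finiteNorm) hc fun m ν L => ?_)
  rw [sum_pairTerm]
  exact hbound m ν _ _ _ _ _ (pairSystem_domain Kp Kn F m ν) (pairBoundary_domain Kp Kn F m ν)
    (rowData_le _ m ν) L

/-- On the domain, the squared norm of `F` outside a suitable finite set of indices is small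
compared to that of `D F`. -/
theorem exists_finset_tail {ε : ℝ} (hε : 0 < ε) : ∃ S : Finset Idx,
    ∀ F : (dirac Kp Kn).domain, ∀ t : Finset Idx, Disjoint t S →
      ∑ i ∈ t, pairTerm d F.1.fst.coeff F.1.snd.coeff i ≤ ε * ‖dirac Kp Kn F‖ ^ 2 := by
  obtain ⟨N, hfin, hN⟩ := exists_uniform_tail_bound Kp Kn hε
  have hS : {i : Idx | i.2.2 < N i.1 i.2.1}.Finite := by
    refine (Set.Finite.biUnion hfin fun j _ =>
      (Finset.range (N j.1 j.2)).finite_toSet.image fun k => ((j.1, j.2, k) : Idx)).subset ?_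
    rintro ⟨m, ν, k⟩ hk
    exact Set.mem_biUnion (x := (m, ν)) (fun h0 => by simp [h0] at hk)
      ⟨k, Finset.mem_coe.2 (Finset.mem_range.2 hk), rfl⟩
  refine ⟨hS.toFinset, fun F t ht => ?_⟩
  set A : Idx → ℝ := fun i =>
    if N i.1 i.2.1 ≤ i.2.2 then pairTerm d F.1.fst.coeff F.1.snd.coeff i else 0 with hA
  have hA0 : ∀ i, 0 ≤ A i := fun i => by
    simp only [hA]
    split_ifs
    exacts [pairTerm_nonneg _ _ _, le_rfl]
  have hAt : ∑ i ∈ t, pairTerm d F.1.fst.coeff F.1.snd.coeff i = ∑ i ∈ t, A i := by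
    refine Finset.sum_congr rfl fun i hi => ?_
    have h1 : i ∉ hS.toFinset := Finset.disjoint_left.1 ht hi
    rw [Set.Finite.mem_toFinset] at h1
    exact (if_pos (not_lt.1 h1)).symm
  rw [hAt, ← tsum_pairTerm]
  refine sum_le_of_rows hA0 (pairTerm_nonneg _ _)
    (summable_pairTerm (dirac Kp Kn F).fst.coeff_finiteNorm
      (dirac Kp Kn F).snd.coeff_finiteNorm) hε.le (fun m ν L => ?_) t
  have h1 : ∑ k ∈ Finset.range L, A (m, ν, k) = ∑ k ∈ Finset.Ico (N m ν) L,
      pairTerm d F.1.fst.coeff F.1.snd.coeff (m, ν, k)  := by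
    simp only [hA]
    exact sum_range_ite_ge fun k => pairTerm d F.1.fst.coeff F.1.snd.coeff (m, ν, k)
  rw [h1, sum_pairTerm]
  exact hN m ν _ _ _ _ _ (pairSystem_domain Kp Kn F m ν) (pairBoundary_domain Kp Kn F m ν)
    (rowData_le _ m ν) L

/-- A bounded operator into `𝓗₀` is compact if the coefficients of its values have uniformly small
tails. -/
theorem isCompactOperator_H0 {V : Type*} [NormedAddCommGroup V] [NormedSpace ℂ V]
    (T : V →L[ℂ] H0 d)
    (h : ∀ ε > 0, ∃ S : Finset Idx, ∀ v, ∀ t : Finset Idx, Disjoint t S →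
      ∑ i ∈ t, ‖(T v).coeff i‖ ^ 2 / wt d i ≤ ε * ‖v‖ ^ 2) : IsCompactOperator T := by
  classical
  let e : H0 d ≃ₗᵢ[ℂ] lp (fun _ : Idx => ℂ) 2 := ⟨H0.scale, fun f => (H0.norm_def f).symm⟩
  have he : ∀ f i, ‖e f i‖ ^ 2 = ‖f.coeff i‖ ^ 2 / wt d i := fun f i => norm_scaled_sq d _ i
  have hc : IsCompactOperator (e.toContinuousLinearEquiv.toContinuousLinearMap.comp T) := by
    refine isCompactOperator_of_tails _ fun ε hε => ?_
    obtain ⟨S, hS⟩ := h ε hε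
    refine ⟨S, fun v => ?_⟩
    change ‖e (T v)‖ ^ 2 - ∑ i ∈ S, ‖e (T v) i‖ ^ 2 ≤ _
    rw [e.norm_map, H0.norm_sq_eq, Finset.sum_congr rfl fun i _ => he (T v) i, sub_le_iff_le_add]
    refine Real.tsum_le_of_sum_le (term_nonneg _) fun t => ?_
    have h1 := hS v (t \ S) Finset.sdiff_disjoint
    have h2 : ∑ i ∈ t, ‖(T v).coeff i‖ ^ 2 / wt d i ≤
        ∑ i ∈ (t \ S) ∪ S, ‖(T v).coeff i‖ ^ 2 / wt d i :=
      Finset.sum_le_sum_of_subset_of_nonneg (by rw [Finset.sdiff_union_self_eq_union]; exact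
        Finset.subset_union_left) fun i _ _ => term_nonneg _ i
    rw [Finset.sum_union Finset.sdiff_disjoint] at h2
    linarith
  have h1 := hc.clm_comp e.symm.toContinuousLinearEquiv.toContinuousLinearMap
  have hT : (T : V → H0 d) = e.symm.toContinuousLinearEquiv.toContinuousLinearMap ∘
      (e.toContinuousLinearEquiv.toContinuousLinearMap.comp T) :=
    funext fun v => (e.symm_apply_apply (T v)).symm
  rw [hT]
  exact h1

/-- The operator `D` has a compact inverse. -/
theorem exists_compact_inverse : ∃ Q : H d →L[ℂ] H d,
    (∀ G : H d, ∃ hG : Q G ∈ (dirac Kp Kn).domain, dirac Kp Kn ⟨Q G, hG⟩ = G) ∧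
    (∀ F : (dirac Kp Kn).domain, Q (dirac Kp Kn F) = F) ∧ IsCompactOperator Q := by
  obtain ⟨c, hc, hbound⟩ := exists_norm_le Kp Kn
  have hinj : Function.Injective (dirac Kp Kn).toFun := by
    rw [← LinearMap.ker_eq_bot, LinearMap.ker_eq_bot']
    intro F hF
    have h1 := hbound F
    rw [show dirac Kp Kn F = 0 from hF, norm_zero, mul_zero] at h1
    exact Subtype.ext (norm_le_zero_iff.1 h1)
  let e := LinearEquiv.ofBijective (dirac Kp Kn).toFun ⟨hinj, fun G => exists_dirac_eq Kp Kn G⟩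
  have he : ∀ G, dirac Kp Kn (e.symm G) = G := fun G => e.apply_symm_apply G
  let Q : H d →L[ℂ] H d := ((dirac Kp Kn).domain.subtype ∘ₗ e.symm.toLinearMap).mkContinuous c
    fun G => by
      have h1 := hbound (e.symm G)
      rwa [he] at h1
  have hQ : ∀ G, Q G = (e.symm G : H d) := fun G => rfl
  refine ⟨Q, fun G => ⟨(e.symm G).2, he G⟩, fun F => ?_, ?_⟩
  · rw [hQ]
    exact congrArg Subtype.val (e.symm_apply_apply F)
  · have h1 : IsCompactOperator ((WithLp.fstL 2 ℂ (H0 d) (H0 d)).comp Q) := by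
      refine isCompactOperator_H0 _ fun ε hε => ?_
      obtain ⟨S, hS⟩ := exists_finset_tail Kp Kn hε
      refine ⟨S, fun G t ht => ?_⟩
      have h2 := hS (e.symm G) t ht
      rw [he] at h2
      exact (Finset.sum_le_sum fun i _ => le_add_of_nonneg_right (term_nonneg _ _)).trans h2
    have h2 : IsCompactOperator ((WithLp.sndL 2 ℂ (H0 d) (H0 d)).comp Q) := by
      refine isCompactOperator_H0 _ fun ε hε => ?_
      obtain ⟨S, hS⟩ := exists_finset_tail Kp Kn hε
      refine ⟨S.map shiftIdx.toEmbedding, fun G t ht => ?_⟩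
      have h3 := hS (e.symm G) (t.map shiftIdx.symm.toEmbedding) (by
        rw [Finset.disjoint_left] at ht ⊢
        intro i hi hiS
        obtain ⟨j, hj, rfl⟩ := Finset.mem_map.1 hi
        exact ht hj (Finset.mem_map.2 ⟨_, hiS, shiftIdx.apply_symm_apply j⟩))
      rw [he, Finset.sum_map] at h3
      refine (Finset.sum_le_sum fun i _ => ?_).trans h3
      have h4 : shiftIdx (shiftIdx.symm.toEmbedding i) = i := shiftIdx.apply_symm_apply i
      rw [pairTerm, h4]
      exact le_add_of_nonneg_left (term_nonneg _ _)
    let j := (WithLp.prodContinuousLinearEquiv 2 ℂ (H0 d) (H0 d)).symm.toContinuousLinearMap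
    have h3 := (h1.clm_comp (j.comp (ContinuousLinearMap.inl ℂ (H0 d) (H0 d)))).add
      (h2.clm_comp (j.comp (ContinuousLinearMap.inr ℂ (H0 d) (H0 d))))
    have hsum : (Q : H d → H d) =
        (j.comp (ContinuousLinearMap.inl ℂ (H0 d) (H0 d))) ∘
          ((WithLp.fstL 2 ℂ (H0 d) (H0 d)).comp Q) +
        (j.comp (ContinuousLinearMap.inr ℂ (H0 d) (H0 d))) ∘
          ((WithLp.sndL 2 ℂ (H0 d) (H0 d)).comp Q) := by
      funext G
      refine (WithLp.equiv 2 (H0 d × H0 d)).injective (Prod.ext ?_ ?_)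
      · exact (add_zero _).symm
      · exact (zero_add _).symm
    rw [hsum]
    exact h3

end QuantumSolidTorus

end

theorem mainTheorem1 (d : QuantumSolidTorus.DiracData) (Kp Kn : QuantumSolidTorus.QuantumK d) :
    ∃ Q : QuantumSolidTorus.H d →L[ℂ] QuantumSolidTorus.H d,
      (∀ G : QuantumSolidTorus.H d, ∃ hG : Q G ∈ (QuantumSolidTorus.dirac Kp Kn).domain,
        QuantumSolidTorus.dirac Kp Kn ⟨Q G, hG⟩ = G) ∧
      (∀ F : (QuantumSolidTorus.dirac Kp Kn).domain,
        Q (QuantumSolidTorus.dirac Kp Kn F) = F) ∧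
      IsCompactOperator Q :=
  QuantumSolidTorus.exists_compact_inverse Kp Kn
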